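/- **Setting.** Let $d\ge 1$, let $\|\cdot\|$ be any norm on $\mathbb R^d$ and let $\nu$ be a compactly supported Borel probability measure on $\mathbb R^d$. For $n\in\mathbb N$ and $r\in\mathbb R$ put $d(x,A)=\min_{y\in A}\|x-y\|$ and $$\mathfrak e_{n,r}(\nu)=\inf_{1\le \operatorname{card}A\le n}\Big(\int d(x,A)^r\,d\nu(x)\Big)^{1/r}\ (r\ne0),\qquad \mathfrak e_{n,0}(\nu)=\inf_{1\le \operatorname{card}A\le n}\exp\int\log d(x,A)\,d\nu(x)$$ (a bracket is $0$ if $r<0$ and the integral is $+\infty$). The upper and lower quantization dimensions $\overline D_r(\nu)$, $\underline D_r(\nu)$ are the $\limsup$ and $\liminf$ of $\log n/(-\log \mathfrak e_{n,r}(\nu))$ as $n\to\infty$, with $1/\log 0=0$; if they agree, the common value is $D_r(\nu)$. Let $\dim_H(\nu)=\inf\{\dim_H(A): A \text{ Borel},\ \nu(A)>0\}$. Fix $s>0$ and $b\in\mathbb R^d$ such that the image $\mu$ of $\nu$ under $x\mapsto sx+b$ satisfies $\mu(\mathcal Q)=1$, where $\mathcal Q=(0,1]^d$ (if already $\nu(\mathcal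 Q)=1$ one may take $\mu=\nu$). Let $\mathcal D_n$ be the partition of $\mathcal Q$ into half-open dyadic cubes of side $2^{-n}$, $\mathcal D=\bigcup_{n\ge0}\mathcal D_n$, $\Lambda$ the Lebesgue measure, and put $$\dim_\infty=\liminf_{n\to\infty}\frac{\max_{Q\in\mathcal D_n}\log\mu(Q)}{\log 2^{-n}},\qquad \beta(q)=\limsup_{n\to\infty}\frac{\log\sum_{Q\in\mathcal D_n,\ \mu(Q)>0}\mu(Q)^q}{\log 2^n}.$$ For $r>-\dim_\infty$ and $Q\in\mathcal D$ put $$\mathfrak J_r(Q)=\max_{Q'\in\mathcal D,\ Q'\subset Q}\mu(Q')\Lambda(Q')^{r/d},\qquad \tau_r(q)=\limsup_{n\to\infty}\frac{\log\sum_{Q\in\mathcal D_n,\ \mathfrak J_r(Q)>0}\mathfrak J_r(Q)^q}{\log 2^n},\qquad q_r=\inf\{q>0:\tau_r(q)<0\}.$$ Let $\mathcal M_r(x)$ be the minimal cardinality of a finite partition $P$ of $\mathcal Q$ into cubes of $\mathcal D$ with $\max_{Q\in P}\mathfrak J_r(Q)<1/x$, and $$\overline h_r=\limsup_{x\to\infty}\frac{\log\mathcal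 M_r(x)}{\log x},\qquad \underline h_r=\lim_{\varepsilon\downarrow0}\ \liminf_{x\to\infty}\frac{\log\mathcal M_{r-\varepsilon}(x)}{\log x}.$$ With $N_{\alpha,r}(n)=\operatorname{card}\{Q\in\mathcal D_n:\mathfrak J_r(Q)\ge2^{-\alpha n}\}$ let $$\overline F_r=\sup_{\alpha>0}\frac1\alpha\limsup_{n\to\infty}\frac{\log^+N_{\alpha,r}(n)}{\log 2^n},\qquad \underline F_r=\sup_{\alpha>0}\frac1\alpha\liminf_{n\to\infty}\frac{\log^+N_{\alpha,r}(n)}{\log 2^n}.$$ **Theorem 1.6.** (1) For $r\in(0,\infty)$, the limit defining $\underline h_r$ exists, the numbers $\underline F_r,\underline h_r,\overline h_r,q_r,\overline F_r$ lie in $[0,1)$, and $$\frac{r\underline F_r}{1-\underline F_r}\le\underline D_r(\nu)\le\frac{r\underline h_r}{1-\underline h_r}\le\frac{r\overline h_r}{1-\overline h_r}=\overline D_r(\nu)=\frac{rq_r}{1-q_r}=\frac{r\overline F_r}{1-\overline F_r}.$$ (2) For $r\in(-\dim_\infty,0)$: (a) $\overline F_r,q_r,\overline h_r$ lie in $(1,\infty)$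 and $$\frac{r\overline F_r}{1-\overline F_r}=\frac{rq_r}{1-q_r}=\underline D_r(\nu)=\frac{r\overline h_r}{1-\overline h_r};$$ (b) if $\underline F_r>1$, then the limit defining $\underline h_r$ exists, $\underline h_r,\underline F_r$ lie in $(1,\infty)$ and $$\frac{r\overline h_r}{1-\overline h_r}\le\frac{r\underline h_r}{1-\underline h_r}\le\overline D_r(\nu)\le\frac{r\underline F_r}{1-\underline F_r}.$$ (3) If $\dim_\infty>0$ and $r\mapsto q_r$ is differentiable at $0$, then $\beta$ is finite near $1$ and differentiable at $1$, $D_0(\nu)$ exists, and $$D_0(\nu)=-\beta'(1)=\dim_H(\nu).$$ -/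

import Mathlib

open MeasureTheory Filter Topology
open scoped ENNReal

noncomputable section

namespace Quantization

/-! ### Quantization errors and quantization dimensions

Points of `ℝ^d` are functions `Fin d → ℝ`; the norm that measures the quantization error is an
arbitrary norm `N` on `ℝ^d`, given as a seminorm that vanishes only at `0`. -/

/-- `d(x, A) = min_{y ∈ A} N (x - y)` for a finite set `A`, as an extended nonnegative number. -/
def distTo {d : ℕ} (N : Seminorm ℝ (Fin d → ℝ)) (A : Finset (Fin d → ℝ)) (x : Fin d → ℝ) :
    ℝ≥0∞ :=
  ⨅ y ∈ A, ENNReal.ofReal (N (x - y))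

/-- The integral `∫ f⁺ dν - ∫ f⁻ dν` of an extended real function (here used for functions whose
positive part has a finite integral; the value `-∞` is allowed). -/
def eintegral {X : Type*} [MeasurableSpace X] (ν : Measure X) (f : X → EReal) : EReal :=
  ((∫⁻ x, (f x).toENNReal ∂ν : ℝ≥0∞) : EReal) - ((∫⁻ x, (-f x).toENNReal ∂ν : ℝ≥0∞) : EReal)

/-- The error of order `r` of the approximation of `ν` by the points of `A`:
`(∫ d(x,A)^r dν)^(1/r)` if `r ≠ 0` (so it is `0` if `r < 0` and the integral is infinite), and
`exp (∫ log d(x,A) dν)` if `r = 0`, with `log 0 = -∞` and `exp (-∞) = 0`. -/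
def errorOf {d : ℕ} (N : Seminorm ℝ (Fin d → ℝ)) (ν : Measure (Fin d → ℝ)) (r : ℝ)
    (A : Finset (Fin d → ℝ)) : ℝ≥0∞ :=
  if r = 0 then EReal.exp (eintegral ν fun x => ENNReal.log (distTo N A x))
  else (∫⁻ x, distTo N A x ^ r ∂ν) ^ (1 / r)

/-- The `n`-th quantization error of `ν` of order `r`: the infimum over all sets of at least one
and at most `n` points. -/
def quantError {d : ℕ} (N : Seminorm ℝ (Fin d → ℝ)) (ν : Measure (Fin d → ℝ)) (n : ℕ) (r : ℝ) :
    ℝ≥0∞ :=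
  ⨅ (A : Finset (Fin d → ℝ)) (_ : 1 ≤ A.card ∧ A.card ≤ n), errorOf N ν r A

/-- `log n / (- log e_{n,r}(ν))`. It is `0` if the error vanishes, because `Real.log 0 = 0` and
`x / 0 = 0`; this is the convention `1 / log 0 = 0`. -/
def quantRatio {d : ℕ} (N : Seminorm ℝ (Fin d → ℝ)) (ν : Measure (Fin d → ℝ)) (r : ℝ) (n : ℕ) :
    ℝ :=
  Real.log n / (-Real.log (quantError N ν n r).toReal)

/-- The upper quantization dimension of `ν` of order `r`. -/
def upperQuantDim {d : ℕ} (N : Seminorm ℝ (Fin d → ℝ)) (ν : Measure (Fin d → ℝ)) (r : ℝ) :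
    EReal :=
  limsup (fun n : ℕ => (quantRatio N ν r n : EReal)) atTop

/-- The lower quantization dimension of `ν` of order `r`. -/
def lowerQuantDim {d : ℕ} (N : Seminorm ℝ (Fin d → ℝ)) (ν : Measure (Fin d → ℝ)) (r : ℝ) :
    EReal :=
  liminf (fun n : ℕ => (quantRatio N ν r n : EReal)) atTop

/-! ### Dyadic cubes -/

/-- The half-open unit cube `(0, 1]^d`. -/
def unitCube (d : ℕ) : Set (Fin d → ℝ) :=
  {x | ∀ i, 0 < x i ∧ x i ≤ 1}

/-- The half-open dyadic cube `∏ i, (k i * 2^(-n), (k i + 1) * 2^(-n)]`. -/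
def dyadicCube {d : ℕ} (n : ℕ) (k : Fin d → Fin (2 ^ n)) : Set (Fin d → ℝ) :=
  {x | ∀ i, ((k i : ℕ) : ℝ) / 2 ^ n < x i ∧ x i ≤ (((k i : ℕ) : ℝ) + 1) / 2 ^ n}

open Classical in
/-- The partition of the unit cube into the `2^(n d)` dyadic cubes of side length `2^(-n)`. -/
def dyadicCubes (d n : ℕ) : Finset (Set (Fin d → ℝ)) :=
  Finset.univ.image (dyadicCube n)

/-- All dyadic subcubes of the unit cube. -/
def allDyadicCubes (d : ℕ) : Set (Set (Fin d → ℝ)) :=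
  {Q | ∃ n : ℕ, Q ∈ dyadicCubes d n}

/-- `dim_∞(ν) = liminf_n (max_{Q ∈ D_n} log ν(Q)) / log 2^(-n)`, with `log 0 = -∞`. -/
def dimInfty {d : ℕ} (ν : Measure (Fin d → ℝ)) : EReal :=
  liminf (fun n : ℕ =>
    (⨆ Q ∈ dyadicCubes d n, ENNReal.log (ν Q)) / ((Real.log ((2 : ℝ) ^ n)⁻¹ : ℝ) : EReal)) atTop

/-! ### Partition functions and the critical value -/

/-- The set function `𝔍_{ν,r}(Q) = max_{Q' ⊆ Q dyadic} ν(Q') Λ(Q')^(r/d)`, with `Λ` the Lebesgue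
measure. -/
def J {d : ℕ} (ν : Measure (Fin d → ℝ)) (r : ℝ) (Q : Set (Fin d → ℝ)) : ℝ≥0∞ :=
  ⨆ Q' ∈ {Q' ∈ allDyadicCubes d | Q' ⊆ Q}, ν Q' * volume Q' ^ (r / d)

open Classical in
/-- For a set function `Φ`, the function
`q ↦ limsup_n log (∑_{Q ∈ D_n, Φ(Q) > 0} Φ(Q)^q) / log 2^n`. -/
def partitionFunction {d : ℕ} (Φ : Set (Fin d → ℝ) → ℝ≥0∞) (q : ℝ) : EReal :=
  limsup (fun n : ℕ =>
    ENNReal.log (∑ Q ∈ (dyadicCubes d n).filter (fun Q => 0 < Φ Q), Φ Q ^ q) /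
      ((Real.log ((2 : ℝ) ^ n) : ℝ) : EReal)) atTop

/-- The `𝔍_{ν,r}`-partition function `τ`. -/
def tau {d : ℕ} (ν : Measure (Fin d → ℝ)) (r q : ℝ) : EReal :=
  partitionFunction (J ν r) q

/-- The `L^q`-spectrum `β_ν`. -/
def beta {d : ℕ} (ν : Measure (Fin d → ℝ)) (q : ℝ) : EReal :=
  partitionFunction (fun Q => ν Q) q

/-- The critical value `q_r = inf {q > 0 : τ(q) < 0}`. -/
def qCrit {d : ℕ} (ν : Measure (Fin d → ℝ)) (r : ℝ) : EReal :=
  ⨅ (q : ℝ) (_ : 0 < q ∧ tau ν r q < 0), (q : EReal)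

/-! ### Partition entropies -/

/-- `P` is a finite partition of the unit cube into dyadic cubes. -/
def IsDyadicPartition {d : ℕ} (P : Finset (Set (Fin d → ℝ))) : Prop :=
  (P : Set (Set (Fin d → ℝ))) ⊆ allDyadicCubes d ∧
    (P : Set (Set (Fin d → ℝ))).PairwiseDisjoint id ∧
    ⋃₀ (P : Set (Set (Fin d → ℝ))) = unitCube d

/-- The minimal cardinality of a dyadic partition `P` with `max_{Q ∈ P} 𝔍_{ν,r}(Q) < 1/x`. -/
def minPartitionCard {d : ℕ} (ν : Measure (Fin d → ℝ)) (r x : ℝ) : ℝ≥0∞ :=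
  ⨅ (P : Finset (Set (Fin d → ℝ)))
    (_ : IsDyadicPartition P ∧ ∀ Q ∈ P, J ν r Q < ENNReal.ofReal (1 / x)), (P.card : ℝ≥0∞)

/-- The upper `(ν,r)`-partition entropy; it is also the number `h̄_r`. -/
def upperEntropy {d : ℕ} (ν : Measure (Fin d → ℝ)) (r : ℝ) : EReal :=
  limsup (fun x : ℝ => ENNReal.log (minPartitionCard ν r x) / ((Real.log x : ℝ) : EReal)) atTop

/-- The lower `(ν,r)`-partition entropy. -/
def lowerEntropy {d : ℕ} (ν : Measure (Fin d → ℝ)) (r : ℝ) : EReal :=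
  liminf (fun x : ℝ => ENNReal.log (minPartitionCard ν r x) / ((Real.log x : ℝ) : EReal)) atTop

/-- The number `h̲_r`, the limit for `ε ↓ 0` of the lower `(ν,r-ε)`-partition entropies. -/
def lowerEntropyLim {d : ℕ} (ν : Measure (Fin d → ℝ)) (r : ℝ) : EReal :=
  limUnder (𝓝[>] (0 : ℝ)) (fun ε => lowerEntropy ν (r - ε))

/-! ### Optimized coarse multifractal dimensions -/

open Classical in
/-- The number of cubes `Q ∈ D_n` with `𝔍_{ν,r}(Q) ≥ 2^(-α n)`. -/
def coarseCount {d : ℕ} (ν : Measure (Fin d → ℝ)) (α r : ℝ) (n : ℕ) : ℕ :=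
  ((dyadicCubes d n).filter (fun Q => ENNReal.ofReal ((2 : ℝ) ^ (-α * n)) ≤ J ν r Q)).card

/-- `F̄_r = sup_{α > 0} F̄_{ν,r}(α) / α`. -/
def upperCoarseDim {d : ℕ} (ν : Measure (Fin d → ℝ)) (r : ℝ) : EReal :=
  ⨆ (α : ℝ) (_ : 0 < α),
    limsup (fun n : ℕ =>
      ((Real.posLog (coarseCount ν α r n) / Real.log ((2 : ℝ) ^ n) : ℝ) : EReal)) atTop /
      (α : EReal)

/-- `F̲_r = sup_{α > 0} F̲_{ν,r}(α) / α`. -/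
def lowerCoarseDim {d : ℕ} (ν : Measure (Fin d → ℝ)) (r : ℝ) : EReal :=
  ⨆ (α : ℝ) (_ : 0 < α),
    liminf (fun n : ℕ =>
      ((Real.posLog (coarseCount ν α r n) / Real.log ((2 : ℝ) ^ n) : ℝ) : EReal)) atTop /
      (α : EReal)

/-! ### Further notation -/

/-- The Hausdorff dimension of a measure, `inf {dim_H A : ν(A) > 0}`. (The Hausdorff dimension of
a set is the same for all norms on `ℝ^d`; Mathlib's `dimH` on `Fin d → ℝ` uses the maximum norm.) -/
def dimHMeasure {d : ℕ} (ν : Measure (Fin d → ℝ)) : ℝ≥0∞ :=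
  ⨅ (A : Set (Fin d → ℝ)) (_ : MeasurableSet A ∧ 0 < ν A), dimH A

/-- The expression `r x / (1 - x)`; it is used for finite `x ≠ 1`. -/
def ratio (r : ℝ) (x : EReal) : EReal :=
  (r : EReal) * x / (1 - x)

/-- The image of `ν` under the similarity `x ↦ s x + b`. -/
def rescale {d : ℕ} (ν : Measure (Fin d → ℝ)) (s : ℝ) (b : Fin d → ℝ) : Measure (Fin d → ℝ) :=
  ν.map (fun x => s • x + b)

end Quantization

end

/-!
The proof rests on three observations, for the image measure `μ` on the unit cube.

**The critical value is a crossing point of the `L^q`-spectrum.** For `q > 0` the sum of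
`J μ r Q ^ q` over the cubes of level `n` lies between the sum of `(μ Q * 2 ^ (-r n)) ^ q` over
that level and the same sum over all finer levels. If `beta μ q < r q`, the latter is a geometric
series; so `tau μ r q < 0` is equivalent to `beta μ q < r q` (`beta_lt_of_tau_neg`,
`tau_neg_of_beta_lt`), and `qCrit μ r` is the point where the spectrum crosses the line of slope
`r` through the origin. As the spectrum decreases at least with slope `dimInfty μ` (`beta_le_sub`),
vanishes at `1`, is at most `d (1 - q)` for `q ≤ 1` and at least `-d (q - 1)` for `q ≥ 1`, this
gives all bounds for the critical value that are needed, and its continuity from the left in `r`.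
No convexity is used.

**Critical value, entropy and coarse dimension agree.** The cubes of level `n` with
`J ≥ 2 ^ (-α n)` have to be split by every admissible partition, so that the coarse dimensions are
at most the entropies (`upperCoarseDim_le_upperEntropy`, `lowerCoarseDim_le_lowerEntropy`). The
children of the cubes with `J ≥ 1 / x` provide a partition that shows `upperEntropy ≤ qCrit`
(`upperEntropy_le_qCrit`). Splitting the sum of `J ^ q` by the size of `J` shows
`qCrit ≤ upperCoarseDim` (`qCrit_le_upperCoarseDim`); here `-dimInfty μ < r` makes `J` decay.

**Errors are controlled by cubes.** Up to constants the errors of `ν` are those of `μ` for the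
maximum norm. For `r > 0` a partition with small `J` yields one point in each of its cubes, hence
an upper bound for the error, whereas many cubes with large `J` cannot all be approached by few
points, hence a lower bound. For `r < 0` the roles are exchanged: points placed in nearly optimal
subcubes of cubes with large `J` make the moment large, and a partition with small `J` of order
`r - ε` bounds the moment for every choice of points, by summation over the cubes near each point.
Inserting the counts of the second observation produces the exponents `r h / (1 - h)`
(`quantDim_of_pos`, `quantDim_of_neg`).

For order zero, the errors are monotone in the order by Jensen's inequality, so that the dimension
of order zero is squeezed between those of order `r → 0`, which tend to `-1 / φ'(0)` with
`φ r = qCrit μ r` (`tendsto_ratio_zero`). The crossing property turns differentiability of `φ` at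
`0` into differentiability of the spectrum at `1`, with reciprocal derivative
(`hasDerivAt_of_crossing`). Finally the slopes of the spectrum at the two sides of `1` bound the
Hausdorff dimension: the Borel–Cantelli lemma shows that the cubes of level `n` around almost every
point eventually have measure at most, respectively at least, `2 ^ (-n t)`, and the mass
distribution principle, respectively a covering by the cubes of large measure, concludes
(`le_dimH_of_beta_lt`, `exists_dimH_le_of_beta_lt`).
-/

namespace Quantization

section Geometry

/-! ### Geometry of the dyadic cubes -/

theorem two_rpow_ne_zero (x : ℝ) : (2 : ℝ≥0∞) ^ x ≠ 0 := by
  simp [ENNReal.rpow_eq_zero_iff]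

theorem two_rpow_ne_top (x : ℝ) : (2 : ℝ≥0∞) ^ x ≠ ⊤ := by
  simp [ENNReal.rpow_eq_top_iff]

theorem two_rpow_add (x y : ℝ) : (2 : ℝ≥0∞) ^ (x + y) = 2 ^ x * 2 ^ y :=
  ENNReal.rpow_add x y (by norm_num) (by norm_num)

theorem two_rpow_mono {x y : ℝ} (h : x ≤ y) : (2 : ℝ≥0∞) ^ x ≤ 2 ^ y :=
  ENNReal.rpow_le_rpow_of_exponent_le (by norm_num) h

theorem ofReal_two_rpow (x : ℝ) : ENNReal.ofReal ((2 : ℝ) ^ x) = 2 ^ x := by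
  rw [← ENNReal.ofReal_rpow_of_pos (by norm_num)]; simp

theorem two_rpow_neg_natCast (n : ℕ) : (2 : ℝ) ^ (-(n : ℝ)) = (2 ^ n)⁻¹ := by
  rw [Real.rpow_neg (by norm_num), Real.rpow_natCast]

variable {d : ℕ}

theorem mem_dyadicCubes {n : ℕ} {Q : Set (Fin d → ℝ)} :
    Q ∈ dyadicCubes d n ↔ ∃ k, dyadicCube n k = Q := by
  simp [dyadicCubes]

theorem dyadicCube_eq_pi (n : ℕ) (k : Fin d → Fin (2 ^ n)) :
    dyadicCube n k =
      Set.univ.pi fun i => Set.Ioc (((k i : ℕ) : ℝ) / 2 ^ n) ((((k i : ℕ) : ℝ) + 1) / 2 ^ n) := by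
  ext x; simp [dyadicCube]

theorem measurableSet_of_mem_dyadicCubes {n : ℕ} {Q : Set (Fin d → ℝ)}
    (h : Q ∈ dyadicCubes d n) : MeasurableSet Q := by
  obtain ⟨k, rfl⟩ := mem_dyadicCubes.1 h
  rw [dyadicCube_eq_pi]
  exact MeasurableSet.univ_pi fun i => measurableSet_Ioc

theorem volume_of_mem_dyadicCubes {n : ℕ} {Q : Set (Fin d → ℝ)} (h : Q ∈ dyadicCubes d n) :
    volume Q = (2 : ℝ≥0∞) ^ (-(n * d : ℝ)) := by
  obtain ⟨k, rfl⟩ := mem_dyadicCubes.1 h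
  rw [dyadicCube_eq_pi, Real.volume_pi_Ioc]
  have h1 : ∀ i : Fin d, ENNReal.ofReal ((((k i : ℕ) : ℝ) + 1) / 2 ^ n - ((k i : ℕ) : ℝ) / 2 ^ n)
      = (2 : ℝ≥0∞) ^ (-(n : ℝ)) := fun i => by
    rw [← ofReal_two_rpow, two_rpow_neg_natCast]
    congr 1
    ring
  rw [Finset.prod_congr rfl fun i _ => h1 i, Finset.prod_const, Finset.card_univ, Fintype.card_fin,
    ← ENNReal.rpow_natCast, ← ENNReal.rpow_mul]
  ring_nf

theorem volume_rpow_of_mem_dyadicCubes (hd : 0 < d) (r : ℝ) {n : ℕ} {Q : Set (Fin d → ℝ)}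
    (h : Q ∈ dyadicCubes d n) : volume Q ^ (r / d) = (2 : ℝ≥0∞) ^ (-(r * n)) := by
  rw [volume_of_mem_dyadicCubes h, ← ENNReal.rpow_mul]
  congr 1
  have : (d : ℝ) ≠ 0 := by positivity
  field_simp

theorem exists_mem_dyadicCubes (n : ℕ) {x : Fin d → ℝ} (hx : x ∈ unitCube d) :
    ∃ Q ∈ dyadicCubes d n, x ∈ Q := by
  have hp : (0 : ℝ) < 2 ^ n := by positivity
  have key : ∀ i, ∃ k : Fin (2 ^ n), ((k : ℕ) : ℝ) / 2 ^ n < x i ∧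
      x i ≤ (((k : ℕ) : ℝ) + 1) / 2 ^ n := fun i => by
    have h0 : 0 < x i * 2 ^ n := mul_pos (hx i).1 hp
    have h1 : x i * 2 ^ n ≤ ((2 ^ n : ℕ) : ℝ) := by
      push_cast
      nlinarith [(hx i).2]
    have hc : 0 < ⌈x i * 2 ^ n⌉₊ := Nat.ceil_pos.2 h0
    have hc1 : ⌈x i * 2 ^ n⌉₊ ≤ 2 ^ n := Nat.ceil_le.2 h1
    refine ⟨⟨⌈x i * 2 ^ n⌉₊ - 1, by omega⟩, ?_, ?_⟩
    · rw [div_lt_iff₀ hp]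
      exact Nat.lt_ceil.1 (by simp only; omega)
    · rw [le_div_iff₀ hp]
      have := Nat.le_ceil (x i * 2 ^ n)
      have h2 : ((⌈x i * 2 ^ n⌉₊ - 1 : ℕ) : ℝ) + 1 = ⌈x i * 2 ^ n⌉₊ := by
        exact_mod_cast Nat.sub_add_cancel hc
      simpa only [h2] using this
  choose k hk using key
  exact ⟨dyadicCube n k, mem_dyadicCubes.2 ⟨k, rfl⟩, hk⟩

theorem subset_unitCube {n : ℕ} {Q : Set (Fin d → ℝ)} (h : Q ∈ dyadicCubes d n) :
    Q ⊆ unitCube d := by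
  obtain ⟨k, rfl⟩ := mem_dyadicCubes.1 h
  intro x hx i
  have hp : (0 : ℝ) < 2 ^ n := by positivity
  refine ⟨lt_of_le_of_lt (by positivity) (hx i).1, (hx i).2.trans ?_⟩
  rw [div_le_one hp]
  exact_mod_cast (k i).2

theorem nonempty_of_mem_dyadicCubes {n : ℕ} {Q : Set (Fin d → ℝ)} (h : Q ∈ dyadicCubes d n) :
    Q.Nonempty := by
  obtain ⟨k, rfl⟩ := mem_dyadicCubes.1 h
  refine ⟨fun i => (((k i : ℕ) : ℝ) + 1) / 2 ^ n, fun i => ⟨?_, le_rfl⟩⟩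
  simp only
  gcongr
  linarith

theorem edist_le_of_mem_dyadicCubes {n : ℕ} {Q : Set (Fin d → ℝ)} (h : Q ∈ dyadicCubes d n)
    {x y : Fin d → ℝ} (hx : x ∈ Q) (hy : y ∈ Q) : edist x y ≤ (2 : ℝ≥0∞) ^ (-(n : ℝ)) := by
  obtain ⟨k, rfl⟩ := mem_dyadicCubes.1 h
  rw [edist_pi_le_iff]
  intro i
  rw [edist_dist, ← ofReal_two_rpow, two_rpow_neg_natCast]
  apply ENNReal.ofReal_le_ofReal
  have h1 := hx i
  have h2 := hy i
  rw [add_div, one_div] at h1 h2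
  rw [Real.dist_eq, abs_le]
  constructor <;> linarith

/-- A cube of level `n` lies in the cube of a coarser level `m` whose index is obtained by dividing
the index by `2 ^ (n - m)`. -/
theorem exists_index_of_le {m n : ℕ} (hmn : m ≤ n) (k : Fin d → Fin (2 ^ n)) :
    ∃ k' : Fin d → Fin (2 ^ m), (∀ i, (k' i : ℕ) = k i / 2 ^ (n - m)) ∧
      dyadicCube n k ⊆ dyadicCube m k' := by
  obtain ⟨j, rfl⟩ := Nat.exists_eq_add_of_le hmn
  have hj : m + j - m = j := by omega
  rw [hj]
  refine ⟨fun i => ⟨k i / 2 ^ j, ?_⟩, fun i => rfl, ?_⟩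
  · rw [Nat.div_lt_iff_lt_mul (by positivity), ← pow_add]
    exact (k i).2
  · intro x hx i
    have hm : (0 : ℝ) < 2 ^ m := by positivity
    have hj' : (0 : ℝ) < 2 ^ j := by positivity
    obtain ⟨h1, h2⟩ := hx i
    rw [show (2 : ℝ) ^ (m + j) = 2 ^ m * 2 ^ j from pow_add _ _ _] at h1 h2
    simp only
    have e1 : (((k i / 2 ^ j : ℕ) : ℝ)) * 2 ^ j ≤ (k i : ℕ) := by
      exact_mod_cast Nat.div_mul_le_self _ _
    have e2 : ((k i : ℕ) : ℝ) + 1 ≤ ((((k i / 2 ^ j : ℕ) : ℝ)) + 1) * 2 ^ j := by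
      have : (k i : ℕ) < (k i / 2 ^ j + 1) * 2 ^ j := by
        rw [← Nat.div_lt_iff_lt_mul (by positivity)]
        exact Nat.lt_succ_self _
      exact_mod_cast this
    constructor
    · refine lt_of_le_of_lt ?_ h1
      rw [div_le_div_iff₀ hm (by positivity)]
      nlinarith
    · refine h2.trans ?_
      rw [div_le_div_iff₀ (by positivity) hm]
      nlinarith

theorem index_unique {n : ℕ} {k k' : Fin d → Fin (2 ^ n)} {x : Fin d → ℝ}
    (h : x ∈ dyadicCube n k) (h' : x ∈ dyadicCube n k') : k = k' := by
  have hp : (0 : ℝ) < 2 ^ n := by positivity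
  funext i
  have h1 := (h i).1.trans_le (h' i).2
  have h2 := (h' i).1.trans_le (h i).2
  rw [div_lt_div_iff_of_pos_right hp] at h1 h2
  have h3 : (k i : ℕ) < k' i + 1 := by exact_mod_cast h1
  have h4 : (k' i : ℕ) < k i + 1 := by exact_mod_cast h2
  exact Fin.ext (by omega)

/-- Dyadic cubes are nested: a cube that meets a cube of a coarser level lies in it. -/
theorem subset_of_mem {m n : ℕ} (hmn : m ≤ n) {Q Q' : Set (Fin d → ℝ)}
    (h : Q ∈ dyadicCubes d m) (h' : Q' ∈ dyadicCubes d n) {x : Fin d → ℝ} (hx : x ∈ Q)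
    (hx' : x ∈ Q') : Q' ⊆ Q := by
  obtain ⟨k, rfl⟩ := mem_dyadicCubes.1 h
  obtain ⟨k', rfl⟩ := mem_dyadicCubes.1 h'
  obtain ⟨l, -, hl⟩ := exists_index_of_le hmn k'
  rwa [index_unique hx (hl hx')]

theorem eq_of_mem {n : ℕ} {Q Q' : Set (Fin d → ℝ)} (h : Q ∈ dyadicCubes d n)
    (h' : Q' ∈ dyadicCubes d n) {x : Fin d → ℝ} (hx : x ∈ Q) (hx' : x ∈ Q') : Q = Q' :=
  (subset_of_mem le_rfl h' h hx' hx).antisymm (subset_of_mem le_rfl h h' hx hx')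

theorem pairwiseDisjoint_dyadicCubes (n : ℕ) :
    (dyadicCubes d n : Set (Set (Fin d → ℝ))).PairwiseDisjoint id := by
  intro Q hQ Q' hQ' hne
  rw [Function.onFun, Set.disjoint_left]
  exact fun x hx hx' => hne (eq_of_mem hQ hQ' hx hx')

theorem subset_or_subset_or_disjoint {Q Q' : Set (Fin d → ℝ)} (h : Q ∈ allDyadicCubes d)
    (h' : Q' ∈ allDyadicCubes d) : Q ⊆ Q' ∨ Q' ⊆ Q ∨ Disjoint Q Q' := by
  obtain ⟨m, hm⟩ := h
  obtain ⟨n, hn⟩ := h'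
  by_cases hd : Disjoint Q Q'
  · exact Or.inr (Or.inr hd)
  · obtain ⟨x, hx, hx'⟩ := Set.not_disjoint_iff.1 hd
    rcases le_total m n with hmn | hmn
    · exact Or.inr (Or.inl (subset_of_mem hmn hm hn hx hx'))
    · exact Or.inl (subset_of_mem hmn hn hm hx' hx)

theorem level_le_of_subset (hd : 0 < d) {m n : ℕ} {Q Q' : Set (Fin d → ℝ)}
    (h : Q ∈ dyadicCubes d m) (h' : Q' ∈ dyadicCubes d n) (hs : Q' ⊆ Q) : m ≤ n := by
  have h1 := measure_mono (μ := volume) hs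
  rw [volume_of_mem_dyadicCubes h, volume_of_mem_dyadicCubes h'] at h1
  by_contra hlt
  push Not at hlt
  have hlt' : (n : ℝ) < m := by exact_mod_cast hlt
  have hd' : (0 : ℝ) < d := by exact_mod_cast hd
  have : (2 : ℝ≥0∞) ^ (-(m * d : ℝ)) < 2 ^ (-(n * d : ℝ)) :=
    ENNReal.rpow_lt_rpow_of_exponent_lt (by norm_num) (by norm_num) (by nlinarith)
  exact absurd h1 (not_le.2 this)

theorem exists_superset {m n : ℕ} (hmn : m ≤ n) {Q : Set (Fin d → ℝ)}
    (h : Q ∈ dyadicCubes d n) : ∃ Q' ∈ dyadicCubes d m, Q ⊆ Q' := by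
  obtain ⟨k, rfl⟩ := mem_dyadicCubes.1 h
  obtain ⟨l, -, hl⟩ := exists_index_of_le hmn k
  exact ⟨_, mem_dyadicCubes.2 ⟨l, rfl⟩, hl⟩

theorem unitCube_mem_dyadicCubes : unitCube d ∈ dyadicCubes d 0 :=
  mem_dyadicCubes.2 ⟨fun _ => 0, by ext x; simp [dyadicCube, unitCube]⟩

theorem dyadicCubes_zero : dyadicCubes d 0 = {unitCube d} := by
  refine Finset.eq_singleton_iff_unique_mem.2 ⟨unitCube_mem_dyadicCubes, fun Q hQ => ?_⟩
  obtain ⟨x, hx⟩ := nonempty_of_mem_dyadicCubes hQ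
  exact eq_of_mem hQ unitCube_mem_dyadicCubes hx (subset_unitCube hQ hx)

theorem measurableSet_unitCube : MeasurableSet (unitCube d) :=
  measurableSet_of_mem_dyadicCubes unitCube_mem_dyadicCubes

theorem card_dyadicCubes_le (n : ℕ) : (dyadicCubes d n).card ≤ 2 ^ (n * d) := by
  refine Finset.card_image_le.trans ?_
  simp [pow_mul]

open Classical in
/-- A cube of level `n` has at most `2 ^ d` children. -/
theorem card_children_le {n : ℕ} {Q : Set (Fin d → ℝ)} (h : Q ∈ dyadicCubes d n) :
    ((dyadicCubes d (n + 1)).filter (· ⊆ Q)).card ≤ 2 ^ d := by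
  obtain ⟨k, rfl⟩ := mem_dyadicCubes.1 h
  have hsub : (dyadicCubes d (n + 1)).filter (· ⊆ dyadicCube n k) ⊆
      (Finset.univ : Finset (Fin d → Fin 2)).image fun e =>
        {x : Fin d → ℝ | ∀ i, ((2 * (k i : ℕ) + (e i : ℕ) : ℕ) : ℝ) / 2 ^ (n + 1) < x i ∧
          x i ≤ (((2 * (k i : ℕ) + (e i : ℕ) : ℕ) : ℝ) + 1) / 2 ^ (n + 1)} := by
    intro Q' hQ'
    obtain ⟨hQ', hs⟩ := Finset.mem_filter.1 hQ'
    obtain ⟨k', rfl⟩ := mem_dyadicCubes.1 hQ'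
    obtain ⟨x, hx⟩ := nonempty_of_mem_dyadicCubes hQ'
    obtain ⟨l, hl, hl'⟩ := exists_index_of_le (Nat.le_succ n) k'
    have hkl : k = l := index_unique (hs hx) (hl' hx)
    subst hkl
    refine Finset.mem_image.2 ⟨fun i => ⟨k' i % 2, Nat.mod_lt _ (by norm_num)⟩,
      Finset.mem_univ _, ?_⟩
    have : ∀ i, 2 * (k i : ℕ) + (k' i : ℕ) % 2 = k' i := fun i => by
      rw [hl i]
      simpa using Nat.div_add_mod (k' i : ℕ) 2
    simp only [this]
    rfl
  refine (Finset.card_le_card hsub).trans (Finset.card_image_le.trans ?_)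
  simp

open Classical in
/-- The cubes of level `n` that contain a point at distance less than `2 ^ (-n)` from `a`. -/
noncomputable def nearCubes (n : ℕ) (a : Fin d → ℝ) : Finset (Set (Fin d → ℝ)) :=
  (dyadicCubes d n).filter fun Q => ∃ x ∈ Q, edist x a < (2 : ℝ≥0∞) ^ (-(n : ℝ))

theorem mem_nearCubes {n : ℕ} {a : Fin d → ℝ} {Q : Set (Fin d → ℝ)} : Q ∈ nearCubes n a ↔
    Q ∈ dyadicCubes d n ∧ ∃ x ∈ Q, edist x a < (2 : ℝ≥0∞) ^ (-(n : ℝ)) := by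
  classical
  rw [nearCubes, Finset.mem_filter]

theorem card_nearCubes_le (n : ℕ) (a : Fin d → ℝ) : (nearCubes n a).card ≤ 3 ^ d := by
  classical
  have hp : (0 : ℝ) < 2 ^ n := by positivity
  have hsub : nearCubes n a ⊆
      (Finset.univ : Finset (Fin d → Fin 3)).image fun e =>
        {x : Fin d → ℝ | ∀ i, ((⌊a i * 2 ^ n⌋ - 1 + (e i : ℕ) : ℤ) : ℝ) / 2 ^ n < x i ∧
          x i ≤ (((⌊a i * 2 ^ n⌋ - 1 + (e i : ℕ) : ℤ) : ℝ) + 1) / 2 ^ n} := by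
    intro Q hQ
    obtain ⟨hQ, x, hx, hxa⟩ := mem_nearCubes.1 hQ
    obtain ⟨k, rfl⟩ := mem_dyadicCubes.1 hQ
    have key : ∀ i, ⌊a i * 2 ^ n⌋ - 1 ≤ ((k i : ℕ) : ℤ) ∧ ((k i : ℕ) : ℤ) ≤ ⌊a i * 2 ^ n⌋ + 1 := by
      intro i
      have h1 : edist (x i) (a i) < (2 : ℝ≥0∞) ^ (-(n : ℝ)) :=
        (edist_le_pi_edist x a i).trans_lt hxa
      rw [edist_dist, ← ofReal_two_rpow, two_rpow_neg_natCast,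
        ENNReal.ofReal_lt_ofReal_iff (by positivity), Real.dist_eq, abs_lt] at h1
      obtain ⟨h2, h3⟩ := hx i
      rw [div_lt_iff₀ hp] at h2
      rw [le_div_iff₀ hp] at h3
      have h4 : a i * 2 ^ n - 1 < x i * 2 ^ n := by
        have := mul_lt_mul_of_pos_right h1.1 hp
        rw [neg_mul, inv_mul_cancel₀ hp.ne'] at this
        linarith
      have h5 : x i * 2 ^ n < a i * 2 ^ n + 1 := by
        have := mul_lt_mul_of_pos_right h1.2 hp
        rw [inv_mul_cancel₀ hp.ne'] at this
        linarith
      have h6 := Int.floor_le (a i * 2 ^ n)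
      have h7 := Int.lt_floor_add_one (a i * 2 ^ n)
      constructor
      · have : (⌊a i * 2 ^ n⌋ : ℝ) < ((k i : ℕ) : ℤ) + 2 := by push_cast; linarith
        have : ⌊a i * 2 ^ n⌋ < ((k i : ℕ) : ℤ) + 2 := by exact_mod_cast this
        omega
      · have : (((k i : ℕ) : ℤ) : ℝ) < ⌊a i * 2 ^ n⌋ + 2 := by push_cast; linarith
        have : ((k i : ℕ) : ℤ) < ⌊a i * 2 ^ n⌋ + 2 := by exact_mod_cast this
        omega
    refine Finset.mem_image.2 ⟨fun i => ⟨((k i : ℕ) - (⌊a i * 2 ^ n⌋ - 1) : ℤ).toNat, ?_⟩,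
      Finset.mem_univ _, ?_⟩
    · have := key i
      omega
    · have : ∀ i, ⌊a i * 2 ^ n⌋ - 1 + ((((k i : ℕ) - (⌊a i * 2 ^ n⌋ - 1) : ℤ).toNat : ℕ) : ℤ)
          = (k i : ℕ) := fun i => by
        have := key i
        omega
      simp only [this]
      rfl
  refine (Finset.card_le_card hsub).trans (Finset.card_image_le.trans ?_)
  simp

/-! ### Measures on the unit cube -/

theorem lintegral_eq_sum_dyadicCubes {μ : Measure (Fin d → ℝ)} (hμ : μ (unitCube d)ᶜ = 0)
    {P : Finset (Set (Fin d → ℝ))} (hP : IsDyadicPartition P) (f : (Fin d → ℝ) → ℝ≥0∞) :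
    ∫⁻ x, f x ∂μ = ∑ Q ∈ P, ∫⁻ x in Q, f x ∂μ := by
  have h1 : ⋃ Q ∈ P, id Q = unitCube d := by rw [← hP.2.2, Set.sUnion_eq_biUnion]; rfl
  have h2 := lintegral_biUnion_finset (μ := μ) hP.2.1 (fun Q hQ => by
    obtain ⟨n, hn⟩ := hP.1 hQ
    exact measurableSet_of_mem_dyadicCubes hn) f
  rw [h1] at h2
  rw [← lintegral_add_compl f measurableSet_unitCube, Measure.restrict_eq_zero.2 hμ]
  simpa using h2

theorem isDyadicPartition_dyadicCubes (n : ℕ) : IsDyadicPartition (dyadicCubes d n) := by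
  refine ⟨fun Q hQ => ⟨n, hQ⟩, pairwiseDisjoint_dyadicCubes n, ?_⟩
  ext x
  refine ⟨fun ⟨Q, hQ, hx⟩ => subset_unitCube hQ hx, fun hx => ?_⟩
  obtain ⟨Q, hQ, hxQ⟩ := exists_mem_dyadicCubes n hx
  exact ⟨Q, hQ, hxQ⟩

theorem sum_measure_eq_one {μ : Measure (Fin d → ℝ)} [IsProbabilityMeasure μ]
    (hμ : μ (unitCube d)ᶜ = 0) {P : Finset (Set (Fin d → ℝ))} (hP : IsDyadicPartition P) :
    ∑ Q ∈ P, μ Q = 1 := by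
  have := lintegral_eq_sum_dyadicCubes hμ hP 1
  simpa using this.symm

theorem nonempty_of_isDyadicPartition {P : Finset (Set (Fin d → ℝ))} (hP : IsDyadicPartition P) :
    P.Nonempty := by
  obtain ⟨x, hx⟩ := nonempty_of_mem_dyadicCubes (unitCube_mem_dyadicCubes (d := d))
  rw [← hP.2.2] at hx
  obtain ⟨Q, hQ, -⟩ := hx
  exact ⟨Q, hQ⟩

/-! ### The set function `J` -/

theorem J_mono (μ : Measure (Fin d → ℝ)) (r : ℝ) {Q Q' : Set (Fin d → ℝ)} (h : Q ⊆ Q') :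
    J μ r Q ≤ J μ r Q' :=
  biSup_mono fun _ hR => ⟨hR.1, hR.2.trans h⟩

theorem le_J (hd : 0 < d) (μ : Measure (Fin d → ℝ)) (r : ℝ) {n : ℕ} {Q Q' : Set (Fin d → ℝ)}
    (h : Q' ∈ dyadicCubes d n) (hs : Q' ⊆ Q) : μ Q' * 2 ^ (-(r * n)) ≤ J μ r Q := by
  rw [← volume_rpow_of_mem_dyadicCubes hd r h]
  exact le_iSup₂_of_le (f := fun Q' _ => μ Q' * volume Q' ^ (r / d)) Q' ⟨⟨n, h⟩, hs⟩ le_rfl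

theorem J_le (hd : 0 < d) {μ : Measure (Fin d → ℝ)} {r : ℝ} {Q : Set (Fin d → ℝ)} {b : ℝ≥0∞}
    (h : ∀ n, ∀ Q' ∈ dyadicCubes d n, Q' ⊆ Q → μ Q' * 2 ^ (-(r * n)) ≤ b) : J μ r Q ≤ b := by
  refine iSup₂_le fun Q' hQ' => ?_
  obtain ⟨⟨n, hn⟩, hs⟩ := hQ'
  rw [volume_rpow_of_mem_dyadicCubes hd r hn]
  exact h n Q' hn hs

theorem exists_lt_of_lt_J (hd : 0 < d) {μ : Measure (Fin d → ℝ)} {r : ℝ} {Q : Set (Fin d → ℝ)}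
    {b : ℝ≥0∞} (h : b < J μ r Q) :
    ∃ n, ∃ Q' ∈ dyadicCubes d n, Q' ⊆ Q ∧ b < μ Q' * 2 ^ (-(r * n)) := by
  by_contra! hcon
  exact absurd h (not_lt.2 (J_le hd fun n Q' hQ' hs => hcon n Q' hQ' hs))

theorem J_anti (hd : 0 < d) (μ : Measure (Fin d → ℝ)) {r s : ℝ} (h : r ≤ s)
    (Q : Set (Fin d → ℝ)) : J μ s Q ≤ J μ r Q :=
  J_le hd fun n Q' hQ' hs => le_trans (by
    gcongr
    · norm_num) (le_J hd μ r hQ' hs)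

/-- For `r ≥ 0` the maximum that defines `J` is attained at the cube itself. -/
theorem J_eq_of_nonneg (hd : 0 < d) (μ : Measure (Fin d → ℝ)) {r : ℝ} (hr : 0 ≤ r) {n : ℕ}
    {Q : Set (Fin d → ℝ)} (h : Q ∈ dyadicCubes d n) : J μ r Q = μ Q * 2 ^ (-(r * n)) := by
  refine le_antisymm (J_le hd fun m Q' hQ' hs => ?_) (le_J hd μ r h subset_rfl)
  have : (n : ℝ) ≤ m := by exact_mod_cast level_le_of_subset hd h hQ' hs
  gcongr
  norm_num

end Geometry

section Growth

/-! ### Exponential growth rates -/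

theorem log_ofReal_rpow {B : ℝ} (hB : 0 < B) (t : ℝ) :
    ENNReal.log (ENNReal.ofReal B ^ t) = ((Real.log B : ℝ) : EReal) * t := by
  rw [ENNReal.log_rpow, ENNReal.log_ofReal_of_pos hB, mul_comm]

theorem log_div_log_le_iff {B : ℝ} (hB : 1 < B) (a : ℝ≥0∞) (t : ℝ) :
    ENNReal.log a / ((Real.log B : ℝ) : EReal) ≤ t ↔ a ≤ ENNReal.ofReal B ^ t := by
  rw [EReal.div_le_iff_le_mul (by exact_mod_cast Real.log_pos hB) (EReal.coe_ne_top _),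
    ← log_ofReal_rpow (by linarith), ENNReal.log_le_log_iff]

theorem le_log_div_log_iff {B : ℝ} (hB : 1 < B) (a : ℝ≥0∞) (t : ℝ) :
    (t : EReal) ≤ ENNReal.log a / ((Real.log B : ℝ) : EReal) ↔ ENNReal.ofReal B ^ t ≤ a := by
  rw [EReal.le_div_iff_mul_le (by exact_mod_cast Real.log_pos hB) (EReal.coe_ne_top _), mul_comm,
    ← log_ofReal_rpow (by linarith), ENNReal.log_le_log_iff]

theorem ofReal_two_pow_rpow (n : ℕ) (t : ℝ) :
    ENNReal.ofReal ((2 : ℝ) ^ n) ^ t = (2 : ℝ≥0∞) ^ (t * n) := by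
  rw [← Real.rpow_natCast, ofReal_two_rpow, ← ENNReal.rpow_mul, mul_comm]

theorem one_lt_two_pow_of_pos {n : ℕ} (hn : 0 < n) : (1 : ℝ) < 2 ^ n :=
  one_lt_pow₀ (by norm_num) hn.ne'

theorem log_div_log_two_pow_le_iff {n : ℕ} (hn : 0 < n) (a : ℝ≥0∞) (t : ℝ) :
    ENNReal.log a / ((Real.log ((2 : ℝ) ^ n) : ℝ) : EReal) ≤ t ↔ a ≤ (2 : ℝ≥0∞) ^ (t * n) := by
  rw [log_div_log_le_iff (one_lt_two_pow_of_pos hn), ofReal_two_pow_rpow]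

theorem le_log_div_log_two_pow_iff {n : ℕ} (hn : 0 < n) (a : ℝ≥0∞) (t : ℝ) :
    (t : EReal) ≤ ENNReal.log a / ((Real.log ((2 : ℝ) ^ n) : ℝ) : EReal) ↔
      (2 : ℝ≥0∞) ^ (t * n) ≤ a := by
  rw [le_log_div_log_iff (one_lt_two_pow_of_pos hn), ofReal_two_pow_rpow]

theorem eventually_le_two_rpow {C : ℝ≥0∞} (hC : C ≠ ⊤) {ε : ℝ} (hε : 0 < ε) :
    ∀ᶠ n : ℕ in atTop, C ≤ (2 : ℝ≥0∞) ^ (ε * n) := by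
  have h1 : Tendsto (fun n : ℕ => (2 : ℝ≥0∞) ^ (ε * n)) atTop (𝓝 ⊤) :=
    (ENNReal.tendsto_rpow_atTop_of_one_lt_base (by norm_num)).comp
      (tendsto_natCast_atTop_atTop.const_mul_atTop hε)
  exact (h1.eventually (lt_mem_nhds (lt_top_iff_ne_top.2 hC))).mono fun _ h => h.le

variable {d : ℕ}

theorem sum_filter_rpow (Φ : Set (Fin d → ℝ) → ℝ≥0∞) {q : ℝ} (hq : 0 < q) (n : ℕ) :
    ∑ Q ∈ (dyadicCubes d n).filter (fun Q => 0 < Φ Q), Φ Q ^ q =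
      ∑ Q ∈ dyadicCubes d n, Φ Q ^ q := by
  refine Finset.sum_subset (Finset.filter_subset _ _) fun Q hQ hQ' => ?_
  have : Φ Q = 0 := by
    by_contra h
    exact hQ' (Finset.mem_filter.2 ⟨hQ, pos_iff_ne_zero.2 h⟩)
  rw [this, ENNReal.zero_rpow_of_pos hq]

theorem partitionFunction_eq (Φ : Set (Fin d → ℝ) → ℝ≥0∞) {q : ℝ} (hq : 0 < q) :
    partitionFunction Φ q = limsup (fun n : ℕ =>
      ENNReal.log (∑ Q ∈ dyadicCubes d n, Φ Q ^ q) /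
        ((Real.log ((2 : ℝ) ^ n) : ℝ) : EReal)) atTop := by
  unfold partitionFunction
  congr 1
  funext n
  rw [← sum_filter_rpow Φ hq n]

theorem exists_eventually_of_partitionFunction_lt {Φ : Set (Fin d → ℝ) → ℝ≥0∞} {q : ℝ}
    (hq : 0 < q) {t : ℝ} (h : partitionFunction Φ q < t) :
    ∃ t' < t, ∀ᶠ n : ℕ in atTop, ∑ Q ∈ dyadicCubes d n, Φ Q ^ q ≤ 2 ^ (t' * n) := by
  obtain ⟨t', h1, h2⟩ := EReal.lt_iff_exists_real_btwn.1 h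
  refine ⟨t', by exact_mod_cast h2, ?_⟩
  rw [partitionFunction_eq Φ hq] at h1
  filter_upwards [eventually_lt_of_limsup_lt h1, eventually_gt_atTop 0] with n hn hn0
  exact (log_div_log_two_pow_le_iff hn0 _ _).1 hn.le

theorem partitionFunction_le {Φ : Set (Fin d → ℝ) → ℝ≥0∞} {q : ℝ} (hq : 0 < q) {t : ℝ}
    {C : ℝ≥0∞} (hC : C ≠ ⊤)
    (h : ∀ᶠ n : ℕ in atTop, ∑ Q ∈ dyadicCubes d n, Φ Q ^ q ≤ C * 2 ^ (t * n)) :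
    partitionFunction Φ q ≤ t := by
  refine EReal.le_of_forall_lt_iff_le.1 fun s hs => ?_
  have hs' : 0 < s - t := sub_pos.2 (by exact_mod_cast hs)
  rw [partitionFunction_eq Φ hq]
  refine limsup_le_of_le (by isBoundedDefault) ?_
  filter_upwards [h, eventually_le_two_rpow hC hs', eventually_gt_atTop 0] with n hn hC' hn0
  rw [log_div_log_two_pow_le_iff hn0]
  calc _ ≤ _ := hn
    _ ≤ 2 ^ ((s - t) * n) * 2 ^ (t * n) := by gcongr
    _ = _ := by rw [← two_rpow_add]; ring_nf

theorem le_partitionFunction {Φ : Set (Fin d → ℝ) → ℝ≥0∞} {q : ℝ} (hq : 0 < q) {t : ℝ}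
    (h : ∀ᶠ n : ℕ in atTop, 2 ^ (t * n) ≤ ∑ Q ∈ dyadicCubes d n, Φ Q ^ q) :
    (t : EReal) ≤ partitionFunction Φ q := by
  rw [partitionFunction_eq Φ hq]
  refine le_limsup_of_frequently_le' (Eventually.frequently ?_)
  filter_upwards [h, eventually_gt_atTop 0] with n hn hn0
  exact (le_log_div_log_two_pow_iff hn0 _ _).2 hn

/-! ### The number `dimInfty` -/

theorem log_inv_two_pow (n : ℕ) :
    ((Real.log ((2 : ℝ) ^ n)⁻¹ : ℝ) : EReal) = -((Real.log ((2 : ℝ) ^ n) : ℝ) : EReal) := by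
  rw [Real.log_inv, EReal.coe_neg]

theorem dimInfty_eq (μ : Measure (Fin d → ℝ)) : dimInfty μ = liminf (fun n : ℕ =>
    -((⨆ Q ∈ dyadicCubes d n, ENNReal.log (μ Q)) /
      ((Real.log ((2 : ℝ) ^ n) : ℝ) : EReal))) atTop := by
  unfold dimInfty
  congr 1
  funext n
  rw [log_inv_two_pow, EReal.div_eq_inv_mul, EReal.inv_neg, EReal.neg_mul, ← EReal.div_eq_inv_mul]

theorem dimInfty_nonneg (μ : Measure (Fin d → ℝ)) [IsProbabilityMeasure μ] : 0 ≤ dimInfty μ := by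
  rw [dimInfty_eq]
  refine le_liminf_of_le (by isBoundedDefault) (Eventually.of_forall fun n => ?_)
  rw [EReal.le_neg]
  simp only [neg_zero]
  refine EReal.div_nonpos_of_nonpos_of_nonneg (iSup₂_le fun Q _ => ?_) ?_
  · rw [ENNReal.log_le_zero_iff]
    exact prob_le_one
  · exact EReal.coe_nonneg.2 (Real.log_nonneg (one_le_pow₀ (by norm_num)))

theorem eventually_measure_le {μ : Measure (Fin d → ℝ)} {c : ℝ} (h : (c : EReal) < dimInfty μ) :
    ∀ᶠ n : ℕ in atTop, ∀ Q ∈ dyadicCubes d n, μ Q ≤ 2 ^ (-c * n) := by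
  rw [dimInfty_eq] at h
  filter_upwards [eventually_lt_of_lt_liminf h, eventually_gt_atTop 0] with n hn hn0 Q hQ
  rw [← log_div_log_two_pow_le_iff hn0, EReal.coe_neg, EReal.le_neg]
  refine hn.le.trans (EReal.neg_le_neg_iff.2 (EReal.div_le_div_right_of_nonneg ?_ ?_))
  · exact EReal.coe_nonneg.2 (Real.log_nonneg (one_le_pow₀ (by norm_num)))
  · exact le_iSup₂_of_le (f := fun Q _ => ENNReal.log (μ Q)) Q hQ le_rfl

/-! ### The `L^q`-spectrum and the critical value -/

theorem beta_lt_of_tau_neg (hd : 0 < d) {μ : Measure (Fin d → ℝ)} {r q : ℝ} (hq : 0 < q)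
    (h : tau μ r q < 0) : beta μ q < (r * q : ℝ) := by
  obtain ⟨t, ht, h1⟩ := exists_eventually_of_partitionFunction_lt (t := 0) hq h
  have h2 : beta μ q ≤ (t + r * q : ℝ) := by
    refine partitionFunction_le hq ENNReal.one_ne_top (h1.mono fun n hn => ?_)
    have h3 : ∑ Q ∈ dyadicCubes d n, μ Q ^ q =
        (∑ Q ∈ dyadicCubes d n, (μ Q * 2 ^ (-(r * n))) ^ q) * 2 ^ (r * q * n) := by
      rw [Finset.sum_mul]
      refine Finset.sum_congr rfl fun Q _ => ?_
      rw [ENNReal.mul_rpow_of_nonneg _ _ hq.le, ← ENNReal.rpow_mul, mul_assoc, ← two_rpow_add]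
      ring_nf
      simp
    rw [h3, one_mul, add_mul, two_rpow_add]
    gcongr
    refine le_trans (Finset.sum_le_sum fun Q hQ => ?_) hn
    exact ENNReal.rpow_le_rpow (le_J hd μ r hQ subset_rfl) hq.le
  refine h2.trans_lt ?_
  exact_mod_cast (by linarith : t + r * q < r * q)

/-- A cube of level `m ≥ n` lies in only one cube of level `n`, so that the sum of `J ^ q` over
level `n` is controlled by the sums of `(μ Q 2 ^ (-r m)) ^ q` over all finer levels. -/
theorem sum_J_rpow_le (hd : 0 < d) (μ : Measure (Fin d → ℝ)) (r : ℝ) {q : ℝ} (hq : 0 < q) (n : ℕ) :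
    ∑ Q ∈ dyadicCubes d n, J μ r Q ^ q ≤
      ∑' m : ℕ, ∑ Q ∈ dyadicCubes d (n + m), (μ Q * 2 ^ (-(r * (n + m : ℕ)))) ^ q := by
  classical
  have h1 : ∀ Q ∈ dyadicCubes d n, J μ r Q ^ q ≤ ∑' m : ℕ, ∑ Q' ∈ dyadicCubes d (n + m),
      if Q' ⊆ Q then (μ Q' * 2 ^ (-(r * (n + m : ℕ)))) ^ q else 0 := by
    intro Q hQ
    rw [← ENNReal.le_rpow_inv_iff hq]
    refine J_le hd fun m Q' hQ' hs => ?_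
    rw [ENNReal.le_rpow_inv_iff hq]
    obtain ⟨j, rfl⟩ := Nat.exists_eq_add_of_le (level_le_of_subset hd hQ hQ' hs)
    refine le_trans ?_ (ENNReal.le_tsum j)
    refine le_trans ?_ (Finset.single_le_sum (fun _ _ => zero_le) hQ')
    rw [if_pos hs]
  refine (Finset.sum_le_sum h1).trans ?_
  rw [← Summable.tsum_finsetSum fun _ _ => ENNReal.summable]
  refine ENNReal.tsum_le_tsum fun m => ?_
  rw [Finset.sum_comm]
  refine Finset.sum_le_sum fun Q' hQ' => ?_
  rw [← Finset.sum_filter, Finset.sum_const, nsmul_eq_mul]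
  have hcard : ((dyadicCubes d n).filter fun Q => Q' ⊆ Q).card ≤ 1 := by
    refine Finset.card_le_one.2 fun Q hQ R hR => ?_
    obtain ⟨x, hx⟩ := nonempty_of_mem_dyadicCubes hQ'
    rw [Finset.mem_filter] at hQ hR
    exact eq_of_mem hQ.1 hR.1 (hQ.2 hx) (hR.2 hx)
  calc _ ≤ ((1 : ℕ) : ℝ≥0∞) * _ := by gcongr
    _ = _ := by simp

theorem tsum_two_rpow_ne_top {t : ℝ} (ht : t < 0) : ∑' m : ℕ, (2 : ℝ≥0∞) ^ (t * m) ≠ ⊤ := by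
  have : ∀ m : ℕ, (2 : ℝ≥0∞) ^ (t * m) = (2 ^ t) ^ m := fun m => by
    rw [ENNReal.rpow_mul, ENNReal.rpow_natCast]
  simp_rw [this]
  rw [ENNReal.tsum_geometric, ENNReal.inv_ne_top]
  exact (tsub_pos_iff_lt.2 (ENNReal.rpow_lt_one_of_one_lt_of_neg (by norm_num) ht)).ne'

/-- The converse of `beta_lt_of_tau_neg`: below the line of slope `r` through the origin, the sums
over the finer levels form a geometric series. -/
theorem tau_neg_of_beta_lt (hd : 0 < d) {μ : Measure (Fin d → ℝ)} {r q : ℝ} (hq : 0 < q)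
    (h : beta μ q < (r * q : ℝ)) : tau μ r q < 0 := by
  obtain ⟨t, ht, h1⟩ := exists_eventually_of_partitionFunction_lt hq h
  have ht' : t - r * q < 0 := by linarith
  have h2 : tau μ r q ≤ (t - r * q : ℝ) := by
    refine partitionFunction_le hq (tsum_two_rpow_ne_top ht') ?_
    filter_upwards [eventually_forall_ge_atTop.2 h1] with n hn
    refine (sum_J_rpow_le hd μ r hq n).trans ?_
    rw [← ENNReal.tsum_mul_right]
    refine ENNReal.tsum_le_tsum fun m => ?_
    calc ∑ Q ∈ dyadicCubes d (n + m), (μ Q * 2 ^ (-(r * (n + m : ℕ)))) ^ q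
        = (∑ Q ∈ dyadicCubes d (n + m), μ Q ^ q) * 2 ^ (-(r * q) * (n + m : ℕ)) := by
          rw [Finset.sum_mul]
          refine Finset.sum_congr rfl fun Q _ => ?_
          rw [ENNReal.mul_rpow_of_nonneg _ _ hq.le, ← ENNReal.rpow_mul]
          ring_nf
      _ ≤ 2 ^ (t * (n + m : ℕ)) * 2 ^ (-(r * q) * (n + m : ℕ)) := by
          gcongr
          exact hn (n + m) (by omega)
      _ = _ := by
          rw [← two_rpow_add, ← two_rpow_add]
          push_cast
          ring_nf
  exact h2.trans_lt (by exact_mod_cast ht')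

theorem qCrit_le (hd : 0 < d) {μ : Measure (Fin d → ℝ)} {r q : ℝ} (hq : 0 < q)
    (h : beta μ q < (r * q : ℝ)) : qCrit μ r ≤ q :=
  iInf₂_le_of_le (f := fun (q : ℝ) _ => (q : EReal)) q ⟨hq, tau_neg_of_beta_lt hd hq h⟩ le_rfl

theorem le_beta_of_lt_qCrit (hd : 0 < d) {μ : Measure (Fin d → ℝ)} {r q : ℝ} (hq : 0 < q)
    (h : (q : EReal) < qCrit μ r) : ((r * q : ℝ) : EReal) ≤ beta μ q := by
  by_contra! hcon
  exact absurd h (not_lt.2 (qCrit_le hd hq hcon))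

theorem exists_of_qCrit_lt (hd : 0 < d) {μ : Measure (Fin d → ℝ)} {r : ℝ} {q : EReal}
    (h : qCrit μ r < q) : ∃ p : ℝ, 0 < p ∧ (p : EReal) < q ∧ beta μ p < (r * p : ℝ) := by
  obtain ⟨p, hp⟩ := iInf_lt_iff.1 h
  obtain ⟨hp1, hp2⟩ := iInf_lt_iff.1 hp
  exact ⟨p, hp1.1, hp2, beta_lt_of_tau_neg hd hp1.1 hp1.2⟩

theorem le_qCrit (hd : 0 < d) {μ : Measure (Fin d → ℝ)} {r : ℝ} {b : EReal}
    (h : ∀ q : ℝ, 0 < q → beta μ q < (r * q : ℝ) → b ≤ q) : b ≤ qCrit μ r :=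
  le_iInf₂ fun q hq => h q hq.1 (beta_lt_of_tau_neg hd hq.1 hq.2)

/-- The spectrum decreases at least with slope `dimInfty`. -/
theorem beta_le_sub {μ : Measure (Fin d → ℝ)} {c q q' b : ℝ} (hc : (c : EReal) < dimInfty μ)
    (hq : 0 < q) (hqq : q ≤ q') (hb : beta μ q < b) : beta μ q' < (b - c * (q' - q) : ℝ) := by
  obtain ⟨t, ht, h1⟩ := exists_eventually_of_partitionFunction_lt hq hb
  have : beta μ q' ≤ (t - c * (q' - q) : ℝ) := by
    refine partitionFunction_le (hq.trans_le hqq) ENNReal.one_ne_top ?_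
    filter_upwards [h1, eventually_measure_le hc] with n hn hn'
    calc ∑ Q ∈ dyadicCubes d n, μ Q ^ q'
        ≤ ∑ Q ∈ dyadicCubes d n, μ Q ^ q * 2 ^ (-c * n * (q' - q)) := by
          refine Finset.sum_le_sum fun Q hQ => ?_
          rw [← add_sub_cancel q q', ENNReal.rpow_add_of_nonneg _ _ hq.le (by linarith),
            ENNReal.rpow_mul]
          rw [add_sub_cancel]
          gcongr
          exact hn' Q hQ
      _ ≤ 2 ^ (t * n) * 2 ^ (-c * n * (q' - q)) := by
          rw [← Finset.sum_mul]
          gcongr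
      _ = 1 * 2 ^ ((t - c * (q' - q)) * n) := by
          rw [← two_rpow_add, one_mul]
          ring_nf
  refine this.trans_lt ?_
  exact_mod_cast (by linarith : t - c * (q' - q) < b - c * (q' - q))

theorem beta_one {μ : Measure (Fin d → ℝ)} [IsProbabilityMeasure μ] (hμ : μ (unitCube d)ᶜ = 0) :
    beta μ 1 = 0 := by
  have h : ∀ n : ℕ, ∑ Q ∈ dyadicCubes d n, μ Q ^ (1 : ℝ) = 1 := fun n => by
    simpa using sum_measure_eq_one hμ (isDyadicPartition_dyadicCubes n)
  refine le_antisymm ?_ ?_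
  · exact_mod_cast partitionFunction_le (t := 0) one_pos ENNReal.one_ne_top
      (Eventually.of_forall fun n => by rw [h n]; simp)
  · exact_mod_cast le_partitionFunction (t := 0) one_pos
      (Eventually.of_forall fun n => by rw [h n]; simp)

theorem card_dyadicCubes_rpow_le {p : ℝ} (hp : 0 ≤ p) (n : ℕ) :
    ((dyadicCubes d n).card : ℝ≥0∞) ^ p ≤ 2 ^ (d * p * n) := by
  have h : ((dyadicCubes d n).card : ℝ≥0∞) ≤ 2 ^ ((n * d : ℕ) : ℝ) := by
    rw [ENNReal.rpow_natCast]
    exact_mod_cast card_dyadicCubes_le n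
  calc _ ≤ ((2 : ℝ≥0∞) ^ ((n * d : ℕ) : ℝ)) ^ p := ENNReal.rpow_le_rpow h hp
    _ = _ := by
      rw [← ENNReal.rpow_mul]
      push_cast
      ring_nf

theorem beta_le_of_le_one {μ : Measure (Fin d → ℝ)} [IsProbabilityMeasure μ]
    (hμ : μ (unitCube d)ᶜ = 0) {q : ℝ} (hq : 0 < q) (hq1 : q ≤ 1) :
    beta μ q ≤ (d * (1 - q) : ℝ) := by
  refine partitionFunction_le hq ENNReal.one_ne_top (Eventually.of_forall fun n => ?_)
  have h1 := ENNReal.rpow_sum_le_const_mul_sum_rpow (dyadicCubes d n) (fun Q => μ Q ^ q)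
    ((one_le_inv₀ hq).2 hq1)
  simp_rw [ENNReal.rpow_rpow_inv hq.ne'] at h1
  rw [sum_measure_eq_one hμ (isDyadicPartition_dyadicCubes n), mul_one,
    ENNReal.rpow_inv_le_iff hq, ← ENNReal.rpow_mul, sub_mul, inv_mul_cancel₀ hq.ne', one_mul] at h1
  rw [one_mul]
  exact h1.trans (card_dyadicCubes_rpow_le (by linarith) n)

theorem le_beta_of_one_le {μ : Measure (Fin d → ℝ)} [IsProbabilityMeasure μ]
    (hμ : μ (unitCube d)ᶜ = 0) {q : ℝ} (hq1 : 1 ≤ q) :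
    ((-(d * (q - 1)) : ℝ) : EReal) ≤ beta μ q := by
  refine le_partitionFunction (by linarith) (Eventually.of_forall fun n => ?_)
  have h1 := ENNReal.rpow_sum_le_const_mul_sum_rpow (dyadicCubes d n) (fun Q => μ Q) hq1
  rw [sum_measure_eq_one hμ (isDyadicPartition_dyadicCubes n), ENNReal.one_rpow] at h1
  have h2 : 1 ≤ 2 ^ (d * (q - 1) * n) * ∑ Q ∈ dyadicCubes d n, μ Q ^ q :=
    h1.trans (by gcongr; exact card_dyadicCubes_rpow_le (by linarith) n)
  rw [neg_mul, ENNReal.rpow_neg, ENNReal.inv_le_iff_le_mul (fun _ => two_rpow_ne_zero _)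
    (fun h => absurd h (two_rpow_ne_top _))]
  exact h2

theorem beta_nonneg_of_le_one {μ : Measure (Fin d → ℝ)} [IsProbabilityMeasure μ]
    (hμ : μ (unitCube d)ᶜ = 0) {q : ℝ} (hq : 0 < q) (hq1 : q ≤ 1) : 0 ≤ beta μ q := by
  refine le_partitionFunction (t := 0) hq (Eventually.of_forall fun n => ?_)
  rw [zero_mul, ENNReal.rpow_zero, ← sum_measure_eq_one hμ (isDyadicPartition_dyadicCubes n)]
  refine Finset.sum_le_sum fun Q _ => ?_
  calc μ Q = μ Q ^ (1 : ℝ) := by simp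
    _ ≤ _ := ENNReal.rpow_le_rpow_of_exponent_ge prob_le_one hq1

end Growth

section Entropy

variable {d : ℕ}

/-! ### Partition entropies -/

theorem minPartitionCard_le {μ : Measure (Fin d → ℝ)} {r x : ℝ} {P : Finset (Set (Fin d → ℝ))}
    (hP : IsDyadicPartition P) (h : ∀ Q ∈ P, J μ r Q < ENNReal.ofReal (1 / x)) :
    minPartitionCard μ r x ≤ P.card :=
  iInf₂_le_of_le (f := fun (P : Finset (Set (Fin d → ℝ))) _ => (P.card : ℝ≥0∞)) P ⟨hP, h⟩ le_rfl

theorem le_minPartitionCard {μ : Measure (Fin d → ℝ)} {r x : ℝ} {b : ℝ≥0∞}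
    (h : ∀ P : Finset (Set (Fin d → ℝ)), IsDyadicPartition P →
      (∀ Q ∈ P, J μ r Q < ENNReal.ofReal (1 / x)) → b ≤ P.card) : b ≤ minPartitionCard μ r x :=
  le_iInf₂ fun P hP => h P hP.1 hP.2

theorem one_le_minPartitionCard (μ : Measure (Fin d → ℝ)) (r x : ℝ) :
    1 ≤ minPartitionCard μ r x :=
  le_minPartitionCard fun _ hP _ => by
    exact_mod_cast (nonempty_of_isDyadicPartition hP).card_pos

theorem exists_partition_of_minPartitionCard_lt {μ : Measure (Fin d → ℝ)} {r x : ℝ} {n : ℕ}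
    (h : minPartitionCard μ r x < (n + 1 : ℕ)) :
    ∃ P : Finset (Set (Fin d → ℝ)), IsDyadicPartition P ∧
      (∀ Q ∈ P, J μ r Q < ENNReal.ofReal (1 / x)) ∧ P.card ≤ n := by
  obtain ⟨P, hP⟩ := iInf_lt_iff.1 h
  obtain ⟨hP1, hP2⟩ := iInf_lt_iff.1 hP
  exact ⟨P, hP1.1, hP1.2, Nat.lt_succ_iff.1 (by exact_mod_cast hP2)⟩

theorem minPartitionCard_anti (hd : 0 < d) (μ : Measure (Fin d → ℝ)) {r s : ℝ} (h : r ≤ s)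
    (x : ℝ) : minPartitionCard μ s x ≤ minPartitionCard μ r x :=
  le_minPartitionCard fun _ hP hJ =>
    minPartitionCard_le hP fun Q hQ => (J_anti hd μ h Q).trans_lt (hJ Q hQ)

theorem eventually_of_upperEntropy_lt {μ : Measure (Fin d → ℝ)} {r h : ℝ}
    (hh : upperEntropy μ r < h) :
    ∀ᶠ x : ℝ in atTop, minPartitionCard μ r x ≤ ENNReal.ofReal x ^ h := by
  filter_upwards [eventually_lt_of_limsup_lt hh, eventually_gt_atTop 1] with x hx hx1
  exact (log_div_log_le_iff hx1 _ _).1 hx.le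

theorem frequently_of_lowerEntropy_lt {μ : Measure (Fin d → ℝ)} {r h : ℝ}
    (hh : lowerEntropy μ r < h) :
    ∃ᶠ x : ℝ in atTop, minPartitionCard μ r x ≤ ENNReal.ofReal x ^ h := by
  refine ((frequently_lt_of_liminf_lt (by isBoundedDefault) hh).and_eventually
    (eventually_gt_atTop 1)).mono fun x hx => ?_
  exact (log_div_log_le_iff hx.2 _ _).1 hx.1.le

theorem upperEntropy_le {μ : Measure (Fin d → ℝ)} {r h : ℝ} {C : ℝ≥0∞} (hC : C ≠ ⊤)
    (hM : ∀ᶠ x : ℝ in atTop, minPartitionCard μ r x ≤ C * ENNReal.ofReal x ^ h) :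
    upperEntropy μ r ≤ h := by
  refine EReal.le_of_forall_lt_iff_le.1 fun s hs => ?_
  have hs' : 0 < s - h := sub_pos.2 (by exact_mod_cast hs)
  refine limsup_le_of_le (by isBoundedDefault) ?_
  have h1 : Tendsto (fun x : ℝ => ENNReal.ofReal x ^ (s - h)) atTop (𝓝 ⊤) :=
    (ENNReal.tendsto_rpow_at_top hs').comp ENNReal.tendsto_ofReal_atTop
  filter_upwards [hM, h1.eventually (lt_mem_nhds (lt_top_iff_ne_top.2 hC)),
    eventually_gt_atTop 1] with x hx hC' hx1
  rw [log_div_log_le_iff hx1]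
  calc _ ≤ _ := hx
    _ ≤ ENNReal.ofReal x ^ (s - h) * ENNReal.ofReal x ^ h := by gcongr
    _ = _ := by
      rw [← ENNReal.rpow_add _ _ (by simpa using (by linarith : 0 < x)) (by simp)]
      ring_nf

theorem lowerEntropy_le_upperEntropy (μ : Measure (Fin d → ℝ)) (r : ℝ) :
    lowerEntropy μ r ≤ upperEntropy μ r := liminf_le_limsup

theorem upperEntropy_nonneg (μ : Measure (Fin d → ℝ)) (r : ℝ) : 0 ≤ upperEntropy μ r := by
  refine le_limsup_of_frequently_le' (Eventually.frequently ?_)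
  filter_upwards [eventually_ge_atTop 1] with x hx
  exact EReal.div_nonneg (ENNReal.zero_le_log_iff.2 (one_le_minPartitionCard μ r x))
    (EReal.coe_nonneg.2 (Real.log_nonneg hx))

theorem lowerEntropy_nonneg (μ : Measure (Fin d → ℝ)) (r : ℝ) : 0 ≤ lowerEntropy μ r := by
  refine le_liminf_of_le (by isBoundedDefault) ?_
  filter_upwards [eventually_ge_atTop 1] with x hx
  exact EReal.div_nonneg (ENNReal.zero_le_log_iff.2 (one_le_minPartitionCard μ r x))
    (EReal.coe_nonneg.2 (Real.log_nonneg hx))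

theorem lowerEntropy_anti (hd : 0 < d) (μ : Measure (Fin d → ℝ)) : Antitone (lowerEntropy μ) := by
  intro r s h
  refine liminf_le_liminf ?_
  filter_upwards [eventually_ge_atTop 1] with x hx
  exact EReal.div_le_div_right_of_nonneg (EReal.coe_nonneg.2 (Real.log_nonneg hx))
    (ENNReal.log_le_log (minPartitionCard_anti hd μ h x))

theorem tendsto_lowerEntropyLim (hd : 0 < d) (μ : Measure (Fin d → ℝ)) (r : ℝ) :
    Tendsto (fun ε => lowerEntropy μ (r - ε)) (𝓝[>] (0 : ℝ)) (𝓝 (lowerEntropyLim μ r)) :=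
  tendsto_nhds_limUnder ⟨_, Monotone.tendsto_nhdsGT
    (fun _ _ h => lowerEntropy_anti hd μ (by linarith)) 0⟩

theorem lowerEntropy_le_lowerEntropyLim (hd : 0 < d) (μ : Measure (Fin d → ℝ)) (r : ℝ) :
    lowerEntropy μ r ≤ lowerEntropyLim μ r :=
  ge_of_tendsto (tendsto_lowerEntropyLim hd μ r) (eventually_nhdsWithin_of_forall fun ε hε =>
    lowerEntropy_anti hd μ (by linarith [Set.mem_Ioi.1 hε]))

/-! ### Coarse multifractal dimensions and entropies -/

/-- A partition into cubes with `J < θ` refines every cube with `θ ≤ J`. -/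
theorem card_le_card_of_partition {μ : Measure (Fin d → ℝ)} {r : ℝ} {θ : ℝ≥0∞} {n : ℕ}
    {T P : Finset (Set (Fin d → ℝ))} (hT : T ⊆ dyadicCubes d n) (hTJ : ∀ Q ∈ T, θ ≤ J μ r Q)
    (hP : IsDyadicPartition P) (hPJ : ∀ Q ∈ P, J μ r Q < θ) : T.card ≤ P.card := by
  have key : ∀ Q ∈ T, ∃ R ∈ P, R ⊆ Q := by
    intro Q hQ
    obtain ⟨x, hx⟩ := nonempty_of_mem_dyadicCubes (hT hQ)
    have hx' := subset_unitCube (hT hQ) hx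
    rw [← hP.2.2] at hx'
    obtain ⟨R, hR, hxR⟩ := hx'
    rcases subset_or_subset_or_disjoint (hP.1 hR) ⟨n, hT hQ⟩ with h | h | h
    · exact ⟨R, hR, h⟩
    · exact absurd ((hTJ Q hQ).trans (J_mono μ r h)) (not_le.2 (hPJ R hR))
    · exact absurd hx (Set.disjoint_left.1 h hxR)
  choose! f hf hf' using key
  refine Finset.card_le_card_of_injOn f hf fun Q hQ Q' hQ' heq => ?_
  obtain ⟨m, hm⟩ := hP.1 (hf Q hQ)
  obtain ⟨x, hx⟩ := nonempty_of_mem_dyadicCubes hm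
  exact eq_of_mem (hT hQ) (hT hQ') (hf' Q hQ hx) (hf' Q' hQ' (heq ▸ hx))

open Classical in
/-- The cubes that are counted by `coarseCount`. -/
noncomputable def coarseCubes (μ : Measure (Fin d → ℝ)) (α r : ℝ) (n : ℕ) :
    Finset (Set (Fin d → ℝ)) :=
  (dyadicCubes d n).filter (fun Q => ENNReal.ofReal ((2 : ℝ) ^ (-α * n)) ≤ J μ r Q)

theorem card_coarseCubes (μ : Measure (Fin d → ℝ)) (α r : ℝ) (n : ℕ) :
    (coarseCubes μ α r n).card = coarseCount μ α r n := by
  unfold coarseCubes coarseCount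
  congr

theorem mem_coarseCubes {μ : Measure (Fin d → ℝ)} {α r : ℝ} {n : ℕ} {Q : Set (Fin d → ℝ)} :
    Q ∈ coarseCubes μ α r n ↔ Q ∈ dyadicCubes d n ∧ (2 : ℝ≥0∞) ^ (-α * n) ≤ J μ r Q := by
  rw [coarseCubes, Finset.mem_filter, ofReal_two_rpow]

theorem coarseCount_le_minPartitionCard {μ : Measure (Fin d → ℝ)} {α r x : ℝ} {n : ℕ}
    (hx : (2 : ℝ) ^ (α * n) ≤ x) : (coarseCount μ α r n : ℝ≥0∞) ≤ minPartitionCard μ r x := by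
  refine le_minPartitionCard fun P hP hPJ => ?_
  rw [← card_coarseCubes]
  refine Nat.cast_le.2 (card_le_card_of_partition (fun Q hQ => (mem_coarseCubes.1 hQ).1)
    (fun Q hQ => (mem_coarseCubes.1 hQ).2) hP fun Q hQ => (hPJ Q hQ).trans_le ?_)
  rw [← ofReal_two_rpow, neg_mul, Real.rpow_neg (by norm_num), one_div]
  exact ENNReal.ofReal_le_ofReal (inv_anti₀ (by positivity) hx)

theorem two_rpow_le_of_lt_posLog {N n : ℕ} (hn : 0 < n) {t : ℝ} (ht : 0 ≤ t)
    (h : t < Real.posLog N / Real.log ((2 : ℝ) ^ n)) : (2 : ℝ) ^ (t * n) ≤ N := by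
  have hl : 0 < Real.log ((2 : ℝ) ^ n) := Real.log_pos (one_lt_two_pow_of_pos hn)
  rw [lt_div_iff₀ hl] at h
  have h0 : 0 < Real.posLog N := lt_of_le_of_lt (by positivity) h
  have hN : N ≠ 0 := by rintro rfl; simp at h0
  have hN' : (1 : ℝ) ≤ N := by exact_mod_cast Nat.one_le_iff_ne_zero.2 hN
  rw [Real.posLog_eq_log (by rwa [Nat.abs_cast])] at h
  rw [← Real.log_le_log_iff (by positivity) (by linarith), Real.log_rpow (by norm_num)]
  rw [Real.log_pow] at h
  linarith

theorem le_two_rpow_of_posLog_lt {N n : ℕ} (hn : 0 < n) {t : ℝ}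
    (h : Real.posLog N / Real.log ((2 : ℝ) ^ n) < t) : (N : ℝ) ≤ (2 : ℝ) ^ (t * n) := by
  have hl : 0 < Real.log ((2 : ℝ) ^ n) := Real.log_pos (one_lt_two_pow_of_pos hn)
  rcases Nat.eq_zero_or_pos N with rfl | hN
  · simp only [Nat.cast_zero]; positivity
  rw [div_lt_iff₀ hl] at h
  have hN' : (0 : ℝ) < N := by exact_mod_cast hN
  rw [← Real.log_le_log_iff hN' (by positivity), Real.log_rpow (by norm_num)]
  rw [Real.log_pow] at h
  have : Real.log N ≤ Real.posLog N := le_max_right _ _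
  linarith

theorem frequently_of_lt_upperCoarseDim {μ : Measure (Fin d → ℝ)} {r v : ℝ} (hv : 0 ≤ v)
    (h : v < upperCoarseDim μ r) :
    ∃ α : ℝ, 0 < α ∧ ∃ᶠ n : ℕ in atTop, (2 : ℝ) ^ (v * α * n) ≤ coarseCount μ α r n := by
  obtain ⟨α, hα⟩ := lt_iSup_iff.1 h
  obtain ⟨hα0, hα⟩ := lt_iSup_iff.1 hα
  rw [EReal.lt_div_iff (by exact_mod_cast hα0) (EReal.coe_ne_top _), ← EReal.coe_mul] at hα
  refine ⟨α, hα0, ((frequently_lt_of_lt_limsup (by isBoundedDefault) hα).and_eventually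
    (eventually_gt_atTop 0)).mono fun n hn => ?_⟩
  exact two_rpow_le_of_lt_posLog hn.2 (by positivity) (by exact_mod_cast hn.1)

theorem eventually_of_lt_lowerCoarseDim {μ : Measure (Fin d → ℝ)} {r v : ℝ} (hv : 0 ≤ v)
    (h : v < lowerCoarseDim μ r) :
    ∃ α : ℝ, 0 < α ∧ ∀ᶠ n : ℕ in atTop, (2 : ℝ) ^ (v * α * n) ≤ coarseCount μ α r n := by
  obtain ⟨α, hα⟩ := lt_iSup_iff.1 h
  obtain ⟨hα0, hα⟩ := lt_iSup_iff.1 hα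
  rw [EReal.lt_div_iff (by exact_mod_cast hα0) (EReal.coe_ne_top _), ← EReal.coe_mul] at hα
  refine ⟨α, hα0, ((eventually_lt_of_lt_liminf hα).and (eventually_gt_atTop 0)).mono fun n hn => ?_⟩
  exact two_rpow_le_of_lt_posLog hn.2 (by positivity) (by exact_mod_cast hn.1)

theorem eventually_of_upperCoarseDim_lt {μ : Measure (Fin d → ℝ)} {r v : ℝ}
    (h : upperCoarseDim μ r < v) {α : ℝ} (hα : 0 < α) :
    ∀ᶠ n : ℕ in atTop, (coarseCount μ α r n : ℝ) ≤ (2 : ℝ) ^ (v * α * n) := by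
  have h1 : limsup (fun n : ℕ =>
      ((Real.posLog (coarseCount μ α r n) / Real.log ((2 : ℝ) ^ n) : ℝ) : EReal)) atTop /
      (α : EReal) < v := (le_iSup₂ (f := fun (α : ℝ) (_ : 0 < α) => limsup (fun n : ℕ =>
      ((Real.posLog (coarseCount μ α r n) / Real.log ((2 : ℝ) ^ n) : ℝ) : EReal)) atTop /
      (α : EReal)) α hα).trans_lt h
  rw [EReal.div_lt_iff (by exact_mod_cast hα) (EReal.coe_ne_top _), ← EReal.coe_mul] at h1
  filter_upwards [eventually_lt_of_limsup_lt h1, eventually_gt_atTop 0] with n hn hn0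
  exact le_two_rpow_of_posLog_lt hn0 (by exact_mod_cast hn)

theorem lowerCoarseDim_nonneg (μ : Measure (Fin d → ℝ)) (r : ℝ) : 0 ≤ lowerCoarseDim μ r := by
  refine le_trans ?_ (le_iSup₂ (f := fun (α : ℝ) (_ : 0 < α) => liminf (fun n : ℕ =>
      ((Real.posLog (coarseCount μ α r n) / Real.log ((2 : ℝ) ^ n) : ℝ) : EReal)) atTop /
      (α : EReal)) 1 one_pos)
  refine EReal.div_nonneg (le_liminf_of_le (by isBoundedDefault) (Eventually.of_forall fun n => ?_))
    (by simp)
  exact EReal.coe_nonneg.2 (div_nonneg Real.posLog_nonneg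
    (Real.log_nonneg (one_le_pow₀ (by norm_num))))

theorem lowerCoarseDim_le_upperCoarseDim (μ : Measure (Fin d → ℝ)) (r : ℝ) :
    lowerCoarseDim μ r ≤ upperCoarseDim μ r :=
  iSup₂_mono fun α hα => EReal.div_le_div_right_of_nonneg (by exact_mod_cast hα.le)
    liminf_le_limsup

theorem upperCoarseDim_le_upperEntropy (μ : Measure (Fin d → ℝ)) (r : ℝ) :
    upperCoarseDim μ r ≤ upperEntropy μ r := by
  refine EReal.ge_of_forall_gt_iff_ge.1 fun v hv => ?_
  rcases lt_or_ge v 0 with hv0 | hv0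
  · exact le_trans (by exact_mod_cast hv0.le) (upperEntropy_nonneg μ r)
  obtain ⟨α, hα, hf⟩ := frequently_of_lt_upperCoarseDim hv0 hv
  have ht : Tendsto (fun n : ℕ => (2 : ℝ) ^ (α * n)) atTop atTop :=
    (tendsto_rpow_atTop_of_base_gt_one 2 (by norm_num)).comp
      (tendsto_natCast_atTop_atTop.const_mul_atTop hα)
  refine le_limsup_of_frequently_le' (ht.frequently ?_)
  refine (hf.and_eventually (eventually_gt_atTop 0)).mono fun n hn => ?_
  have hn0 : (0 : ℝ) < n := by exact_mod_cast hn.2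
  rw [le_log_div_log_iff (Real.one_lt_rpow (by norm_num) (by positivity)), ofReal_two_rpow,
    ← ENNReal.rpow_mul, ← ofReal_two_rpow]
  refine le_trans ?_ (coarseCount_le_minPartitionCard le_rfl)
  rw [← ENNReal.ofReal_natCast]
  refine ENNReal.ofReal_le_ofReal (le_trans (le_of_eq ?_) hn.1)
  ring_nf

theorem lowerCoarseDim_le_lowerEntropy (μ : Measure (Fin d → ℝ)) (r : ℝ) :
    lowerCoarseDim μ r ≤ lowerEntropy μ r := by
  refine EReal.ge_of_forall_gt_iff_ge.1 fun v hv => ?_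
  rcases lt_or_ge v 0 with hv0 | hv0
  · exact le_trans (by exact_mod_cast hv0.le) (lowerEntropy_nonneg μ r)
  obtain ⟨w, hvw, hw⟩ := EReal.lt_iff_exists_real_btwn.1 hv
  have hvw' : v < w := by exact_mod_cast hvw
  obtain ⟨α, hα, hf⟩ := eventually_of_lt_lowerCoarseDim (hv0.trans hvw'.le) hw
  -- the scale `n` that belongs to `x` is the integer part of `log₂ x / α`
  have ht : Tendsto (fun x : ℝ => ⌊Real.logb 2 x / α⌋₊) atTop atTop :=
    tendsto_nat_floor_atTop.comp
      ((Real.tendsto_logb_atTop (by norm_num)).atTop_div_const hα)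
  refine le_liminf_of_le (by isBoundedDefault) ?_
  filter_upwards [ht.eventually hf, eventually_gt_atTop 1,
    (Real.tendsto_logb_atTop (b := 2) (by norm_num)).eventually_ge_atTop (w * α / (w - v))]
    with x hx hx1 hx2
  have hx0 : 0 < x := by linarith
  set n := ⌊Real.logb 2 x / α⌋₊
  have hlog : 0 ≤ Real.logb 2 x := Real.logb_nonneg (by norm_num) hx1.le
  have hn1 : α * n ≤ Real.logb 2 x := by
    have := Nat.floor_le (div_nonneg hlog hα.le)
    rw [le_div_iff₀ hα] at this
    linarith
  have hn2 : Real.logb 2 x ≤ α * n + α := by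
    have := (Nat.lt_floor_add_one (Real.logb 2 x / α)).le
    rw [div_le_iff₀ hα] at this
    linarith
  have hxe : x = 2 ^ Real.logb 2 x := (Real.rpow_logb (by norm_num) (by norm_num) hx0).symm
  rw [le_log_div_log_iff hx1]
  refine le_trans ?_ (coarseCount_le_minPartitionCard (α := α) (n := n) ?_)
  · rw [ENNReal.ofReal_rpow_of_pos hx0, ← ENNReal.ofReal_natCast]
    refine ENNReal.ofReal_le_ofReal (le_trans ?_ hx)
    conv_lhs => rw [hxe]
    rw [← Real.rpow_mul (by norm_num)]
    refine Real.rpow_le_rpow_of_exponent_le (by norm_num) ?_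
    rw [div_le_iff₀ (by linarith)] at hx2
    have : w * Real.logb 2 x ≤ w * (α * n + α) :=
      mul_le_mul_of_nonneg_left hn2 (hv0.trans hvw'.le)
    nlinarith
  · conv_rhs => rw [hxe]
    exact Real.rpow_le_rpow_of_exponent_le (by norm_num) hn1

/-! ### The entropy is at most the critical value -/

open Classical in
/-- The maximal cubes with `J < θ` form a partition; every one of them is the unit cube or a child
of a cube with `θ ≤ J`, which bounds their number. -/
theorem exists_partition_card_le {μ : Measure (Fin d → ℝ)} {r : ℝ} {θ : ℝ≥0∞} {L : ℕ}
    (hd : 0 < d) (hL : ∀ Q ∈ dyadicCubes d L, J μ r Q < θ) :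
    ∃ P : Finset (Set (Fin d → ℝ)), IsDyadicPartition P ∧ (∀ Q ∈ P, J μ r Q < θ) ∧
      P.card ≤ 1 + ∑ n ∈ Finset.range L,
        ((dyadicCubes d n).filter fun Q => θ ≤ J μ r Q).card * 2 ^ d := by
  set G : Finset (Set (Fin d → ℝ)) :=
    ((Finset.range (L + 1)).biUnion fun n => dyadicCubes d n).filter fun Q => J μ r Q < θ with hG
  have memG : ∀ {Q}, Q ∈ G ↔ (∃ n ≤ L, Q ∈ dyadicCubes d n) ∧ J μ r Q < θ := by
    intro Q
    simp [hG]
  set P := G.filter fun Q => ∀ R ∈ G, Q ⊆ R → R ⊆ Q with hPdef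
  have memP : ∀ {Q}, Q ∈ P ↔ Q ∈ G ∧ ∀ R ∈ G, Q ⊆ R → R ⊆ Q := by
    intro Q
    simp [hPdef]
  have hGall : ∀ Q ∈ G, Q ∈ allDyadicCubes d := fun Q hQ => by
    obtain ⟨⟨n, -, hn⟩, -⟩ := memG.1 hQ
    exact ⟨n, hn⟩
  refine ⟨P, ⟨fun Q hQ => hGall Q (memP.1 hQ).1, ?_, ?_⟩, fun Q hQ => (memG.1 (memP.1 hQ).1).2, ?_⟩
  · intro Q hQ R hR hne
    obtain ⟨hQG, hQm⟩ := memP.1 hQ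
    obtain ⟨hRG, hRm⟩ := memP.1 hR
    rcases subset_or_subset_or_disjoint (hGall Q hQG) (hGall R hRG) with h | h | h
    · exact absurd (h.antisymm (hQm R hRG h)) hne
    · exact absurd ((hRm Q hQG h).antisymm h) hne
    · exact h
  · ext x
    constructor
    · rintro ⟨Q, hQ, hx⟩
      obtain ⟨⟨n, -, hn⟩, -⟩ := memG.1 (memP.1 hQ).1
      exact subset_unitCube hn hx
    · intro hx
      obtain ⟨Q, hQ, hxQ⟩ := exists_mem_dyadicCubes L hx
      obtain ⟨R, hQR, hR⟩ := G.exists_le_maximal (memG.2 ⟨⟨L, le_rfl, hQ⟩, hL Q hQ⟩)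
      exact ⟨R, memP.2 ⟨hR.1, fun S hS h => hR.2 hS h⟩, hQR hxQ⟩
  · have hsub : P ⊆ {unitCube d} ∪ (Finset.range L).biUnion fun n =>
        ((dyadicCubes d n).filter fun Q => θ ≤ J μ r Q).biUnion fun Q =>
          (dyadicCubes d (n + 1)).filter (· ⊆ Q) := by
      intro Q hQ
      obtain ⟨hQG, hQm⟩ := memP.1 hQ
      obtain ⟨⟨n, hnL, hn⟩, -⟩ := memG.1 hQG
      rcases n with _ | n
      · rw [dyadicCubes_zero] at hn
        exact Finset.mem_union_left _ hn
      · obtain ⟨R, hR, hQR⟩ := exists_superset (Nat.le_succ n) hn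
        refine Finset.mem_union_right _ (Finset.mem_biUnion.2 ⟨n, Finset.mem_range.2 hnL,
          Finset.mem_biUnion.2 ⟨R, Finset.mem_filter.2 ⟨hR, ?_⟩, Finset.mem_filter.2 ⟨hn, hQR⟩⟩⟩)
        by_contra! hlt
        have := hQm R (memG.2 ⟨⟨n, by omega, hR⟩, hlt⟩) hQR
        exact absurd (level_le_of_subset hd hn hR this) (by omega)
    refine (Finset.card_le_card hsub).trans ((Finset.card_union_le _ _).trans ?_)
    rw [Finset.card_singleton]
    refine Nat.add_le_add_left (Finset.card_biUnion_le.trans (Finset.sum_le_sum fun n _ => ?_)) 1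
    exact Finset.card_biUnion_le_card_mul _ _ _ fun Q hQ =>
      card_children_le (Finset.mem_filter.1 hQ).1

/-- If `tau μ r q < 0`, the sums of `J ^ q` over all levels converge, so that there are `O(x ^ q)`
cubes with `1 / x ≤ J`; their children determine an admissible partition. -/
theorem upperEntropy_le_of_tau_neg (hd : 0 < d) {μ : Measure (Fin d → ℝ)} {r q : ℝ} (hq : 0 < q)
    (h : tau μ r q < 0) : upperEntropy μ r ≤ q := by
  classical
  obtain ⟨t, ht, h1⟩ := exists_eventually_of_partitionFunction_lt (t := 0) hq h
  obtain ⟨n₀, hn₀⟩ := eventually_atTop.1 h1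
  set g : ℕ → ℝ≥0∞ := fun n => (if n < n₀ then ((dyadicCubes d n).card : ℝ≥0∞) else 0) +
    2 ^ (t * n) with hg
  have hgtop : ∑' n, g n ≠ ⊤ := by
    rw [ENNReal.tsum_add]
    refine ENNReal.add_ne_top.2 ⟨?_, tsum_two_rpow_ne_top ht⟩
    rw [tsum_eq_sum (s := Finset.range n₀) fun n hn => if_neg (by simpa using hn)]
    refine (ENNReal.sum_lt_top.2 fun n _ => ?_).ne
    split_ifs <;> simp
  refine upperEntropy_le (C := 1 + (∑' n, g n) * 2 ^ d)
    (ENNReal.add_ne_top.2 ⟨by simp, ENNReal.mul_ne_top hgtop (by simp)⟩) ?_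
  filter_upwards [eventually_ge_atTop 1] with x hx
  have hx0 : 0 < x := by linarith
  set θ := ENNReal.ofReal (1 / x) with hθ
  have hθ0 : θ ≠ 0 := by simpa [hθ] using hx0
  have hθt : θ ≠ ⊤ := ENNReal.ofReal_ne_top
  have hθx : (θ ^ q)⁻¹ = ENNReal.ofReal x ^ q := by
    rw [hθ, one_div, ENNReal.ofReal_inv_of_pos hx0, ENNReal.inv_rpow, inv_inv]
  have hxq : 1 ≤ ENNReal.ofReal x ^ q :=
    ENNReal.one_le_rpow (by simpa using hx) hq
  -- all cubes of some level have small `J`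
  obtain ⟨L, hL⟩ : ∃ L, ∀ Q ∈ dyadicCubes d L, J μ r Q < θ := by
    have ht0 : Tendsto (fun n : ℕ => (2 : ℝ≥0∞) ^ (t * n)) atTop (𝓝 0) :=
      (ENNReal.tendsto_rpow_atBot_of_one_lt_base (by norm_num)).comp
        (tendsto_natCast_atTop_atTop.const_mul_atTop_of_neg ht)
    obtain ⟨L, hL, hLn⟩ := ((ht0.eventually (gt_mem_nhds (ENNReal.rpow_pos
      (pos_iff_ne_zero.2 hθ0) hθt : 0 < θ ^ q))).and (eventually_ge_atTop n₀)).exists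
    refine ⟨L, fun Q hQ => ?_⟩
    rw [← ENNReal.rpow_lt_rpow_iff hq]
    refine lt_of_le_of_lt ?_ hL
    exact (Finset.single_le_sum (f := fun Q => J μ r Q ^ q) (fun _ _ => zero_le) hQ).trans
      (hn₀ L hLn)
  obtain ⟨P, hP, hPJ, hcard⟩ := exists_partition_card_le hd hL
  refine (minPartitionCard_le hP hPJ).trans ?_
  have hcount : ∀ n, (((dyadicCubes d n).filter fun Q => θ ≤ J μ r Q).card : ℝ≥0∞) ≤
      g n * ENNReal.ofReal x ^ q := by
    intro n
    rcases lt_or_ge n n₀ with hn | hn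
    · calc (((dyadicCubes d n).filter fun Q => θ ≤ J μ r Q).card : ℝ≥0∞)
          ≤ (dyadicCubes d n).card := by gcongr; exact Finset.filter_subset _ _
        _ ≤ g n := by simp [hg, hn]
        _ ≤ g n * ENNReal.ofReal x ^ q := le_mul_of_one_le_right' hxq
    · have h2 : (((dyadicCubes d n).filter fun Q => θ ≤ J μ r Q).card : ℝ≥0∞) * θ ^ q ≤
          2 ^ (t * n) := by
        rw [← nsmul_eq_mul, ← Finset.sum_const]
        calc _ ≤ ∑ Q ∈ (dyadicCubes d n).filter fun Q => θ ≤ J μ r Q, J μ r Q ^ q :=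
              Finset.sum_le_sum fun Q hQ => ENNReal.rpow_le_rpow (Finset.mem_filter.1 hQ).2 hq.le
          _ ≤ _ := Finset.sum_le_sum_of_subset (Finset.filter_subset _ _)
          _ ≤ _ := hn₀ n hn
      rw [← hθx, ← div_eq_mul_inv, ENNReal.le_div_iff_mul_le
        (Or.inl (ENNReal.rpow_pos (pos_iff_ne_zero.2 hθ0) hθt).ne')
        (Or.inl (ENNReal.rpow_ne_top_of_nonneg hq.le hθt))]
      exact h2.trans (by simp [hg])
  calc (P.card : ℝ≥0∞) ≤ ((1 + ∑ n ∈ Finset.range L,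
        ((dyadicCubes d n).filter fun Q => θ ≤ J μ r Q).card * 2 ^ d : ℕ) : ℝ≥0∞) := by
        exact_mod_cast hcard
    _ = 1 + (∑ n ∈ Finset.range L,
        (((dyadicCubes d n).filter fun Q => θ ≤ J μ r Q).card : ℝ≥0∞)) * 2 ^ d := by
        push_cast
        rw [Finset.sum_mul]
    _ ≤ 1 * ENNReal.ofReal x ^ q + ((∑' n, g n) * ENNReal.ofReal x ^ q) * 2 ^ d := by
        gcongr
        · simpa using hxq
        · rw [← ENNReal.tsum_mul_right]
          exact (Finset.sum_le_sum fun n _ => hcount n).trans (ENNReal.sum_le_tsum _)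
    _ = _ := by ring

theorem upperEntropy_le_qCrit (hd : 0 < d) (μ : Measure (Fin d → ℝ)) (r : ℝ) :
    upperEntropy μ r ≤ qCrit μ r :=
  le_iInf₂ fun _ hq => upperEntropy_le_of_tau_neg hd hq.1 hq.2

/-- `r ↦ qCrit μ r` is continuous from the left, because `beta μ q < r * q` is an open condition
on `r`. -/
theorem lowerEntropyLim_le_qCrit (hd : 0 < d) (μ : Measure (Fin d → ℝ)) (r : ℝ) :
    lowerEntropyLim μ r ≤ qCrit μ r := by
  refine le_qCrit hd fun q hq hb => ?_
  obtain ⟨b, hb1, hb2⟩ := EReal.lt_iff_exists_real_btwn.1 hb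
  have hb2' : b < r * q := by exact_mod_cast hb2
  refine le_of_tendsto (tendsto_lowerEntropyLim hd μ r) ?_
  have hε : 0 < r - b / q := sub_pos.2 (by rwa [div_lt_iff₀ hq])
  filter_upwards [Ioo_mem_nhdsGT hε] with ε hε'
  refine (lowerEntropy_le_upperEntropy μ _).trans ((upperEntropy_le_qCrit hd μ _).trans
    (qCrit_le hd hq (hb1.trans ?_)))
  have : b / q < r - ε := by linarith [hε'.2]
  rw [div_lt_iff₀ hq] at this
  exact_mod_cast this

/-! ### The critical value is at most the upper coarse multifractal dimension -/

/-- Above `-dimInfty` the set function `J` decays exponentially in the level. -/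
theorem eventually_J_le (hd : 0 < d) {μ : Measure (Fin d → ℝ)} {r : ℝ}
    (hr : -(dimInfty μ) < (r : EReal)) :
    ∃ δ : ℝ, 0 < δ ∧ ∀ᶠ n : ℕ in atTop, ∀ Q ∈ dyadicCubes d n, J μ r Q ≤ 2 ^ (-δ * n) := by
  obtain ⟨c, hc1, hc2⟩ := EReal.lt_iff_exists_real_btwn.1 (EReal.neg_lt_comm.1 hr)
  have hcr : -r < c := by exact_mod_cast hc1
  refine ⟨c + r, by linarith, ?_⟩
  filter_upwards [eventually_forall_ge_atTop.2 (eventually_measure_le hc2)] with n hn Q hQ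
  refine J_le hd fun m Q' hQ' hs => ?_
  have hnm := level_le_of_subset hd hQ hQ' hs
  have hnm' : (n : ℝ) ≤ m := by exact_mod_cast hnm
  calc μ Q' * 2 ^ (-(r * m)) ≤ 2 ^ (-c * m) * 2 ^ (-(r * m)) := by
        gcongr
        exact hn m hnm Q' hQ'
    _ = 2 ^ (-(c + r) * m) := by rw [← two_rpow_add]; ring_nf
    _ ≤ _ := two_rpow_mono (by nlinarith)

open Classical in
/-- A number `y` between two thresholds `2 ^ (-a (i + 1) n)` and `2 ^ (-a i n)` is bounded by the
larger one; the last term accounts for `y` below all thresholds. -/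
theorem rpow_le_sum_indicator {a : ℕ → ℝ} {q : ℝ} (hq : 0 < q) {n : ℕ} {y : ℝ≥0∞}
    (h0 : y ≤ 2 ^ (-a 0 * n)) (K : ℕ) :
    y ^ q ≤ (∑ i ∈ Finset.range K,
      if (2 : ℝ≥0∞) ^ (-a (i + 1) * n) ≤ y then (2 : ℝ≥0∞) ^ (-a i * n * q) else 0) +
      2 ^ (-a K * n * q) := by
  induction K with
  | zero =>
    rw [Finset.sum_range_zero, zero_add, ENNReal.rpow_mul]
    exact ENNReal.rpow_le_rpow h0 hq.le
  | succ K ih =>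
    rw [Finset.sum_range_succ]
    by_cases h : (2 : ℝ≥0∞) ^ (-a (K + 1) * n) ≤ y
    · rw [if_pos h]
      exact ih.trans le_self_add
    · refine le_trans ?_ le_add_self
      rw [ENNReal.rpow_mul]
      exact ENNReal.rpow_le_rpow (not_le.1 h).le hq.le

/-- The sum of `J ^ q` is split according to the size of `J` at the thresholds `2 ^ (-α n)`, with
`α` in a finite geometric progression; each part is bounded by the coarse count. -/
theorem tau_neg_of_upperCoarseDim_lt (hd : 0 < d) {μ : Measure (Fin d → ℝ)} {r q : ℝ}
    (hr : -(dimInfty μ) < (r : EReal)) (hq : 0 < q) (h : upperCoarseDim μ r < q) :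
    tau μ r q < 0 := by
  classical
  obtain ⟨δ, hδ, hJ⟩ := eventually_J_le hd hr
  obtain ⟨f', hf1, hf2⟩ := EReal.lt_iff_exists_real_btwn.1 h
  have hf2' : f' < q := by exact_mod_cast hf2
  set f := max f' (q / 2) with hf
  have hfq : f < q := max_lt hf2' (by linarith)
  have hf0 : 0 < f := lt_of_lt_of_le (by linarith) (le_max_right f' (q / 2))
  have hFf : upperCoarseDim μ r < f := hf1.trans_le (by exact_mod_cast le_max_left _ _)
  -- the ratio of the progression satisfies `f * lam < q`
  set lam := (q / f + 1) / 2 with hlam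
  have hqf : 1 < q / f := by rwa [one_lt_div hf0]
  have hlam1 : 1 < lam := by rw [hlam]; linarith
  have hflam : f * lam < q := by
    have : lam < q / f := by rw [hlam]; linarith
    rw [lt_div_iff₀ hf0] at this
    linarith
  set a : ℕ → ℝ := fun i => δ * lam ^ i with ha
  have haδ : ∀ i, δ ≤ a i := fun i => le_mul_of_one_le_right hδ.le (one_le_pow₀ hlam1.le)
  obtain ⟨K, hK⟩ : ∃ K : ℕ, (d + q * δ) / (q * δ) < lam ^ K := pow_unbounded_of_one_lt _ hlam1
  have hK' : d + q * δ ≤ a K * q := by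
    rw [div_lt_iff₀ (by positivity)] at hK
    have : a K * q = lam ^ K * (q * δ) := by simp only [ha]; ring
    linarith
  set s := min ((q - f * lam) * δ) (q * δ) with hs
  have hs0 : 0 < s := lt_min (mul_pos (by linarith) hδ) (by positivity)
  have hcount : ∀ᶠ n : ℕ in atTop, ∀ i ∈ Finset.range K,
      (coarseCount μ (a (i + 1)) r n : ℝ) ≤ (2 : ℝ) ^ (f * a (i + 1) * n) :=
    (Finset.eventually_all _).2 fun i _ =>
      eventually_of_upperCoarseDim_lt hFf (hδ.trans_le (haδ _))
  have hmain : tau μ r q ≤ (-s : ℝ) := by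
    refine partitionFunction_le hq (C := K + 1) (by simp) ?_
    filter_upwards [hJ, hcount] with n hJn hcn
    have hn0 : (0 : ℝ) ≤ n := Nat.cast_nonneg n
    calc ∑ Q ∈ dyadicCubes d n, J μ r Q ^ q
        ≤ ∑ Q ∈ dyadicCubes d n, ((∑ i ∈ Finset.range K,
            if (2 : ℝ≥0∞) ^ (-a (i + 1) * n) ≤ J μ r Q then (2 : ℝ≥0∞) ^ (-a i * n * q) else 0) +
            2 ^ (-a K * n * q)) :=
          Finset.sum_le_sum fun Q hQ =>
            rpow_le_sum_indicator (a := a) hq (by simpa [ha] using hJn Q hQ) K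
      _ = (∑ i ∈ Finset.range K,
            (coarseCount μ (a (i + 1)) r n : ℝ≥0∞) * (2 : ℝ≥0∞) ^ (-a i * n * q)) +
            (dyadicCubes d n).card * 2 ^ (-a K * n * q) := by
          rw [Finset.sum_add_distrib, Finset.sum_comm, Finset.sum_const, nsmul_eq_mul]
          congr 1
          refine Finset.sum_congr rfl fun i _ => ?_
          rw [← Finset.sum_filter, Finset.sum_const, nsmul_eq_mul, ← card_coarseCubes, coarseCubes,
            ofReal_two_rpow]
      _ ≤ (∑ _i ∈ Finset.range K, (2 : ℝ≥0∞) ^ (-s * n)) + 2 ^ (-s * n) := by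
          gcongr with i hi
          · have h1 : (coarseCount μ (a (i + 1)) r n : ℝ≥0∞) ≤ 2 ^ (f * a (i + 1) * n) := by
              rw [← ofReal_two_rpow, ← ENNReal.ofReal_natCast]
              exact ENNReal.ofReal_le_ofReal (hcn i hi)
            refine (mul_le_mul_left h1 _).trans ?_
            rw [← two_rpow_add]
            refine two_rpow_mono ?_
            have e1 : f * a (i + 1) * n + -a i * n * q = -((q - f * lam) * a i) * n := by
              simp only [ha, pow_succ]; ring
            rw [e1]
            refine mul_le_mul_of_nonneg_right (neg_le_neg ?_) hn0
            exact (min_le_left _ _).trans (mul_le_mul_of_nonneg_left (haδ i) (by linarith))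
          · have h1 := card_dyadicCubes_rpow_le (d := d) zero_le_one n
            rw [ENNReal.rpow_one] at h1
            refine (mul_le_mul_left h1 _).trans ?_
            rw [← two_rpow_add]
            refine two_rpow_mono ?_
            have : s ≤ q * δ := min_le_right _ _
            nlinarith
      _ = (K + 1) * 2 ^ (-s * n) := by
          rw [Finset.sum_const, Finset.card_range, nsmul_eq_mul]; ring
  exact hmain.trans_lt (by exact_mod_cast neg_neg_of_pos hs0)

theorem qCrit_le_upperCoarseDim (hd : 0 < d) {μ : Measure (Fin d → ℝ)} {r : ℝ}
    (hr : -(dimInfty μ) < (r : EReal)) : qCrit μ r ≤ upperCoarseDim μ r := by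
  refine EReal.le_of_forall_lt_iff_le.1 fun q hq => ?_
  have hq0 : 0 < q := by
    exact_mod_cast ((lowerCoarseDim_nonneg μ r).trans
      (lowerCoarseDim_le_upperCoarseDim μ r)).trans_lt hq
  exact iInf₂_le_of_le (f := fun (q : ℝ) _ => (q : EReal)) q
    ⟨hq0, tau_neg_of_upperCoarseDim_lt hd hr hq0 hq⟩ le_rfl

theorem upperEntropy_eq_qCrit (hd : 0 < d) {μ : Measure (Fin d → ℝ)} {r : ℝ}
    (hr : -(dimInfty μ) < (r : EReal)) : upperEntropy μ r = qCrit μ r :=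
  (upperEntropy_le_qCrit hd μ r).antisymm
    ((qCrit_le_upperCoarseDim hd hr).trans (upperCoarseDim_le_upperEntropy μ r))

theorem upperCoarseDim_eq_qCrit (hd : 0 < d) {μ : Measure (Fin d → ℝ)} {r : ℝ}
    (hr : -(dimInfty μ) < (r : EReal)) : upperCoarseDim μ r = qCrit μ r :=
  ((upperCoarseDim_le_upperEntropy μ r).trans (upperEntropy_le_qCrit hd μ r)).antisymm
    (qCrit_le_upperCoarseDim hd hr)

/-! ### Bounds for the critical value -/

theorem qCrit_nonneg (μ : Measure (Fin d → ℝ)) (r : ℝ) : 0 ≤ qCrit μ r :=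
  le_iInf₂ fun _ hq => EReal.coe_nonneg.2 hq.1.le

theorem qCrit_lt_one (hd : 0 < d) {μ : Measure (Fin d → ℝ)} [IsProbabilityMeasure μ]
    (hμ : μ (unitCube d)ᶜ = 0) {r : ℝ} (hr : 0 < r) : qCrit μ r < 1 := by
  have hd' : (0 : ℝ) < d := by exact_mod_cast hd
  have h1 : r / (2 * (d + r)) < 1 := by
    rw [div_lt_one (by positivity)]
    linarith
  have h2 : 0 < r / (2 * (d + r)) := by positivity
  refine (qCrit_le hd (q := 1 - r / (2 * (d + r))) (by linarith) ?_).trans_lt ?_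
  · refine (beta_le_of_le_one hμ (by linarith) (by linarith)).trans_lt (EReal.coe_lt_coe_iff.2 ?_)
    have : (d + r) * (r / (2 * (d + r))) = r / 2 := by field_simp
    nlinarith
  · exact_mod_cast (by linarith : 1 - r / (2 * (d + r)) < 1)

theorem one_add_le_qCrit (hd : 0 < d) {μ : Measure (Fin d → ℝ)} [IsProbabilityMeasure μ]
    (hμ : μ (unitCube d)ᶜ = 0) {r : ℝ} (hr : r < 0) :
    ((1 + -r / d : ℝ) : EReal) ≤ qCrit μ r := by
  have hd' : (0 : ℝ) < d := by exact_mod_cast hd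
  refine le_qCrit hd fun q hq hb => ?_
  rcases le_or_gt q 1 with hq1 | hq1
  · have := (beta_nonneg_of_le_one hμ hq hq1).trans_lt hb
    have h2 : 0 < r * q := by exact_mod_cast this
    nlinarith
  · have := (le_beta_of_one_le hμ hq1.le).trans_lt hb
    have h2 : -(d * (q - 1)) < r * q := by exact_mod_cast this
    refine EReal.coe_le_coe_iff.2 ?_
    have h3 : -r / d < q - 1 := by
      rw [div_lt_iff₀ hd']
      nlinarith
    linarith

theorem one_lt_qCrit (hd : 0 < d) {μ : Measure (Fin d → ℝ)} [IsProbabilityMeasure μ]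
    (hμ : μ (unitCube d)ᶜ = 0) {r : ℝ} (hr : r < 0) : 1 < qCrit μ r := by
  have h1 : 0 < -r / d := div_pos (neg_pos.2 hr) (by exact_mod_cast hd)
  exact lt_of_lt_of_le (by exact_mod_cast (by linarith : 1 < 1 + -r / d))
    (one_add_le_qCrit hd hμ hr)

theorem qCrit_lt_top (hd : 0 < d) {μ : Measure (Fin d → ℝ)} [IsProbabilityMeasure μ]
    (hμ : μ (unitCube d)ᶜ = 0) {r : ℝ} (hr : -(dimInfty μ) < (r : EReal)) : qCrit μ r < ⊤ := by
  rcases lt_or_ge 0 r with hr0 | hr0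
  · exact (qCrit_lt_one hd hμ hr0).trans (by exact_mod_cast EReal.coe_lt_top 1)
  obtain ⟨c, hc1, hc2⟩ := EReal.lt_iff_exists_real_btwn.1 (EReal.neg_lt_comm.1 hr)
  have hcr : 0 < c + r := by
    have : -r < c := by exact_mod_cast hc1
    linarith
  have h1 : 1 ≤ (1 + c) / (c + r) := by
    rw [one_le_div hcr]
    linarith
  refine (qCrit_le hd (q := (1 + c) / (c + r)) (by linarith) ?_).trans_lt (EReal.coe_lt_top _)
  refine (beta_le_sub (b := 1) hc2 one_pos h1 ?_).trans_le (EReal.coe_le_coe_iff.2 (le_of_eq ?_))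
  · rw [beta_one hμ]
    exact_mod_cast one_pos
  · field_simp
    ring

end Entropy

section Moments

variable {d : ℕ}

/-! ### Moments of the distance to a finite set, in the maximum norm -/

theorem rpow_anti {r : ℝ} (hr : r < 0) {x y : ℝ≥0∞} (h : x ≤ y) : y ^ r ≤ x ^ r := by
  have h1 : ∀ z : ℝ≥0∞, z ^ r = (z ^ (-r))⁻¹ := fun z => by rw [← ENNReal.rpow_neg, neg_neg]
  rw [h1, h1, ENNReal.inv_le_inv]
  exact ENNReal.rpow_le_rpow h (by linarith)

theorem le_infEDist {A : Finset (Fin d → ℝ)} {x : Fin d → ℝ} {t : ℝ≥0∞}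
    (h : ∀ a ∈ A, t ≤ edist x a) : t ≤ Metric.infEDist x (A : Set (Fin d → ℝ)) :=
  Metric.le_infEDist.2 fun a ha => h a (by exact_mod_cast ha)

theorem measurable_infEDist_rpow (A : Set (Fin d → ℝ)) (r : ℝ) :
    Measurable fun x : Fin d → ℝ => Metric.infEDist x A ^ r :=
  (measurable_infEDist (s := A)).pow_const r

/-- Every nonzero distance below `2 ^ (-m)` has a dyadic scale `j ≥ m`. -/
theorem exists_scale {y : ℝ≥0∞} (h0 : y ≠ 0) {m : ℕ} (h : y < 2 ^ (-(m : ℝ))) :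
    ∃ j : ℕ, m ≤ j ∧ (2 : ℝ≥0∞) ^ (-(j + 1 : ℝ)) ≤ y ∧ y < 2 ^ (-(j : ℝ)) := by
  have hex : ∃ k : ℕ, (2 : ℝ≥0∞) ^ (-(k : ℝ)) ≤ y := by
    have ht0 : Tendsto (fun n : ℕ => (2 : ℝ≥0∞) ^ (-(n : ℝ))) atTop (𝓝 0) :=
      (ENNReal.tendsto_rpow_atBot_of_one_lt_base (by norm_num)).comp
        (tendsto_neg_atTop_atBot.comp tendsto_natCast_atTop_atTop)
    exact ((ht0.eventually (gt_mem_nhds (pos_iff_ne_zero.2 h0))).exists).imp fun _ h => h.le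
  classical
  have hk := Nat.find_spec hex
  have hmk : m < Nat.find hex := by
    by_contra! hle
    have hle' : (Nat.find hex : ℝ) ≤ m := by exact_mod_cast hle
    exact absurd ((two_rpow_mono (neg_le_neg hle')).trans hk) (not_le.2 h)
  obtain ⟨j, hj⟩ : ∃ j, Nat.find hex = j + 1 := ⟨Nat.find hex - 1, by omega⟩
  have hj' := not_le.1 (Nat.find_min hex (m := j) (by omega))
  rw [hj] at hk
  exact ⟨j, by omega, by exact_mod_cast hk, hj'⟩

theorem sum_setLIntegral_le {μ : Measure (Fin d → ℝ)} {T : Finset (Set (Fin d → ℝ))}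
    (hm : ∀ Q ∈ T, MeasurableSet Q) (hT : (T : Set (Set (Fin d → ℝ))).PairwiseDisjoint id)
    (f : (Fin d → ℝ) → ℝ≥0∞) : ∑ Q ∈ T, ∫⁻ x in Q, f x ∂μ ≤ ∫⁻ x, f x ∂μ :=
  (lintegral_biUnion_finset hT hm f).symm.trans_le (setLIntegral_le_lintegral _ _)

/-- One point in each cube of a partition. -/
theorem exists_lintegral_le_of_partition (hd : 0 < d) {μ : Measure (Fin d → ℝ)}
    (hμ : μ (unitCube d)ᶜ = 0) {r : ℝ} (hr : 0 < r) {P : Finset (Set (Fin d → ℝ))}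
    (hP : IsDyadicPartition P) :
    ∃ A : Finset (Fin d → ℝ), 1 ≤ A.card ∧ A.card ≤ P.card ∧
      ∫⁻ x, Metric.infEDist x (A : Set (Fin d → ℝ)) ^ r ∂μ ≤ ∑ Q ∈ P, J μ r Q := by
  classical
  have hne : ∀ Q ∈ P, ∃ a, a ∈ Q := fun Q hQ => by
    obtain ⟨n, hn⟩ := hP.1 hQ
    exact nonempty_of_mem_dyadicCubes hn
  choose! a ha using hne
  refine ⟨P.image a, ((nonempty_of_isDyadicPartition hP).image a).card_pos, Finset.card_image_le,
    ?_⟩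
  rw [lintegral_eq_sum_dyadicCubes hμ hP]
  refine Finset.sum_le_sum fun Q hQ => ?_
  obtain ⟨n, hn⟩ := hP.1 hQ
  calc _ ≤ ∫⁻ x in Q, (2 : ℝ≥0∞) ^ (-(r * n)) ∂μ := by
        refine setLIntegral_mono' (measurableSet_of_mem_dyadicCubes hn) fun x hx => ?_
        have h1 : Metric.infEDist x (P.image a : Set (Fin d → ℝ)) ≤ 2 ^ (-(n : ℝ)) :=
          (Metric.infEDist_le_edist_of_mem (by
            exact_mod_cast Finset.mem_image_of_mem a hQ)).trans
            (edist_le_of_mem_dyadicCubes hn hx (ha Q hQ))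
        refine (ENNReal.rpow_le_rpow h1 hr.le).trans (le_of_eq ?_)
        rw [← ENNReal.rpow_mul]
        ring_nf
    _ = μ Q * 2 ^ (-(r * n)) := by rw [setLIntegral_const, mul_comm]
    _ ≤ J μ r Q := le_J hd μ r hn subset_rfl

/-- A point is near to at most `3 ^ d` cubes of a level, so that at least half of the cubes stay
away from a set of few points. -/
theorem card_mul_le_lintegral {μ : Measure (Fin d → ℝ)} {r : ℝ} (hr : 0 < r) {n : ℕ}
    {T : Finset (Set (Fin d → ℝ))} (hT : T ⊆ dyadicCubes d n) {θ : ℝ≥0∞}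
    (hθ : ∀ Q ∈ T, θ ≤ μ Q * 2 ^ (-(r * n))) {A : Finset (Fin d → ℝ)}
    (hA : 2 * 3 ^ d * A.card ≤ T.card) :
    T.card * θ ≤ 2 * ∫⁻ x, Metric.infEDist x (A : Set (Fin d → ℝ)) ^ r ∂μ := by
  classical
  set G := T \ A.biUnion (nearCubes n) with hG
  have hcard : T.card ≤ 2 * G.card := by
    have h1 : (A.biUnion (nearCubes n)).card ≤ A.card * 3 ^ d :=
      Finset.card_biUnion_le_card_mul _ _ _ fun a _ => card_nearCubes_le n a
    have h2 : T.card - (A.biUnion (nearCubes n)).card ≤ G.card := Finset.le_card_sdiff _ T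
    have h3 : 2 * 3 ^ d * A.card = 2 * (A.card * 3 ^ d) := by ring
    omega
  have hGT : G ⊆ dyadicCubes d n := Finset.sdiff_subset.trans hT
  have hint : (G.card : ℝ≥0∞) * θ ≤ ∫⁻ x, Metric.infEDist x (A : Set (Fin d → ℝ)) ^ r ∂μ := by
    refine le_trans ?_ (sum_setLIntegral_le (T := G)
      (fun Q hQ => measurableSet_of_mem_dyadicCubes (hGT hQ))
      ((pairwiseDisjoint_dyadicCubes n).subset (by exact_mod_cast hGT)) _)
    rw [← nsmul_eq_mul, ← Finset.sum_const]
    refine Finset.sum_le_sum fun Q hQ => ?_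
    obtain ⟨hQT, hQn⟩ := Finset.mem_sdiff.1 hQ
    refine (hθ Q hQT).trans ?_
    rw [mul_comm, ← setLIntegral_const]
    refine setLIntegral_mono' (measurableSet_of_mem_dyadicCubes (hT hQT)) fun x hx => ?_
    have h1 : (2 : ℝ≥0∞) ^ (-(n : ℝ)) ≤ Metric.infEDist x (A : Set (Fin d → ℝ)) := by
      refine le_infEDist fun a ha => ?_
      by_contra! hlt
      exact hQn (Finset.mem_biUnion.2 ⟨a, ha, mem_nearCubes.2 ⟨hT hQT, x, hx, hlt⟩⟩)
    refine le_trans (le_of_eq ?_) (ENNReal.rpow_le_rpow h1 hr.le)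
    rw [← ENNReal.rpow_mul]
    ring_nf
  calc (T.card : ℝ≥0∞) * θ ≤ (2 * G.card : ℕ) * θ := by gcongr
    _ = 2 * (G.card * θ) := by push_cast; ring
    _ ≤ _ := by gcongr

/-- For negative order a point is put into an almost optimal subcube of each given cube. -/
theorem exists_card_mul_le_lintegral (hd : 0 < d) {μ : Measure (Fin d → ℝ)} {r : ℝ} (hr : r < 0)
    {n : ℕ} {T : Finset (Set (Fin d → ℝ))} (hT : T ⊆ dyadicCubes d n) (hne : T.Nonempty)
    {θ : ℝ≥0∞} (hθ0 : θ ≠ 0) (hθt : θ ≠ ⊤) (hθ : ∀ Q ∈ T, θ ≤ J μ r Q) :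
    ∃ A : Finset (Fin d → ℝ), 1 ≤ A.card ∧ A.card ≤ T.card ∧
      T.card * θ ≤ 2 * ∫⁻ x, Metric.infEDist x (A : Set (Fin d → ℝ)) ^ r ∂μ := by
  classical
  have key : ∀ Q ∈ T, ∃ R : Set (Fin d → ℝ), ∃ m, ∃ a, R ∈ dyadicCubes d m ∧ R ⊆ Q ∧ a ∈ R ∧
      θ / 2 ≤ μ R * 2 ^ (-(r * m)) := by
    intro Q hQ
    obtain ⟨m, R, hR, hs, hlt⟩ :=
      exists_lt_of_lt_J hd ((ENNReal.half_lt_self hθ0 hθt).trans_le (hθ Q hQ))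
    obtain ⟨a, ha⟩ := nonempty_of_mem_dyadicCubes hR
    exact ⟨R, m, a, hR, hs, ha, hlt.le⟩
  choose! R m a hR hs ha hlt using key
  refine ⟨T.image a, (hne.image a).card_pos, Finset.card_image_le, ?_⟩
  have hsum : ∑ Q ∈ T, θ / 2 ≤
      ∫⁻ x, Metric.infEDist x (T.image a : Set (Fin d → ℝ)) ^ r ∂μ := by
    refine le_trans (Finset.sum_le_sum fun Q hQ => ?_)
      (sum_setLIntegral_le (T := T) (fun Q hQ => measurableSet_of_mem_dyadicCubes (hT hQ))
      ((pairwiseDisjoint_dyadicCubes n).subset (by exact_mod_cast hT)) _)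
    refine (hlt Q hQ).trans ?_
    refine le_trans ?_ (lintegral_mono_set (hs Q hQ))
    rw [mul_comm, ← setLIntegral_const]
    refine setLIntegral_mono' (measurableSet_of_mem_dyadicCubes (hR Q hQ)) fun x hx => ?_
    have h1 : Metric.infEDist x (T.image a : Set (Fin d → ℝ)) ≤ 2 ^ (-(m Q : ℝ)) :=
      (Metric.infEDist_le_edist_of_mem (by
        exact_mod_cast Finset.mem_image_of_mem a hQ)).trans
        (edist_le_of_mem_dyadicCubes (hR Q hQ) hx (ha Q hQ))
    refine le_trans (le_of_eq ?_) (rpow_anti hr h1)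
    rw [← ENNReal.rpow_mul]
    ring_nf
  rw [Finset.sum_const, nsmul_eq_mul] at hsum
  calc (T.card : ℝ≥0∞) * θ = 2 * (T.card * (θ / 2)) := by
        rw [mul_left_comm, ENNReal.mul_div_cancel (by simp) (by simp)]
    _ ≤ _ := by gcongr

/-- For `r < 0` the function `infEDist · A ^ r` is bounded on a cube of level `m` by the value
`2 ^ (-m r)` or, near a point `a` of `A`, by a sum over the cubes of finer levels that are near to
`a`. -/
theorem infEDist_rpow_le {r : ℝ} (hr : r < 0) {m : ℕ} {Q : Set (Fin d → ℝ)}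
    (hQ : Q ∈ dyadicCubes d m) (A : Finset (Fin d → ℝ)) {x : Fin d → ℝ} (hx : x ∈ Q)
    {F : (Fin d → ℝ) → ℕ → Finset (Set (Fin d → ℝ))}
    (hF : ∀ a j R, R ∈ nearCubes j a → R ⊆ Q → R ∈ F a j) :
    Metric.infEDist x (A : Set (Fin d → ℝ)) ^ r ≤ 2 ^ (-(r * m)) +
      ∑ a ∈ A, ∑' j : ℕ, ∑ R ∈ F a j, R.indicator (fun _ => (2 : ℝ≥0∞) ^ (-(r * (j + 1)))) x := by
  rcases le_or_gt ((2 : ℝ≥0∞) ^ (-(m : ℝ))) (Metric.infEDist x (A : Set (Fin d → ℝ))) with h | h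
  · refine ((rpow_anti hr h).trans (le_of_eq ?_)).trans le_self_add
    rw [← ENNReal.rpow_mul]
    ring_nf
  refine le_trans ?_ le_add_self
  have hA : (A : Set (Fin d → ℝ)).Nonempty := by
    by_contra hA
    rw [Set.not_nonempty_iff_eq_empty.1 hA, Metric.infEDist_empty] at h
    exact absurd h not_top_lt
  obtain ⟨a, haA, ha⟩ := A.finite_toSet.isCompact.exists_infEDist_eq_edist hA x
  rw [ha] at h ⊢
  refine le_trans ?_ (Finset.single_le_sum (f := fun a => ∑' j : ℕ, ∑ R ∈ F a j,
    R.indicator (fun _ => (2 : ℝ≥0∞) ^ (-(r * (j + 1)))) x) (fun _ _ => zero_le) haA)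
  have hterm : ∀ j : ℕ, m ≤ j → edist x a < 2 ^ (-(j : ℝ)) →
      (2 : ℝ≥0∞) ^ (-(r * (j + 1))) ≤ ∑' j : ℕ, ∑ R ∈ F a j,
        R.indicator (fun _ => (2 : ℝ≥0∞) ^ (-(r * (j + 1)))) x := by
    intro j hj hxa
    obtain ⟨R, hR, hxR⟩ := exists_mem_dyadicCubes j (subset_unitCube hQ hx)
    have hRF : R ∈ F a j := hF a j R (mem_nearCubes.2 ⟨hR, x, hxR, hxa⟩)
      (subset_of_mem hj hQ hR hx hxR)
    refine le_trans ?_ (ENNReal.le_tsum j)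
    refine le_trans ?_ (Finset.single_le_sum (fun _ _ => zero_le) hRF)
    rw [Set.indicator_of_mem hxR]
  rcases eq_or_ne (edist x a) 0 with h0 | h0
  · rw [h0, ENNReal.zero_rpow_of_neg hr, top_le_iff]
    by_contra hne
    have hr' : 0 < -r := by linarith
    obtain ⟨j, hj1, hj2⟩ := ((eventually_le_two_rpow (C := (∑' j : ℕ, ∑ R ∈ F a j,
      R.indicator (fun _ => (2 : ℝ≥0∞) ^ (-(r * (j + 1)))) x)) hne hr').and
      (eventually_ge_atTop m)).exists
    have h1 := hterm j hj2 (by rw [h0]; exact pos_iff_ne_zero.2 (two_rpow_ne_zero _))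
    have h2 : (2 : ℝ≥0∞) ^ (-r * j) < 2 ^ (-(r * (j + 1))) :=
      ENNReal.rpow_lt_rpow_of_exponent_lt (by norm_num) (by norm_num) (by linarith)
    exact absurd (h1.trans hj1) (not_le.2 h2)
  · obtain ⟨j, hmj, hk, hj'⟩ := exists_scale h0 h
    refine le_trans ?_ (hterm j hmj hj')
    refine (rpow_anti hr hk).trans (le_of_eq ?_)
    rw [← ENNReal.rpow_mul]
    ring_nf

/-- For negative order `r` the moment is controlled by the values of `J` of the smaller order
`r - ε`: the loss `ε` makes the sum over the levels near a point of `A` converge. -/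
theorem exists_lintegral_le_card_mul (hd : 0 < d) {r ε : ℝ} (hr : r < 0) (hε : 0 < ε) :
    ∃ C : ℝ≥0∞, C ≠ ⊤ ∧ ∀ μ : Measure (Fin d → ℝ), μ (unitCube d)ᶜ = 0 →
      ∀ P : Finset (Set (Fin d → ℝ)), IsDyadicPartition P →
      ∀ θ : ℝ≥0∞, (∀ Q ∈ P, J μ (r - ε) Q ≤ θ) → ∀ A : Finset (Fin d → ℝ),
        ∫⁻ x, Metric.infEDist x (A : Set (Fin d → ℝ)) ^ r ∂μ ≤ C * (P.card + A.card : ℕ) * θ := by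
  classical
  set S : ℝ≥0∞ := ∑' j : ℕ, (2 : ℝ≥0∞) ^ (-ε * j) with hS
  have hSt : S ≠ ⊤ := tsum_two_rpow_ne_top (by linarith)
  refine ⟨1 + 3 ^ d * 2 ^ (-r) * S, ENNReal.add_ne_top.2 ⟨by simp, ENNReal.mul_ne_top
    (ENNReal.mul_ne_top (by simp) (two_rpow_ne_top _)) hSt⟩, fun μ hμ P hP θ hθ A => ?_⟩
  have hlev : ∀ Q ∈ P, ∃ m, Q ∈ dyadicCubes d m := fun Q hQ => hP.1 hQ
  choose! lev hlev using hlev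
  set F : (Fin d → ℝ) → ℕ → Finset (Set (Fin d → ℝ)) := fun a j =>
    (nearCubes j a).filter fun R => ∃ Q ∈ P, R ⊆ Q with hF
  have hRm : ∀ a j, ∀ R ∈ F a j, R ∈ dyadicCubes d j := fun a j R hR =>
    (mem_nearCubes.1 (Finset.mem_filter.1 hR).1).1
  have hmeas : ∀ a j, ∀ R ∈ F a j,
      Measurable (R.indicator fun _ : Fin d → ℝ => (2 : ℝ≥0∞) ^ (-(r * (j + 1)))) :=
    fun a j R hR => measurable_const.indicator (measurableSet_of_mem_dyadicCubes (hRm a j R hR))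
  set f : (Fin d → ℝ) → ℝ≥0∞ := fun x => ∑ a ∈ A, ∑' j : ℕ, ∑ R ∈ F a j,
    R.indicator (fun _ => (2 : ℝ≥0∞) ^ (-(r * (j + 1)))) x with hf
  have hfint : ∫⁻ x, f x ∂μ ≤ A.card * (3 ^ d * 2 ^ (-r) * S * θ) := by
    rw [hf, lintegral_finsetSum _ fun a _ => Measurable.tsum fun j =>
      Finset.measurable_fun_sum _ fun R hR => hmeas a j R hR, ← nsmul_eq_mul, ← Finset.sum_const]
    refine Finset.sum_le_sum fun a _ => ?_
    rw [lintegral_tsum fun j =>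
      (Finset.measurable_fun_sum _ fun R hR => hmeas a j R hR).aemeasurable]
    calc ∑' j : ℕ, ∫⁻ x, ∑ R ∈ F a j, R.indicator (fun _ => (2 : ℝ≥0∞) ^ (-(r * (j + 1)))) x ∂μ
        ≤ ∑' j : ℕ, 3 ^ d * 2 ^ (-r) * θ * (2 : ℝ≥0∞) ^ (-ε * j) := by
          refine ENNReal.tsum_le_tsum fun j => ?_
          rw [lintegral_finsetSum _ fun R hR => hmeas a j R hR]
          have hR : ∀ R ∈ F a j, ∫⁻ x, R.indicator (fun _ => (2 : ℝ≥0∞) ^ (-(r * (j + 1)))) x ∂μ ≤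
              2 ^ (-r) * θ * (2 : ℝ≥0∞) ^ (-ε * j) := by
            intro R hR
            obtain ⟨-, Q, hQ, hRQ⟩ := Finset.mem_filter.1 hR
            rw [lintegral_indicator_const (measurableSet_of_mem_dyadicCubes (hRm a j R hR))]
            calc (2 : ℝ≥0∞) ^ (-(r * (j + 1))) * μ R
                = 2 ^ (-r) * (μ R * 2 ^ (-((r - ε) * j))) * 2 ^ (-ε * j) := by
                  have : (2 : ℝ≥0∞) ^ (-(r * (j + 1))) =
                      2 ^ (-r) * 2 ^ (-((r - ε) * j)) * 2 ^ (-ε * j) := by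
                    rw [← two_rpow_add, ← two_rpow_add]
                    ring_nf
                  rw [this]
                  ring
              _ ≤ _ := by
                  gcongr
                  exact (le_J hd μ (r - ε) (hRm a j R hR) hRQ).trans (hθ Q hQ)
          refine (Finset.sum_le_sum hR).trans ?_
          rw [Finset.sum_const, nsmul_eq_mul]
          have hc : ((F a j).card : ℝ≥0∞) ≤ 3 ^ d := by
            exact_mod_cast (Finset.card_filter_le _ _).trans (card_nearCubes_le j a)
          calc _ ≤ 3 ^ d * (2 ^ (-r) * θ * (2 : ℝ≥0∞) ^ (-ε * j)) := by gcongr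
            _ = _ := by ring
      _ = 3 ^ d * 2 ^ (-r) * S * θ := by
          rw [ENNReal.tsum_mul_left, ← hS]
          ring
  rw [lintegral_eq_sum_dyadicCubes hμ hP]
  calc ∑ Q ∈ P, ∫⁻ x in Q, Metric.infEDist x (A : Set (Fin d → ℝ)) ^ r ∂μ
      ≤ ∑ Q ∈ P, ∫⁻ x in Q, ((2 : ℝ≥0∞) ^ (-(r * lev Q)) + f x) ∂μ := by
        refine Finset.sum_le_sum fun Q hQ => ?_
        refine setLIntegral_mono' (measurableSet_of_mem_dyadicCubes (hlev Q hQ)) fun x hx => ?_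
        exact infEDist_rpow_le hr (hlev Q hQ) A hx fun a j R hR hRQ =>
          Finset.mem_filter.2 ⟨hR, Q, hQ, hRQ⟩
    _ = ∑ Q ∈ P, μ Q * (2 : ℝ≥0∞) ^ (-(r * lev Q)) + ∫⁻ x, f x ∂μ := by
        rw [lintegral_eq_sum_dyadicCubes hμ hP f, ← Finset.sum_add_distrib]
        refine Finset.sum_congr rfl fun Q _ => ?_
        rw [lintegral_add_left measurable_const, setLIntegral_const, mul_comm]
    _ ≤ P.card * θ + A.card * (3 ^ d * 2 ^ (-r) * S * θ) := by
        refine add_le_add ?_ hfint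
        rw [← nsmul_eq_mul, ← Finset.sum_const]
        refine Finset.sum_le_sum fun Q hQ => le_trans ?_ (hθ Q hQ)
        refine le_trans ?_ (le_J hd μ (r - ε) (hlev Q hQ) subset_rfl)
        gcongr
        · norm_num
        · linarith
    _ ≤ (1 + 3 ^ d * 2 ^ (-r) * S) * P.card * θ + (1 + 3 ^ d * 2 ^ (-r) * S) * A.card * θ := by
        refine add_le_add ?_ ?_
        · rw [add_mul, one_mul, add_mul]
          exact le_self_add
        · rw [add_mul, one_mul, add_mul]
          refine le_trans (le_of_eq ?_) le_add_self
          ring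
    _ = _ := by push_cast; ring

end Moments

section Transfer

variable {d : ℕ}

/-! ### Quantization errors in terms of the image measure on the unit cube -/

theorem exists_norm_bounds (N : Seminorm ℝ (Fin d → ℝ)) (hN : ∀ x, N x = 0 → x = 0) :
    Continuous N ∧ ∃ c C : ℝ, 0 < c ∧ 0 < C ∧ ∀ x, c * ‖x‖ ≤ N x ∧ N x ≤ C * ‖x‖ := by
  have hcont : Continuous N := continuousOn_univ.1 (ConvexOn.continuousOn isOpen_univ N.convexOn)
  obtain ⟨C, hC, hC'⟩ := Seminorm.bound_of_continuous_normedSpace N hcont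
  refine ⟨hcont, ?_⟩
  rcases (Metric.sphere (0 : Fin d → ℝ) 1).eq_empty_or_nonempty with he | hne
  · have h0 : ∀ x : Fin d → ℝ, x = 0 := fun x => by
      by_contra hx
      have : ‖x‖⁻¹ • x ∈ Metric.sphere (0 : Fin d → ℝ) 1 := by
        simp [norm_smul, norm_ne_zero_iff.2 hx]
      rw [he] at this
      exact this
    exact ⟨1, C, one_pos, hC, fun x => by simp [h0 x]⟩
  obtain ⟨y, hy, hmin⟩ := (isCompact_sphere (0 : Fin d → ℝ) 1).exists_isMinOn hne
    hcont.continuousOn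
  have hy1 : ‖y‖ = 1 := by simpa using hy
  have hNy : 0 < N y := lt_of_le_of_ne (apply_nonneg N y) fun h => by
    rw [hN y h.symm] at hy1
    simp at hy1
  refine ⟨N y, C, hNy, hC, fun x => ⟨?_, hC' x⟩⟩
  rcases eq_or_ne x 0 with rfl | hx
  · simp
  have hx' : 0 < ‖x‖ := norm_pos_iff.2 hx
  have h1 : N y ≤ N (‖x‖⁻¹ • x) := hmin (by simp [norm_smul, hx'.ne'])
  rw [map_smul_eq_mul, norm_inv, norm_norm, ← div_eq_inv_mul, le_div_iff₀ hx'] at h1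
  exact h1

theorem measurable_distTo {N : Seminorm ℝ (Fin d → ℝ)} (hN : Continuous N)
    (A : Finset (Fin d → ℝ)) : Measurable (distTo N A) := by
  refine Measurable.biInf (A : Set (Fin d → ℝ)) A.countable_toSet fun y _ => ?_
  exact ENNReal.measurable_ofReal.comp (hN.comp (continuous_id.sub continuous_const)).measurable

/-- The error of order `r` of the approximation by `A`, for the maximum norm. -/
noncomputable def supError (μ : Measure (Fin d → ℝ)) (r : ℝ) (A : Finset (Fin d → ℝ)) : ℝ≥0∞ :=
  (∫⁻ x, Metric.infEDist x (A : Set (Fin d → ℝ)) ^ r ∂μ) ^ (1 / r)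

theorem const_mul_rpow {k : ℝ≥0∞} (hk0 : k ≠ 0) (hkt : k ≠ ⊤) (x : ℝ≥0∞) (r : ℝ) :
    (k * x) ^ r = k ^ r * x ^ r := by
  rw [ENNReal.mul_rpow_eq_ite, if_neg]
  rintro ⟨h | h, -⟩
  · exact hk0 h.1
  · exact hkt h.1

theorem rpow_ne_zero_of {k : ℝ≥0∞} (hk0 : k ≠ 0) (hkt : k ≠ ⊤) (r : ℝ) : k ^ r ≠ 0 := by
  simp [ENNReal.rpow_eq_zero_iff, hk0, hkt]

theorem rpow_ne_top_of {k : ℝ≥0∞} (hk0 : k ≠ 0) (hkt : k ≠ ⊤) (r : ℝ) : k ^ r ≠ ⊤ := by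
  simp [ENNReal.rpow_eq_top_iff, hk0, hkt]

theorem lintegral_rpow_mono {X : Type*} [MeasurableSpace X] {ν : Measure X} {r : ℝ}
    {f g : X → ℝ≥0∞} (h : ∀ x, f x ≤ g x) :
    (∫⁻ x, f x ^ r ∂ν) ^ (1 / r) ≤ (∫⁻ x, g x ^ r ∂ν) ^ (1 / r) := by
  rcases lt_trichotomy r 0 with hr | rfl | hr
  · exact rpow_anti (one_div_neg.2 hr) (lintegral_mono fun x => rpow_anti hr (h x))
  · simp
  · exact ENNReal.rpow_le_rpow (lintegral_mono fun x => ENNReal.rpow_le_rpow (h x) hr.le)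
      (one_div_pos.2 hr).le

theorem lintegral_const_mul_rpow {X : Type*} [MeasurableSpace X] {ν : Measure X} {r : ℝ}
    (hr : r ≠ 0) {k : ℝ≥0∞} (hk0 : k ≠ 0) (hkt : k ≠ ⊤) (f : X → ℝ≥0∞) :
    (∫⁻ x, (k * f x) ^ r ∂ν) ^ (1 / r) = k * (∫⁻ x, f x ^ r ∂ν) ^ (1 / r) := by
  simp_rw [const_mul_rpow hk0 hkt]
  rw [lintegral_const_mul' _ _ (rpow_ne_top_of hk0 hkt r),
    const_mul_rpow (rpow_ne_zero_of hk0 hkt r) (rpow_ne_top_of hk0 hkt r), ← ENNReal.rpow_mul,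
    mul_one_div_cancel hr, ENNReal.rpow_one]

/-- The quantization error of `ν` for the norm `N` is comparable to the error of the image measure
on the unit cube for the maximum norm. -/
theorem exists_quantError_bounds (N : Seminorm ℝ (Fin d → ℝ)) (hN : ∀ x, N x = 0 → x = 0)
    (ν : Measure (Fin d → ℝ)) {s : ℝ} (hs : 0 < s) (b : Fin d → ℝ) :
    ∃ k K : ℝ≥0∞, k ≠ 0 ∧ K ≠ ⊤ ∧ ∀ r : ℝ, r ≠ 0 → ∀ n : ℕ,
      (∀ A : Finset (Fin d → ℝ), 1 ≤ A.card → A.card ≤ n →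
        quantError N ν n r ≤ K * supError (rescale ν s b) r A) ∧
      (∀ e : ℝ≥0∞, (∀ A : Finset (Fin d → ℝ), 1 ≤ A.card → A.card ≤ n →
        e ≤ supError (rescale ν s b) r A) → k * e ≤ quantError N ν n r) := by
  classical
  obtain ⟨-, c, C, hc, hC, hcC⟩ := exists_norm_bounds N hN
  set T : (Fin d → ℝ) → (Fin d → ℝ) := fun x => s • x + b with hT
  have hTm : Measurable T := by fun_prop
  have hTinj : Function.Injective T := fun x y h => by
    have : s • x = s • y := add_right_cancel h
    exact smul_right_injective _ hs.ne' this
  have hTsurj : Function.Surjective T := fun y => ⟨s⁻¹ • (y - b), by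
    simp only [hT, smul_inv_smul₀ hs.ne', sub_add_cancel]⟩
  have hTnorm : ∀ x y, ‖x - y‖ = s⁻¹ * dist (T x) (T y) := fun x y => by
    rw [dist_eq_norm]
    simp only [hT, add_sub_add_right_eq_sub, ← smul_sub, norm_smul, Real.norm_of_nonneg hs.le]
    rw [inv_mul_cancel_left₀ hs.ne']
  set k := ENNReal.ofReal (c * s⁻¹) with hk
  set K := ENNReal.ofReal (C * s⁻¹) with hK
  have hk0 : k ≠ 0 := by rw [hk, Ne, ENNReal.ofReal_eq_zero, not_le]; positivity
  have hK0 : K ≠ 0 := by rw [hK, Ne, ENNReal.ofReal_eq_zero, not_le]; positivity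
  have hlow : ∀ (A : Finset (Fin d → ℝ)) x,
      k * Metric.infEDist (T x) (A.image T : Set (Fin d → ℝ)) ≤ distTo N A x := fun A x => by
    refine le_iInf₂ fun y hy => ?_
    calc k * Metric.infEDist (T x) (A.image T : Set (Fin d → ℝ)) ≤ k * edist (T x) (T y) := by
          gcongr
          exact Metric.infEDist_le_edist_of_mem (by exact_mod_cast Finset.mem_image_of_mem T hy)
      _ = ENNReal.ofReal (c * ‖x - y‖) := by
          rw [hk, edist_dist, ← ENNReal.ofReal_mul (by positivity), hTnorm]
          ring_nf
      _ ≤ _ := ENNReal.ofReal_le_ofReal (hcC _).1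
  have hup : ∀ (A : Finset (Fin d → ℝ)) x,
      distTo N A x ≤ K * Metric.infEDist (T x) (A.image T : Set (Fin d → ℝ)) := fun A x => by
    have : K⁻¹ * distTo N A x ≤ Metric.infEDist (T x) (A.image T : Set (Fin d → ℝ)) := by
      refine le_infEDist fun a ha => ?_
      obtain ⟨y, hy, rfl⟩ := Finset.mem_image.1 ha
      rw [ENNReal.inv_mul_le_iff hK0 ENNReal.ofReal_ne_top]
      calc distTo N A x ≤ ENNReal.ofReal (N (x - y)) :=
            iInf₂_le_of_le (f := fun y (_ : y ∈ A) => ENNReal.ofReal (N (x - y))) y hy le_rfl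
        _ ≤ ENNReal.ofReal (C * ‖x - y‖) := ENNReal.ofReal_le_ofReal (hcC _).2
        _ = _ := by
          rw [hK, edist_dist, ← ENNReal.ofReal_mul (by positivity), hTnorm]
          ring_nf
    rwa [ENNReal.inv_mul_le_iff hK0 ENNReal.ofReal_ne_top] at this
  have hmap : ∀ (r : ℝ) (A : Finset (Fin d → ℝ)), supError (rescale ν s b) r A =
      (∫⁻ x, Metric.infEDist (T x) (A : Set (Fin d → ℝ)) ^ r ∂ν) ^ (1 / r) := fun r A => by
    rw [supError, rescale, lintegral_map (measurable_infEDist_rpow _ r) hTm]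
  refine ⟨k, K, hk0, ENNReal.ofReal_ne_top, fun r hr n => ⟨fun A hA1 hAn => ?_, fun e he => ?_⟩⟩
  · obtain ⟨B, rfl⟩ : ∃ B : Finset (Fin d → ℝ), B.image T = A := by
      refine ⟨A.image (Function.surjInv hTsurj), ?_⟩
      rw [Finset.image_image]
      have : T ∘ Function.surjInv hTsurj = id := funext fun y => Function.surjInv_eq hTsurj y
      rw [this, Finset.image_id]
    rw [Finset.card_image_of_injective _ hTinj] at hA1 hAn
    refine (iInf₂_le_of_le (f := fun (A : Finset (Fin d → ℝ)) (_ : 1 ≤ A.card ∧ A.card ≤ n) =>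
      errorOf N ν r A) B ⟨hA1, hAn⟩ le_rfl).trans ?_
    rw [errorOf, if_neg hr, hmap, ← lintegral_const_mul_rpow hr hK0 ENNReal.ofReal_ne_top]
    exact lintegral_rpow_mono (hup B)
  · refine le_iInf₂ fun A hA => ?_
    rw [errorOf, if_neg hr]
    have h1 : (A.image T).card = A.card := Finset.card_image_of_injective _ hTinj
    refine (mul_le_mul_right (he (A.image T) (h1 ▸ hA.1) (h1 ▸ hA.2)) k).trans ?_
    rw [hmap, ← lintegral_const_mul_rpow hr hk0 ENNReal.ofReal_ne_top]
    exact lintegral_rpow_mono (hlow A)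

section Bounds

variable {N : Seminorm ℝ (Fin d → ℝ)} {ν : Measure (Fin d → ℝ)} {s : ℝ} {b : Fin d → ℝ}

theorem quantError_le_of_partition (hd : 0 < d) (hN : ∀ x, N x = 0 → x = 0) (hs : 0 < s)
    (hcube : rescale ν s b (unitCube d)ᶜ = 0) {r : ℝ} (hr : 0 < r) :
    ∃ K : ℝ≥0∞, K ≠ ⊤ ∧ ∀ (P : Finset (Set (Fin d → ℝ))) (θ : ℝ≥0∞) (n : ℕ),
      IsDyadicPartition P → (∀ Q ∈ P, J (rescale ν s b) r Q ≤ θ) → P.card ≤ n →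
      quantError N ν n r ≤ K * (P.card * θ) ^ (1 / r) := by
  obtain ⟨_, K, -, hK, h⟩ := exists_quantError_bounds N hN ν hs b
  refine ⟨K, hK, fun P θ n hP hθ hn => ?_⟩
  obtain ⟨A, hA1, hA2, hA⟩ := exists_lintegral_le_of_partition hd hcube hr hP
  refine ((h r hr.ne' n).1 A hA1 (hA2.trans hn)).trans ?_
  gcongr
  refine ENNReal.rpow_le_rpow (hA.trans ?_) (one_div_pos.2 hr).le
  rw [← nsmul_eq_mul, ← Finset.sum_const]
  exact Finset.sum_le_sum hθ

theorem le_quantError_of_card (hd : 0 < d) (hN : ∀ x, N x = 0 → x = 0) (hs : 0 < s)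
    {r : ℝ} (hr : 0 < r) :
    ∃ k : ℝ≥0∞, k ≠ 0 ∧ ∀ (m : ℕ) (T : Finset (Set (Fin d → ℝ))) (θ : ℝ≥0∞) (n : ℕ),
      T ⊆ dyadicCubes d m → (∀ Q ∈ T, θ ≤ J (rescale ν s b) r Q) → 2 * 3 ^ d * n ≤ T.card →
      k * (T.card * θ) ^ (1 / r) ≤ quantError N ν n r := by
  obtain ⟨k, _, hk, -, h⟩ := exists_quantError_bounds N hN ν hs b
  refine ⟨k * (2 ^ (1 / r))⁻¹, mul_ne_zero hk (ENNReal.inv_ne_zero.2 (two_rpow_ne_top _)),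
    fun m T θ n hT hθ hn => ?_⟩
  rw [mul_assoc]
  refine (h r hr.ne' n).2 _ fun A _ hAn => ?_
  have h1 := card_mul_le_lintegral (μ := rescale ν s b) hr hT (θ := θ) (A := A)
    (fun Q hQ => by rw [← J_eq_of_nonneg hd _ hr.le (hT hQ)]; exact hθ Q hQ)
    ((Nat.mul_le_mul_left _ hAn).trans hn)
  rw [ENNReal.inv_mul_le_iff (two_rpow_ne_zero _) (two_rpow_ne_top _), supError,
    ← const_mul_rpow (by simp) (by simp)]
  exact ENNReal.rpow_le_rpow h1 (one_div_pos.2 hr).le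

theorem le_quantError_of_partition (hd : 0 < d) (hN : ∀ x, N x = 0 → x = 0) (hs : 0 < s)
    (hcube : rescale ν s b (unitCube d)ᶜ = 0) {r ε : ℝ} (hr : r < 0) (hε : 0 < ε) :
    ∃ k : ℝ≥0∞, k ≠ 0 ∧ ∀ (P : Finset (Set (Fin d → ℝ))) (θ : ℝ≥0∞) (n : ℕ),
      IsDyadicPartition P → (∀ Q ∈ P, J (rescale ν s b) (r - ε) Q ≤ θ) → P.card ≤ n →
      k * (n * θ) ^ (1 / r) ≤ quantError N ν n r := by
  obtain ⟨k, _, hk, -, h⟩ := exists_quantError_bounds N hN ν hs b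
  obtain ⟨C, hC, hint⟩ := exists_lintegral_le_card_mul hd hr hε
  have hC0 : 2 * (C + 1) ≠ 0 := by simp
  have hCt : 2 * (C + 1) ≠ ⊤ := ENNReal.mul_ne_top (by simp) (ENNReal.add_ne_top.2 ⟨hC, by simp⟩)
  refine ⟨k * (2 * (C + 1)) ^ (1 / r), mul_ne_zero hk (rpow_ne_zero_of hC0 hCt _),
    fun P θ n hP hθ hn => ?_⟩
  rw [mul_assoc, ← const_mul_rpow hC0 hCt]
  refine (h r hr.ne n).2 _ fun A _ hAn => ?_
  refine rpow_anti (one_div_neg.2 hr) ?_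
  calc _ ≤ C * (P.card + A.card : ℕ) * θ := hint _ hcube P hP θ hθ A
    _ ≤ (C + 1) * (2 * n : ℕ) * θ := by
        gcongr
        · exact le_self_add
        · omega
    _ = _ := by push_cast; ring

theorem quantError_le_of_card (hd : 0 < d) (hN : ∀ x, N x = 0 → x = 0) (hs : 0 < s)
    {r : ℝ} (hr : r < 0) :
    ∃ K : ℝ≥0∞, K ≠ ⊤ ∧ ∀ (m : ℕ) (T : Finset (Set (Fin d → ℝ))) (θ : ℝ≥0∞) (n : ℕ),
      T ⊆ dyadicCubes d m → T.Nonempty → θ ≠ 0 → θ ≠ ⊤ →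
      (∀ Q ∈ T, θ ≤ J (rescale ν s b) r Q) → T.card ≤ n →
      quantError N ν n r ≤ K * (T.card * θ) ^ (1 / r) := by
  obtain ⟨_, K, -, hK, h⟩ := exists_quantError_bounds N hN ν hs b
  refine ⟨K * (2 ^ (1 / r))⁻¹, ENNReal.mul_ne_top hK (ENNReal.inv_ne_top.2 (two_rpow_ne_zero _)),
    fun m T θ n hT hne hθ0 hθt hθ hn => ?_⟩
  obtain ⟨A, hA1, hA2, hA⟩ :=
    exists_card_mul_le_lintegral (μ := rescale ν s b) hd hr hT hne hθ0 hθt hθ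
  refine ((h r hr.ne n).1 A hA1 (hA2.trans hn)).trans ?_
  rw [mul_assoc]
  gcongr
  rw [← ENNReal.mul_le_iff_le_inv (two_rpow_ne_zero _) (two_rpow_ne_top _), supError,
    ← const_mul_rpow (by simp) (by simp)]
  exact rpow_anti (one_div_neg.2 hr) hA

end Bounds

end Transfer

section Order

variable {d : ℕ}

/-! ### Monotonicity of the error in the order -/

theorem toENNReal_log_le {r : ℝ} (hr : 0 < r) (y : ℝ≥0∞) :
    (ENNReal.log y).toENNReal ≤ ENNReal.ofReal r⁻¹ * y ^ r := by
  rcases eq_or_ne y 0 with rfl | h0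
  · simp
  rcases eq_or_ne y ⊤ with rfl | ht
  · rw [ENNReal.top_rpow_of_pos hr, ENNReal.mul_top (by simpa using hr)]
    exact le_top
  have hy : 0 < y.toReal := ENNReal.toReal_pos h0 ht
  rw [ENNReal.log_pos_real h0 ht, EReal.toENNReal_of_ne_top (EReal.coe_ne_top _), EReal.toReal_coe]
  conv_rhs => rw [← ENNReal.ofReal_toReal ht, ENNReal.ofReal_rpow_of_pos hy,
    ← ENNReal.ofReal_mul (by positivity)]
  refine ENNReal.ofReal_le_ofReal ((Real.log_le_rpow_div hy.le hr).trans (le_of_eq ?_))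
  rw [div_eq_inv_mul]

theorem toENNReal_neg_log_le {r : ℝ} (hr : r < 0) (y : ℝ≥0∞) :
    (-ENNReal.log y).toENNReal ≤ ENNReal.ofReal (-r)⁻¹ * y ^ r := by
  have := toENNReal_log_le (r := -r) (by linarith) y⁻¹
  rwa [ENNReal.log_inv, ENNReal.inv_rpow, ← ENNReal.rpow_neg, neg_neg] at this

/-- Jensen's inequality for the exponential function. -/
theorem exp_eintegral_log {X : Type*} [MeasurableSpace X] {ν : Measure X} [IsProbabilityMeasure ν]
    {f : X → ℝ≥0∞} (hf : Measurable f) (hft : ∀ x, f x ≠ ⊤)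
    (hpos : ∫⁻ x, (ENNReal.log (f x)).toENNReal ∂ν ≠ ⊤)
    (hneg : ∫⁻ x, (-ENNReal.log (f x)).toENNReal ∂ν ≠ ⊤) :
    ∃ c : ℝ, EReal.exp (eintegral ν fun x => ENNReal.log (f x)) = ENNReal.ofReal (Real.exp c) ∧
      ∀ r : ℝ, ENNReal.ofReal (Real.exp (r * c)) ≤ ∫⁻ x, f x ^ r ∂ν := by
  have hlog : Measurable fun x => ENNReal.log (f x) := hf.ennreal_log
  have h0 : ∀ᵐ x ∂ν, f x ≠ 0 := by
    have hm : Measurable fun x => (-ENNReal.log (f x)).toENNReal := hlog.neg.ereal_toENNReal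
    filter_upwards [ae_lt_top hm hneg] with x hx hx0
    rw [hx0] at hx
    simp at hx
  set g : X → ℝ := fun x => Real.log (f x).toReal with hg
  have hgm : Measurable g := Real.measurable_log.comp hf.ennreal_toReal
  have hcoe : ∀ᵐ x ∂ν, ENNReal.log (f x) = (g x : EReal) :=
    h0.mono fun x hx => ENNReal.log_pos_real hx (hft x)
  have e1 : ∫⁻ x, (ENNReal.log (f x)).toENNReal ∂ν = ∫⁻ x, ENNReal.ofReal (g x) ∂ν :=
    lintegral_congr_ae (hcoe.mono fun x hx => by
      simp only [hx]
      rw [EReal.toENNReal_of_ne_top (EReal.coe_ne_top _), EReal.toReal_coe])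
  have e2 : ∫⁻ x, (-ENNReal.log (f x)).toENNReal ∂ν = ∫⁻ x, ENNReal.ofReal (-g x) ∂ν :=
    lintegral_congr_ae (hcoe.mono fun x hx => by
      simp only [hx]
      rw [← EReal.coe_neg, EReal.toENNReal_of_ne_top (EReal.coe_ne_top _), EReal.toReal_coe])
  rw [e1] at hpos
  rw [e2] at hneg
  have hgi : Integrable g ν := by
    refine ⟨hgm.aestronglyMeasurable, ?_⟩
    rw [hasFiniteIntegral_iff_norm]
    have : ∀ x, ENNReal.ofReal ‖g x‖ ≤ ENNReal.ofReal (g x) + ENNReal.ofReal (-g x) := fun x => by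
      rcases abs_choice (g x) with h | h
      · rw [Real.norm_eq_abs, h]; exact le_self_add
      · rw [Real.norm_eq_abs, h]; exact le_add_self
    refine (lintegral_mono this).trans_lt ?_
    rw [lintegral_add_left hgm.ennreal_ofReal]
    exact ENNReal.add_lt_top.2 ⟨lt_top_iff_ne_top.2 hpos, lt_top_iff_ne_top.2 hneg⟩
  refine ⟨∫ x, g x ∂ν, ?_, fun r => ?_⟩
  · have : eintegral ν (fun x => ENNReal.log (f x)) = ((∫ x, g x ∂ν : ℝ) : EReal) := by
      rw [eintegral, e1, e2, integral_eq_lintegral_pos_part_sub_lintegral_neg_part hgi,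
        EReal.coe_sub, ← EReal.coe_ennreal_toReal hpos, ← EReal.coe_ennreal_toReal hneg]
    rw [this, EReal.exp_coe]
  · rcases eq_or_ne (∫⁻ x, f x ^ r ∂ν) ⊤ with h | h
    · rw [h]; exact le_top
    have hexp : ∀ᵐ x ∂ν, f x ^ r = ENNReal.ofReal (Real.exp (r * g x)) := h0.mono fun x hx => by
      have hy : 0 < (f x).toReal := ENNReal.toReal_pos hx (hft x)
      conv_lhs => rw [← ENNReal.ofReal_toReal (hft x), ENNReal.ofReal_rpow_of_pos hy]
      rw [Real.rpow_def_of_pos hy, mul_comm]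
    rw [lintegral_congr_ae hexp] at h ⊢
    have hem : Measurable fun x => Real.exp (r * g x) := by fun_prop
    have hei : Integrable (fun x => Real.exp (r * g x)) ν := by
      refine ⟨hem.aestronglyMeasurable, ?_⟩
      rw [hasFiniteIntegral_iff_ofReal (Eventually.of_forall fun x => (Real.exp_pos _).le)]
      exact lt_top_iff_ne_top.2 h
    rw [← ofReal_integral_eq_lintegral_ofReal hei
      (Eventually.of_forall fun x => (Real.exp_pos _).le)]
    refine ENNReal.ofReal_le_ofReal ?_
    rw [← integral_const_mul]
    exact convexOn_exp.map_integral_le Real.continuous_exp.continuousOn isClosed_univ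
      (Eventually.of_forall fun _ => Set.mem_univ _) (hgi.const_mul r) hei

theorem distTo_ne_top {N : Seminorm ℝ (Fin d → ℝ)} {A : Finset (Fin d → ℝ)} (hA : 1 ≤ A.card)
    (x : Fin d → ℝ) : distTo N A x ≠ ⊤ := by
  obtain ⟨y, hy⟩ := Finset.card_pos.1 hA
  exact ne_top_of_le_ne_top ENNReal.ofReal_ne_top
    (iInf₂_le_of_le (f := fun y (_ : y ∈ A) => ENNReal.ofReal (N (x - y))) y hy le_rfl)

theorem ofReal_exp_rpow {r : ℝ} (hr : r ≠ 0) (c : ℝ) :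
    ENNReal.ofReal (Real.exp (r * c)) ^ (1 / r) = ENNReal.ofReal (Real.exp c) := by
  rw [ENNReal.ofReal_rpow_of_pos (Real.exp_pos _), ← Real.exp_mul]
  congr 2
  field_simp

theorem errorOf_zero_le {N : Seminorm ℝ (Fin d → ℝ)} (hN : Continuous N)
    {ν : Measure (Fin d → ℝ)} [IsProbabilityMeasure ν] {A : Finset (Fin d → ℝ)} (hA : 1 ≤ A.card)
    {r : ℝ} (hr : 0 < r) : errorOf N ν 0 A ≤ errorOf N ν r A := by
  rw [errorOf, errorOf, if_pos rfl, if_neg hr.ne']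
  have hf := measurable_distTo hN A
  rcases eq_or_ne (∫⁻ x, distTo N A x ^ r ∂ν) ⊤ with h | h
  · rw [h, ENNReal.top_rpow_of_pos (one_div_pos.2 hr)]
    exact le_top
  have hpos : ∫⁻ x, (ENNReal.log (distTo N A x)).toENNReal ∂ν ≠ ⊤ := by
    refine ne_top_of_le_ne_top ?_ (lintegral_mono fun x => toENNReal_log_le hr _)
    rw [lintegral_const_mul _ (hf.pow_const r)]
    exact ENNReal.mul_ne_top ENNReal.ofReal_ne_top h
  rcases eq_or_ne (∫⁻ x, (-ENNReal.log (distTo N A x)).toENNReal ∂ν) ⊤ with hneg | hneg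
  · rw [eintegral, hneg, EReal.coe_ennreal_top, ← EReal.coe_ennreal_toReal hpos]
    simp
  · obtain ⟨c, hc, hJ⟩ := exp_eintegral_log hf (distTo_ne_top hA) hpos hneg
    rw [hc, ← ofReal_exp_rpow hr.ne']
    exact ENNReal.rpow_le_rpow (hJ r) (one_div_pos.2 hr).le

theorem errorOf_le_zero {N : Seminorm ℝ (Fin d → ℝ)} (hN : Continuous N)
    {ν : Measure (Fin d → ℝ)} [IsProbabilityMeasure ν] {A : Finset (Fin d → ℝ)} (hA : 1 ≤ A.card)
    {r : ℝ} (hr : r < 0) : errorOf N ν r A ≤ errorOf N ν 0 A := by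
  rw [errorOf, errorOf, if_pos rfl, if_neg hr.ne]
  have hf := measurable_distTo hN A
  rcases eq_or_ne (∫⁻ x, distTo N A x ^ r ∂ν) ⊤ with h | h
  · rw [h, ENNReal.top_rpow_of_neg (one_div_neg.2 hr)]
    exact zero_le
  have hneg : ∫⁻ x, (-ENNReal.log (distTo N A x)).toENNReal ∂ν ≠ ⊤ := by
    refine ne_top_of_le_ne_top ?_ (lintegral_mono fun x => toENNReal_neg_log_le hr _)
    rw [lintegral_const_mul _ (hf.pow_const r)]
    exact ENNReal.mul_ne_top ENNReal.ofReal_ne_top h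
  rcases eq_or_ne (∫⁻ x, (ENNReal.log (distTo N A x)).toENNReal ∂ν) ⊤ with hpos | hpos
  · rw [eintegral, hpos, EReal.coe_ennreal_top, ← EReal.coe_ennreal_toReal hneg]
    simp
  · obtain ⟨c, hc, hJ⟩ := exp_eintegral_log hf (distTo_ne_top hA) hpos hneg
    rw [hc, ← ofReal_exp_rpow hr.ne]
    exact rpow_anti (one_div_neg.2 hr) (hJ r)

theorem quantError_zero_le {N : Seminorm ℝ (Fin d → ℝ)} (hN : Continuous N)
    {ν : Measure (Fin d → ℝ)} [IsProbabilityMeasure ν] {r : ℝ} (hr : 0 < r) (n : ℕ) :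
    quantError N ν n 0 ≤ quantError N ν n r :=
  iInf₂_mono fun _ hA => errorOf_zero_le hN hA.1 hr

theorem quantError_le_zero {N : Seminorm ℝ (Fin d → ℝ)} (hN : Continuous N)
    {ν : Measure (Fin d → ℝ)} [IsProbabilityMeasure ν] {r : ℝ} (hr : r < 0) (n : ℕ) :
    quantError N ν n r ≤ quantError N ν n 0 :=
  iInf₂_mono fun _ hA => errorOf_le_zero hN hA.1 hr

theorem quantRatio_mono {N : Seminorm ℝ (Fin d → ℝ)} {ν : Measure (Fin d → ℝ)} {r r' : ℝ} {n : ℕ}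
    (h : quantError N ν n r ≤ quantError N ν n r') (h1 : quantError N ν n r' < 1) :
    quantRatio N ν r n ≤ quantRatio N ν r' n := by
  have ht : quantError N ν n r' ≠ ⊤ := ne_top_of_lt h1
  have hle := ENNReal.toReal_mono ht h
  have h1' : (quantError N ν n r').toReal < 1 := by
    rw [← ENNReal.toReal_one]
    exact (ENNReal.toReal_lt_toReal ht (by simp)).2 h1
  have hn : 0 ≤ Real.log n := Real.log_natCast_nonneg n
  unfold quantRatio
  rcases (ENNReal.toReal_nonneg (a := quantError N ν n r)).eq_or_lt with h0 | h0
  · rw [← h0, Real.log_zero, neg_zero, div_zero]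
    refine div_nonneg hn (neg_nonneg.2 (Real.log_nonpos ENNReal.toReal_nonneg h1'.le))
  · refine div_le_div_of_nonneg_left hn ?_ (neg_le_neg (Real.log_le_log h0 hle))
    exact neg_pos.2 (Real.log_neg (h0.trans_le hle) h1')

/-! ### Dimensions from power bounds on the error -/

theorem quantRatio_nonneg {N : Seminorm ℝ (Fin d → ℝ)} {ν : Measure (Fin d → ℝ)} {r : ℝ} {n : ℕ}
    (h1 : quantError N ν n r ≤ 1) : 0 ≤ quantRatio N ν r n :=
  div_nonneg (Real.log_natCast_nonneg n) (neg_nonneg.2 (Real.log_nonpos ENNReal.toReal_nonneg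
    (ENNReal.toReal_le_of_le_ofReal zero_le_one (by simpa using h1))))

theorem natCast_rpow_eq_ofReal {n : ℕ} (hn : 0 < n) (x : ℝ) :
    (n : ℝ≥0∞) ^ x = ENNReal.ofReal ((n : ℝ) ^ x) := by
  rw [← ENNReal.ofReal_rpow_of_pos (by exact_mod_cast hn), ENNReal.ofReal_natCast]

theorem eventually_quantRatio_le (N : Seminorm ℝ (Fin d → ℝ)) (ν : Measure (Fin d → ℝ)) (r : ℝ)
    {κ u : ℝ} (hκ : 0 < κ) (hu : 1 / κ < u) {K : ℝ≥0∞} (hK : K ≠ ⊤) :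
    ∀ᶠ n : ℕ in atTop, quantError N ν n r ≤ K * (n : ℝ≥0∞) ^ (-κ) → quantRatio N ν r n ≤ u := by
  have hu0 : 0 < u := (one_div_pos.2 hκ).trans hu
  have huκ : 1 < u * κ := by rwa [div_lt_iff₀ hκ] at hu
  set L := Real.log (K.toReal + 1)
  have hlog : Tendsto (fun n : ℕ => Real.log n) atTop atTop :=
    Real.tendsto_log_atTop.comp tendsto_natCast_atTop_atTop
  filter_upwards [hlog.eventually_ge_atTop (u * L / (u * κ - 1)), hlog.eventually_gt_atTop 0,
    eventually_gt_atTop 0] with n hn hn1 hn0 he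
  have hn0' : (0 : ℝ) < n := by exact_mod_cast hn0
  rw [div_le_iff₀ (by linarith)] at hn
  unfold quantRatio
  rcases (ENNReal.toReal_nonneg (a := quantError N ν n r)).eq_or_lt with h0 | h0
  · rw [← h0, Real.log_zero, neg_zero, div_zero]
    exact hu0.le
  have hle : (quantError N ν n r).toReal ≤ (K.toReal + 1) * (n : ℝ) ^ (-κ) := by
    refine ENNReal.toReal_le_of_le_ofReal (by positivity) (he.trans ?_)
    rw [natCast_rpow_eq_ofReal hn0, ENNReal.ofReal_mul (by positivity)]
    gcongr
    rw [← ENNReal.ofReal_toReal hK]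
    exact ENNReal.ofReal_le_ofReal (by rw [ENNReal.toReal_ofReal ENNReal.toReal_nonneg]; linarith)
  have h2 := Real.log_le_log h0 hle
  rw [Real.log_mul (by positivity) (by positivity), Real.log_rpow hn0'] at h2
  have h3 : Real.log n ≤ u * (-Real.log (quantError N ν n r).toReal) := by
    have : u * (κ * Real.log n - L) ≤ u * (-Real.log (quantError N ν n r).toReal) :=
      mul_le_mul_of_nonneg_left (by linarith) hu0.le
    nlinarith
  have h4 : 0 < -Real.log (quantError N ν n r).toReal := by
    by_contra! hcon
    nlinarith
  rwa [div_le_iff₀ h4]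

theorem eventually_le_quantRatio (N : Seminorm ℝ (Fin d → ℝ)) (ν : Measure (Fin d → ℝ)) (r : ℝ)
    {κ u : ℝ} (hκ : 0 < κ) (hu : u < 1 / κ) {k : ℝ≥0∞} (hk : k ≠ 0) :
    ∀ᶠ n : ℕ in atTop, quantError N ν n r < 1 → k * (n : ℝ≥0∞) ^ (-κ) ≤ quantError N ν n r →
      u ≤ quantRatio N ν r n := by
  rcases le_or_gt u 0 with hu0 | hu0
  · exact Eventually.of_forall fun n h1 _ => hu0.trans (quantRatio_nonneg h1.le)
  have huκ : u * κ < 1 := by rwa [lt_div_iff₀ hκ] at hu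
  -- a finite positive constant below `k`
  set k' : ℝ := (min k 1).toReal with hk'
  have hk1 : min k 1 ≠ ⊤ := ne_top_of_le_ne_top ENNReal.one_ne_top (min_le_right _ _)
  have hk'0 : 0 < k' := ENNReal.toReal_pos (by simp [min_eq_iff, hk]) hk1
  have hkk : ENNReal.ofReal k' ≤ k := by
    rw [hk', ENNReal.ofReal_toReal hk1]
    exact min_le_left _ _
  have hlog : Tendsto (fun n : ℕ => Real.log n) atTop atTop :=
    Real.tendsto_log_atTop.comp tendsto_natCast_atTop_atTop
  filter_upwards [hlog.eventually_ge_atTop (-(u * Real.log k') / (1 - u * κ)),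
    eventually_gt_atTop 0] with n hn hn0 h1 he
  have hn0' : (0 : ℝ) < n := by exact_mod_cast hn0
  rw [div_le_iff₀ (by linarith)] at hn
  have ht : quantError N ν n r ≠ ⊤ := ne_top_of_lt h1
  have hle : k' * (n : ℝ) ^ (-κ) ≤ (quantError N ν n r).toReal := by
    rw [← ENNReal.ofReal_le_iff_le_toReal ht, ENNReal.ofReal_mul hk'0.le,
      ← natCast_rpow_eq_ofReal hn0]
    exact (mul_le_mul_left hkk _).trans he
  have h0 : 0 < (quantError N ν n r).toReal := lt_of_lt_of_le (by positivity) hle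
  have h1' : (quantError N ν n r).toReal < 1 := by
    rw [← ENNReal.toReal_one]
    exact (ENNReal.toReal_lt_toReal ht (by simp)).2 h1
  have h2 := Real.log_le_log (by positivity) hle
  rw [Real.log_mul (by positivity) (by positivity), Real.log_rpow hn0'] at h2
  unfold quantRatio
  rw [le_div_iff₀ (neg_pos.2 (Real.log_neg h0 h1'))]
  have : u * (-Real.log (quantError N ν n r).toReal) ≤ u * (κ * Real.log n - Real.log k') :=
    mul_le_mul_of_nonneg_left (by linarith) hu0.le
  nlinarith

theorem upperQuantDim_le {N : Seminorm ℝ (Fin d → ℝ)} {ν : Measure (Fin d → ℝ)} {r κ : ℝ}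
    (hκ : 0 < κ) {K : ℝ≥0∞} (hK : K ≠ ⊤)
    (h : ∀ᶠ n : ℕ in atTop, quantError N ν n r ≤ K * (n : ℝ≥0∞) ^ (-κ)) :
    upperQuantDim N ν r ≤ (1 / κ : ℝ) := by
  refine EReal.le_of_forall_lt_iff_le.1 fun u hu => limsup_le_of_le (by isBoundedDefault) ?_
  filter_upwards [h, eventually_quantRatio_le N ν r hκ (EReal.coe_lt_coe_iff.1 hu) hK] with n h1 h2
  exact EReal.coe_le_coe_iff.2 (h2 h1)

theorem lowerQuantDim_le {N : Seminorm ℝ (Fin d → ℝ)} {ν : Measure (Fin d → ℝ)} {r κ : ℝ}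
    (hκ : 0 < κ) {K : ℝ≥0∞} (hK : K ≠ ⊤)
    (h : ∃ᶠ n : ℕ in atTop, quantError N ν n r ≤ K * (n : ℝ≥0∞) ^ (-κ)) :
    lowerQuantDim N ν r ≤ (1 / κ : ℝ) := by
  refine EReal.le_of_forall_lt_iff_le.1 fun u hu => liminf_le_of_frequently_le' ?_
  refine (h.and_eventually (eventually_quantRatio_le N ν r hκ
    (EReal.coe_lt_coe_iff.1 hu) hK)).mono fun n hn => ?_
  exact EReal.coe_le_coe_iff.2 (hn.2 hn.1)

theorem le_lowerQuantDim {N : Seminorm ℝ (Fin d → ℝ)} {ν : Measure (Fin d → ℝ)} {r κ : ℝ}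
    (hκ : 0 < κ) {k : ℝ≥0∞} (hk : k ≠ 0)
    (h1 : ∀ᶠ n : ℕ in atTop, quantError N ν n r < 1)
    (h : ∀ᶠ n : ℕ in atTop, k * (n : ℝ≥0∞) ^ (-κ) ≤ quantError N ν n r) :
    ((1 / κ : ℝ) : EReal) ≤ lowerQuantDim N ν r := by
  refine EReal.ge_of_forall_gt_iff_ge.1 fun u hu => le_liminf_of_le (by isBoundedDefault) ?_
  filter_upwards [h, h1, eventually_le_quantRatio N ν r hκ (EReal.coe_lt_coe_iff.1 hu) hk]
    with n h1 h2 h3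
  exact EReal.coe_le_coe_iff.2 (h3 h2 h1)

theorem le_upperQuantDim {N : Seminorm ℝ (Fin d → ℝ)} {ν : Measure (Fin d → ℝ)} {r κ : ℝ}
    (hκ : 0 < κ) {k : ℝ≥0∞} (hk : k ≠ 0)
    (h1 : ∀ᶠ n : ℕ in atTop, quantError N ν n r < 1)
    (h : ∃ᶠ n : ℕ in atTop, k * (n : ℝ≥0∞) ^ (-κ) ≤ quantError N ν n r) :
    ((1 / κ : ℝ) : EReal) ≤ upperQuantDim N ν r := by
  refine EReal.ge_of_forall_gt_iff_ge.1 fun u hu => le_limsup_of_frequently_le' ?_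
  refine (h.and_eventually (h1.and (eventually_le_quantRatio N ν r hκ
    (EReal.coe_lt_coe_iff.1 hu) hk))).mono fun n hn => ?_
  exact EReal.coe_le_coe_iff.2 (hn.2.2 hn.2.1 hn.1)

end Order

section PowerBounds

variable {d : ℕ}

/-! ### Power bounds from the entropies -/

theorem exists_partition_floor {μ : Measure (Fin d → ℝ)} {r x h : ℝ} (hx : 0 < x)
    (hM : minPartitionCard μ r x ≤ ENNReal.ofReal x ^ h) :
    ∃ P : Finset (Set (Fin d → ℝ)), IsDyadicPartition P ∧
      (∀ Q ∈ P, J μ r Q < ENNReal.ofReal (1 / x)) ∧ P.card ≤ ⌊x ^ h⌋₊ := by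
  refine exists_partition_of_minPartitionCard_lt (hM.trans_lt ?_)
  rw [ENNReal.ofReal_rpow_of_pos hx, ← ENNReal.ofReal_natCast]
  rw [ENNReal.ofReal_lt_ofReal_iff (by positivity)]
  push_cast
  exact Nat.lt_floor_add_one _

theorem ofReal_one_div_le {x h : ℝ} (hx : 0 < x) (hh : 0 < h) {n : ℕ} (hn : 0 < n)
    (hnx : n = ⌊x ^ h⌋₊) : ENNReal.ofReal (1 / x) ≤ (n : ℝ≥0∞) ^ (-(1 / h)) := by
  rw [natCast_rpow_eq_ofReal hn]
  refine ENNReal.ofReal_le_ofReal ?_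
  have hn' : (0 : ℝ) < n := by exact_mod_cast hn
  rw [Real.rpow_neg hn'.le, one_div]
  refine inv_anti₀ (by positivity) ?_
  calc (n : ℝ) ^ (1 / h) ≤ (x ^ h) ^ (1 / h) := by
        refine Real.rpow_le_rpow hn'.le ?_ (by positivity)
        rw [hnx]
        exact Nat.floor_le (by positivity)
    _ = x := by rw [← Real.rpow_mul hx.le, mul_one_div_cancel hh.ne', Real.rpow_one]

theorem natCast_mul_rpow {n : ℕ} (hn : 0 < n) (r h : ℝ) :
    ((n : ℝ≥0∞) * (n : ℝ≥0∞) ^ (-(1 / h))) ^ (1 / r) = (n : ℝ≥0∞) ^ (-((1 / h - 1) / r)) := by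
  have h0 : (n : ℝ≥0∞) ≠ 0 := by exact_mod_cast hn.ne'
  have ht : (n : ℝ≥0∞) ≠ ⊤ := ENNReal.natCast_ne_top n
  nth_rewrite 1 [← ENNReal.rpow_one (n : ℝ≥0∞)]
  rw [← ENNReal.rpow_add _ _ h0 ht, ← ENNReal.rpow_mul]
  congr 1
  ring

theorem tendsto_floor_rpow {h : ℝ} (hh : 0 < h) :
    Tendsto (fun x : ℝ => ⌊x ^ h⌋₊) atTop atTop :=
  tendsto_nat_floor_atTop.comp (tendsto_rpow_atTop hh)

/-- A property of `⌊x ^ h⌋₊` for all large `x` is a property of all large `n`. -/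
theorem eventually_of_floor_rpow {h : ℝ} (hh : 0 < h) {p : ℕ → Prop}
    (hp : ∀ᶠ x : ℝ in atTop, p ⌊x ^ h⌋₊) : ∀ᶠ n : ℕ in atTop, p n := by
  have ht : Tendsto (fun n : ℕ => (n : ℝ) ^ (1 / h)) atTop atTop :=
    (tendsto_rpow_atTop (by positivity)).comp tendsto_natCast_atTop_atTop
  filter_upwards [ht.eventually hp] with n hn
  rwa [← Real.rpow_mul (Nat.cast_nonneg n), one_div_mul_cancel hh.ne', Real.rpow_one,
    Nat.floor_natCast] at hn

section Bounds

variable {N : Seminorm ℝ (Fin d → ℝ)} {ν : Measure (Fin d → ℝ)} {s : ℝ} {b : Fin d → ℝ}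

theorem quantError_le_of_entropy (hd : 0 < d) (hN : ∀ x, N x = 0 → x = 0) (hs : 0 < s)
    (hcube : rescale ν s b (unitCube d)ᶜ = 0) {r : ℝ} (hr : 0 < r) {h : ℝ} (hh : 0 < h) :
    ∃ K : ℝ≥0∞, K ≠ ⊤ ∧ ∀ᶠ x : ℝ in atTop,
      minPartitionCard (rescale ν s b) r x ≤ ENNReal.ofReal x ^ h →
      quantError N ν ⌊x ^ h⌋₊ r ≤ K * (⌊x ^ h⌋₊ : ℝ≥0∞) ^ (-((1 / h - 1) / r)) := by
  obtain ⟨K, hK, hP⟩ := quantError_le_of_partition hd hN hs hcube hr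
  refine ⟨K, hK, ?_⟩
  filter_upwards [eventually_gt_atTop 0, (tendsto_floor_rpow hh).eventually_gt_atTop 0]
    with x hx hn hM
  obtain ⟨P, hP1, hP2, hP3⟩ := exists_partition_floor hx hM
  refine (hP P _ _ hP1 (fun Q hQ => (hP2 Q hQ).le) hP3).trans ?_
  rw [← natCast_mul_rpow hn]
  gcongr
  exact ofReal_one_div_le hx hh hn rfl

theorem le_quantError_of_entropy (hd : 0 < d) (hN : ∀ x, N x = 0 → x = 0) (hs : 0 < s)
    (hcube : rescale ν s b (unitCube d)ᶜ = 0) {r ε : ℝ} (hr : r < 0) (hε : 0 < ε) {h : ℝ}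
    (hh : 0 < h) :
    ∃ k : ℝ≥0∞, k ≠ 0 ∧ ∀ᶠ x : ℝ in atTop,
      minPartitionCard (rescale ν s b) (r - ε) x ≤ ENNReal.ofReal x ^ h →
      k * (⌊x ^ h⌋₊ : ℝ≥0∞) ^ (-((1 / h - 1) / r)) ≤ quantError N ν ⌊x ^ h⌋₊ r := by
  obtain ⟨k, hk, hP⟩ := le_quantError_of_partition hd hN hs hcube hr hε
  refine ⟨k, hk, ?_⟩
  filter_upwards [eventually_gt_atTop 0, (tendsto_floor_rpow hh).eventually_gt_atTop 0]
    with x hx hn hM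
  obtain ⟨P, hP1, hP2, hP3⟩ := exists_partition_floor hx hM
  refine le_trans ?_ (hP P _ _ hP1 (fun Q hQ => (hP2 Q hQ).le) hP3)
  rw [← natCast_mul_rpow hn]
  gcongr k * ?_
  refine rpow_anti (one_div_neg.2 hr) ?_
  gcongr
  exact ofReal_one_div_le hx hh hn rfl

/-! ### Power bounds from the coarse multifractal dimensions -/

/-- The threshold `2 ^ (-α m)` in terms of the number `n` of points, if `n` is at least comparable
to `2 ^ (f α m)`. -/
theorem const_mul_rpow_le_two_rpow {α f B : ℝ} (hf : 0 < f) (hB : 0 < B) {m n : ℕ} (hn : 0 < n)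
    (h : (2 : ℝ) ^ (f * α * m) ≤ B * n) :
    ENNReal.ofReal (B ^ (-(1 / f))) * (n : ℝ≥0∞) ^ (-(1 / f)) ≤ 2 ^ (-α * m) := by
  have hn' : (0 : ℝ) < n := by exact_mod_cast hn
  rw [natCast_rpow_eq_ofReal hn, ← ENNReal.ofReal_mul (by positivity), ← ofReal_two_rpow,
    ← Real.mul_rpow hB.le hn'.le]
  refine ENNReal.ofReal_le_ofReal ?_
  have h1 : (2 : ℝ) ^ (-α * m) = ((2 : ℝ) ^ (f * α * m)) ^ (-(1 / f)) := by
    rw [← Real.rpow_mul (by norm_num)]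
    congr 1
    field_simp
  rw [h1]
  exact Real.rpow_le_rpow_of_nonpos (by positivity) h (by simpa using hf.le)

theorem ofReal_ne_zero_of_pos {x : ℝ} (hx : 0 < x) : ENNReal.ofReal x ≠ 0 := by simpa using hx

theorem le_quantError_of_coarseCount (hd : 0 < d) (hN : ∀ x, N x = 0 → x = 0) (hs : 0 < s)
    {r : ℝ} (hr : 0 < r) {α f B : ℝ} (hf : 0 < f) (hB : 0 < B) :
    ∃ k : ℝ≥0∞, k ≠ 0 ∧ ∀ m n : ℕ, 0 < n →
      (2 : ℝ) ^ (f * α * m) ≤ coarseCount (rescale ν s b) α r m →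
      (2 * 3 ^ d : ℝ) * n ≤ (2 : ℝ) ^ (f * α * m) → (2 : ℝ) ^ (f * α * m) ≤ B * n →
      k * (n : ℝ≥0∞) ^ (-((1 / f - 1) / r)) ≤ quantError N ν n r := by
  obtain ⟨k, hk, hT⟩ := le_quantError_of_card (b := b) (ν := ν) hd hN hs hr
  have hc0 : ENNReal.ofReal (B ^ (-(1 / f))) ≠ 0 := ofReal_ne_zero_of_pos (by positivity)
  refine ⟨k * ENNReal.ofReal (B ^ (-(1 / f))) ^ (1 / r),
    mul_ne_zero hk (rpow_ne_zero_of hc0 ENNReal.ofReal_ne_top _), fun m n hn h1 h2 h3 => ?_⟩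
  have hcard : 2 * 3 ^ d * n ≤ (coarseCubes (rescale ν s b) α r m).card := by
    rw [card_coarseCubes]
    exact_mod_cast h2.trans h1
  refine le_trans ?_ (hT m (coarseCubes (rescale ν s b) α r m) (2 ^ (-α * m)) n
    (fun Q hQ => (mem_coarseCubes.1 hQ).1) (fun Q hQ => (mem_coarseCubes.1 hQ).2) hcard)
  rw [mul_assoc, ← natCast_mul_rpow hn, ← const_mul_rpow hc0 ENNReal.ofReal_ne_top,
    mul_left_comm]
  gcongr k * (?_ * ?_) ^ (1 / r)
  · refine Nat.cast_le.2 (le_trans ?_ hcard)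
    exact Nat.le_mul_of_pos_left _ (by positivity)
  · exact const_mul_rpow_le_two_rpow hf hB hn h3

theorem quantError_le_of_coarseCount (hd : 0 < d) (hN : ∀ x, N x = 0 → x = 0) (hs : 0 < s)
    {r : ℝ} (hr : r < 0) {α f B : ℝ} (hf : 0 < f) (hB : 0 < B) :
    ∃ K : ℝ≥0∞, K ≠ ⊤ ∧ ∀ m n : ℕ, 0 < n →
      (2 : ℝ) ^ (f * α * m) ≤ coarseCount (rescale ν s b) α r m →
      (n : ℝ) ≤ (2 : ℝ) ^ (f * α * m) → (2 : ℝ) ^ (f * α * m) ≤ B * n →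
      quantError N ν n r ≤ K * (n : ℝ≥0∞) ^ (-((1 / f - 1) / r)) := by
  obtain ⟨K, hK, hT⟩ := quantError_le_of_card (b := b) (ν := ν) hd hN hs hr
  have hc0 : ENNReal.ofReal (B ^ (-(1 / f))) ≠ 0 := ofReal_ne_zero_of_pos (by positivity)
  refine ⟨K * ENNReal.ofReal (B ^ (-(1 / f))) ^ (1 / r),
    ENNReal.mul_ne_top hK (rpow_ne_top_of hc0 ENNReal.ofReal_ne_top _), fun m n hn h1 h2 h3 => ?_⟩
  have hcard : n ≤ (coarseCubes (rescale ν s b) α r m).card := by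
    rw [card_coarseCubes]
    exact_mod_cast h2.trans h1
  obtain ⟨T, hTs, hTc⟩ := Finset.exists_subset_card_eq hcard
  refine (hT m T (2 ^ (-α * m)) n (fun Q hQ => (mem_coarseCubes.1 (hTs hQ)).1)
    (Finset.card_pos.1 (hTc ▸ hn)) (two_rpow_ne_zero _) (two_rpow_ne_top _)
    (fun Q hQ => (mem_coarseCubes.1 (hTs hQ)).2) hTc.le).trans ?_
  rw [mul_assoc, ← natCast_mul_rpow hn, ← const_mul_rpow hc0 ENNReal.ofReal_ne_top,
    mul_left_comm, hTc]
  gcongr K * ?_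
  refine rpow_anti (one_div_neg.2 hr) ?_
  gcongr
  exact const_mul_rpow_le_two_rpow hf hB hn h3

end Bounds

/-- For given `n` there is a level `m` such that `2 ^ (a m)` is comparable to `n`. -/
theorem eventually_of_scale {a D : ℝ} (ha : 0 < a) (hD : 0 < D) {q : ℕ → Prop} {p : ℕ → Prop}
    (hq : ∀ᶠ m in atTop, q m)
    (h : ∀ m n : ℕ, 0 < n → q m → D * n ≤ (2 : ℝ) ^ (a * m) →
      (2 : ℝ) ^ (a * m) ≤ D * 2 ^ a * n → p n) : ∀ᶠ n in atTop, p n := by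
  have ht : Tendsto (fun n : ℕ => ⌈Real.logb 2 (D * n) / a⌉₊) atTop atTop :=
    tendsto_nat_ceil_atTop.comp (((Real.tendsto_logb_atTop (by norm_num)).comp
      (tendsto_natCast_atTop_atTop.const_mul_atTop hD)).atTop_div_const ha)
  have ht' : Tendsto (fun n : ℕ => D * (n : ℝ)) atTop atTop :=
    tendsto_natCast_atTop_atTop.const_mul_atTop hD
  filter_upwards [ht.eventually hq, eventually_gt_atTop 0, ht'.eventually_ge_atTop 1]
    with n hn hn0 hn1
  have hDn : D * n = (2 : ℝ) ^ Real.logb 2 (D * n) :=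
    (Real.rpow_logb (by norm_num) (by norm_num) (by linarith)).symm
  have hl : 0 ≤ Real.logb 2 (D * n) := Real.logb_nonneg (by norm_num) hn1
  refine h _ n hn0 hn ?_ ?_
  · conv_lhs => rw [hDn]
    refine Real.rpow_le_rpow_of_exponent_le (by norm_num) ?_
    have := Nat.le_ceil (Real.logb 2 (D * n) / a)
    rw [div_le_iff₀ ha] at this
    linarith
  · have e : D * 2 ^ a * n = (2 : ℝ) ^ (Real.logb 2 (D * n) + a) := by
      rw [Real.rpow_add (by norm_num), ← hDn]
      ring
    rw [e]
    refine Real.rpow_le_rpow_of_exponent_le (by norm_num) ?_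
    have := (Nat.ceil_lt_add_one (div_nonneg hl ha.le)).le
    calc a * (⌈Real.logb 2 (D * n) / a⌉₊ : ℝ) ≤ a * (Real.logb 2 (D * n) / a + 1) :=
          mul_le_mul_of_nonneg_left this ha.le
      _ = _ := by field_simp

/-- The counterpart of `eventually_of_scale` for frequent events: each level `m` has an `n`. -/
theorem frequently_of_scale {a D : ℝ} (ha : 0 < a) (hD : 0 < D) {q : ℕ → Prop} {p : ℕ → Prop}
    (hq : ∃ᶠ m in atTop, q m)
    (h : ∀ m n : ℕ, 0 < n → q m → D * n ≤ (2 : ℝ) ^ (a * m) →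
      (2 : ℝ) ^ (a * m) ≤ D * 2 * n → p n) : ∃ᶠ n in atTop, p n := by
  have ht : Tendsto (fun m : ℕ => (2 : ℝ) ^ (a * m) / D) atTop atTop :=
    ((tendsto_rpow_atTop_of_base_gt_one 2 (by norm_num)).comp
      (tendsto_natCast_atTop_atTop.const_mul_atTop ha)).atTop_div_const hD
  have ht' : Tendsto (fun m : ℕ => ⌊(2 : ℝ) ^ (a * m) / D⌋₊) atTop atTop :=
    tendsto_nat_floor_atTop.comp ht
  refine ht'.frequently ((hq.and_eventually (ht'.eventually_gt_atTop 0)).mono fun m hm => ?_)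
  have h1 : (1 : ℝ) ≤ ⌊(2 : ℝ) ^ (a * m) / D⌋₊ := by exact_mod_cast hm.2
  refine h m _ hm.2 hm.1 ?_ ?_
  · have := Nat.floor_le (a := (2 : ℝ) ^ (a * m) / D) (by positivity)
    rw [le_div_iff₀ hD] at this
    linarith
  · have := (Nat.lt_floor_add_one ((2 : ℝ) ^ (a * m) / D)).le
    rw [div_le_iff₀ hD] at this
    nlinarith

/-! ### The expression `ratio` -/

theorem ratio_coe (r x : ℝ) : ratio r x = ((r * x / (1 - x) : ℝ) : EReal) := by
  rw [ratio, EReal.coe_div, EReal.coe_mul, EReal.coe_sub, EReal.coe_one]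

theorem one_div_exponent {r v : ℝ} (hr : r ≠ 0) (hv : v ≠ 0) (hv1 : v ≠ 1) :
    1 / ((1 / v - 1) / r) = r * v / (1 - v) := by
  have : 1 - v ≠ 0 := sub_ne_zero.2 hv1.symm
  field_simp

theorem exponent_pos_of_lt_one {r v : ℝ} (hr : 0 < r) (hv : 0 < v) (hv1 : v < 1) :
    0 < (1 / v - 1) / r :=
  div_pos (sub_pos.2 ((one_lt_div hv).2 hv1)) hr

theorem exponent_pos_of_one_lt {r v : ℝ} (hr : r < 0) (hv1 : 1 < v) : 0 < (1 / v - 1) / r :=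
  div_pos_of_neg_of_neg (sub_neg.2 ((div_lt_one (by linarith)).2 hv1)) hr

theorem tendsto_ratio {r F : ℝ} (hF : F ≠ 1) :
    Tendsto (fun v : ℝ => ((r * v / (1 - v) : ℝ) : EReal)) (𝓝 F) (𝓝 (ratio r F)) := by
  rw [ratio_coe]
  refine (continuous_coe_real_ereal.tendsto _).comp ?_
  have h1 : 1 - F ≠ 0 := sub_ne_zero.2 hF.symm
  exact ((continuous_const.mul continuous_id).tendsto F).div
    ((continuous_const.sub continuous_id).tendsto F) h1

theorem ratio_le_of_eventually {r F : ℝ} {X : EReal} {l : Filter ℝ} [NeBot l] (hl : l ≤ 𝓝 F)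
    (hF : F ≠ 1) (h : ∀ᶠ v in l, ((r * v / (1 - v) : ℝ) : EReal) ≤ X) : ratio r F ≤ X :=
  le_of_tendsto ((tendsto_ratio hF).mono_left hl) h

theorem le_ratio_of_eventually {r F : ℝ} {X : EReal} {l : Filter ℝ} [NeBot l] (hl : l ≤ 𝓝 F)
    (hF : F ≠ 1) (h : ∀ᶠ v in l, X ≤ ((r * v / (1 - v) : ℝ) : EReal)) : X ≤ ratio r F :=
  ge_of_tendsto ((tendsto_ratio hF).mono_left hl) h

theorem ratio_mono {r : ℝ} (hr : 0 < r) {x y : ℝ} (hxy : x ≤ y) (hy : y < 1) :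
    ratio r x ≤ ratio r y := by
  rw [ratio_coe, ratio_coe, EReal.coe_le_coe_iff, div_le_div_iff₀ (by linarith) (by linarith)]
  nlinarith

theorem ratio_anti {r : ℝ} (hr : r < 0) {x y : ℝ} (hxy : x ≤ y) (hx : 1 < x) :
    ratio r y ≤ ratio r x := by
  rw [ratio_coe, ratio_coe, EReal.coe_le_coe_iff, ← neg_div_neg_eq (r * y),
    ← neg_div_neg_eq (r * x), div_le_div_iff₀ (by linarith) (by linarith)]
  nlinarith

/-! ### Quantization dimensions of positive order -/

section Main

variable {N : Seminorm ℝ (Fin d → ℝ)} {ν : Measure (Fin d → ℝ)} {s : ℝ}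
  {b : Fin d → ℝ}

instance isProbabilityMeasure_rescale (ν : Measure (Fin d → ℝ)) [IsProbabilityMeasure ν] (s : ℝ)
    (b : Fin d → ℝ) : IsProbabilityMeasure (rescale ν s b) :=
  Measure.isProbabilityMeasure_map (by fun_prop)

theorem neg_dimInfty_lt (μ : Measure (Fin d → ℝ)) [IsProbabilityMeasure μ] {r : ℝ} (hr : 0 < r) :
    -(dimInfty μ) < (r : EReal) :=
  lt_of_le_of_lt (b := (0 : EReal)) (EReal.neg_le.1 (by simpa using dimInfty_nonneg μ))
    (by exact_mod_cast hr)

theorem upperEntropy_lt_one (hd : 0 < d) {μ : Measure (Fin d → ℝ)} [IsProbabilityMeasure μ]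
    (hμ : μ (unitCube d)ᶜ = 0) {r : ℝ} (hr : 0 < r) : upperEntropy μ r < 1 :=
  (upperEntropy_le_qCrit hd μ r).trans_lt (qCrit_lt_one hd hμ hr)

theorem eventually_quantError_lt_one [IsProbabilityMeasure ν] (hd : 0 < d)
    (hN : ∀ x, N x = 0 → x = 0) (hs : 0 < s)
    (hcube : rescale ν s b (unitCube d)ᶜ = 0) (r : ℝ) :
    ∀ᶠ n : ℕ in atTop, quantError N ν n r < 1 := by
  have hcont := (exists_norm_bounds N hN).1
  have main : ∀ r : ℝ, 0 < r → ∀ᶠ n : ℕ in atTop, quantError N ν n r < 1 := by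
    intro r hr
    obtain ⟨h, hh1, hh2⟩ := EReal.lt_iff_exists_real_btwn.1 (upperEntropy_lt_one hd hcube hr)
    have hh0 : 0 < h := by exact_mod_cast (upperEntropy_nonneg _ _).trans_lt hh1
    have hh2' : h < 1 := by exact_mod_cast hh2
    obtain ⟨K, hK, hx⟩ := quantError_le_of_entropy hd hN hs hcube hr hh0
    have hev := eventually_of_floor_rpow (p := fun n => quantError N ν n r ≤
      K * (n : ℝ≥0∞) ^ (-((1 / h - 1) / r))) hh0
      ((hx.and (eventually_of_upperEntropy_lt hh1)).mono fun x hx => hx.1 hx.2)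
    have hκ := exponent_pos_of_lt_one hr hh0 hh2'
    have ht : Tendsto (fun n : ℕ => K * (n : ℝ≥0∞) ^ (-((1 / h - 1) / r))) atTop (𝓝 0) := by
      have h1 : Tendsto (fun n : ℕ => (n : ℝ≥0∞) ^ (-((1 / h - 1) / r))) atTop (𝓝 0) := by
        simp_rw [ENNReal.rpow_neg]
        rw [← ENNReal.inv_top]
        exact tendsto_inv_iff.2
          ((ENNReal.tendsto_rpow_at_top hκ).comp ENNReal.tendsto_nat_nhds_top)
      simpa using ENNReal.Tendsto.const_mul h1 (Or.inr hK)
    filter_upwards [hev, ht.eventually (gt_mem_nhds one_pos)] with n h1 h2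
    exact h1.trans_lt h2
  rcases lt_trichotomy r 0 with hr | rfl | hr
  · exact (main 1 one_pos).mono fun n hn => ((quantError_le_zero hcont hr n).trans
      (quantError_zero_le hcont one_pos n)).trans_lt hn
  · exact (main 1 one_pos).mono fun n hn => (quantError_zero_le hcont one_pos n).trans_lt hn
  · exact main r hr

theorem lowerQuantDim_nonneg [IsProbabilityMeasure ν] (hd : 0 < d)
    (hN : ∀ x, N x = 0 → x = 0) (hs : 0 < s)
    (hcube : rescale ν s b (unitCube d)ᶜ = 0) (r : ℝ) : 0 ≤ lowerQuantDim N ν r := by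
  refine le_liminf_of_le (by isBoundedDefault) ?_
  filter_upwards [eventually_quantError_lt_one hd hN hs hcube r] with n hn
  exact EReal.coe_nonneg.2 (quantRatio_nonneg hn.le)

theorem upperQuantDim_le_ratio_of_pos [IsProbabilityMeasure ν] (hd : 0 < d)
    (hN : ∀ x, N x = 0 → x = 0) (hs : 0 < s)
    (hcube : rescale ν s b (unitCube d)ᶜ = 0) {r : ℝ} (hr : 0 < r) {F : ℝ}
    (hF : upperEntropy (rescale ν s b) r = F) :
    upperQuantDim N ν r ≤ ratio r F := by
  have hF1 : F < 1 := by exact_mod_cast hF ▸ upperEntropy_lt_one hd hcube hr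
  have hF0 : 0 ≤ F := by exact_mod_cast hF ▸ upperEntropy_nonneg (rescale ν s b) r
  refine le_ratio_of_eventually (l := 𝓝[>] F) nhdsWithin_le_nhds hF1.ne ?_
  filter_upwards [Ioo_mem_nhdsGT hF1] with h hh
  have hh0 : 0 < h := hF0.trans_lt hh.1
  obtain ⟨K, hK, hx⟩ := quantError_le_of_entropy hd hN hs hcube hr hh0
  rw [← one_div_exponent hr.ne' hh0.ne' hh.2.ne]
  refine upperQuantDim_le (exponent_pos_of_lt_one hr hh0 hh.2) hK
    (eventually_of_floor_rpow hh0 ((hx.and (eventually_of_upperEntropy_lt ?_)).mono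
      fun x hx => hx.1 hx.2))
  rw [hF]
  exact_mod_cast hh.1

/-- Only the entropy of order `r` itself enters here, not its limit from the left. -/
theorem lowerQuantDim_le_ratio_of_pos (hd : 0 < d) (hN : ∀ x, N x = 0 → x = 0) (hs : 0 < s)
    (hcube : rescale ν s b (unitCube d)ᶜ = 0) {r : ℝ} (hr : 0 < r) {F : ℝ} (hF1 : F < 1)
    (hF : lowerEntropy (rescale ν s b) r ≤ F) :
    lowerQuantDim N ν r ≤ ratio r F := by
  have hF0 : 0 ≤ F := by exact_mod_cast (lowerEntropy_nonneg (rescale ν s b) r).trans hF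
  refine le_ratio_of_eventually (l := 𝓝[>] F) nhdsWithin_le_nhds hF1.ne ?_
  filter_upwards [Ioo_mem_nhdsGT hF1] with h hh
  have hh0 : 0 < h := hF0.trans_lt hh.1
  obtain ⟨K, hK, hx⟩ := quantError_le_of_entropy hd hN hs hcube hr hh0
  rw [← one_div_exponent hr.ne' hh0.ne' hh.2.ne]
  refine lowerQuantDim_le (exponent_pos_of_lt_one hr hh0 hh.2) hK
    ((tendsto_floor_rpow hh0).frequently
      (((frequently_of_lowerEntropy_lt (hF.trans_lt ?_)).and_eventually hx).mono
        fun x hx => hx.2 hx.1))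
  exact_mod_cast hh.1

theorem ratio_le_upperQuantDim_of_pos [IsProbabilityMeasure ν] (hd : 0 < d)
    (hN : ∀ x, N x = 0 → x = 0) (hs : 0 < s)
    (hcube : rescale ν s b (unitCube d)ᶜ = 0) {r : ℝ} (hr : 0 < r) {F : ℝ} (hF1 : F < 1)
    (hF0 : 0 ≤ F) (hF : upperCoarseDim (rescale ν s b) r = F) :
    ratio r F ≤ upperQuantDim N ν r := by
  rcases hF0.eq_or_lt with rfl | hF0
  · rw [ratio_coe, mul_zero, zero_div]
    exact (lowerQuantDim_nonneg hd hN hs hcube r).trans (liminf_le_limsup)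
  refine ratio_le_of_eventually (l := 𝓝[<] F) nhdsWithin_le_nhds hF1.ne ?_
  filter_upwards [Ioo_mem_nhdsLT hF0] with f hf
  have hf1 : f < 1 := hf.2.trans hF1
  obtain ⟨α, hα, hm⟩ := frequently_of_lt_upperCoarseDim (μ := rescale ν s b) (r := r) hf.1.le
    (by rw [hF]; exact_mod_cast hf.2)
  obtain ⟨k, hk, hn⟩ := le_quantError_of_coarseCount (N := N) (ν := ν) (b := b) (α := α)
    (B := 2 * 3 ^ d * 2) hd hN hs hr hf.1 (by positivity)
  rw [← one_div_exponent hr.ne' hf.1.ne' hf1.ne]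
  refine le_upperQuantDim (exponent_pos_of_lt_one hr hf.1 hf1) hk
    (eventually_quantError_lt_one hd hN hs hcube r)
    (frequently_of_scale (mul_pos hf.1 hα) (D := 2 * 3 ^ d) (by positivity) hm ?_)
  exact fun m n h0 h1 h2 h3 => hn m n h0 h1 h2 h3

theorem ratio_le_lowerQuantDim_of_pos [IsProbabilityMeasure ν] (hd : 0 < d)
    (hN : ∀ x, N x = 0 → x = 0) (hs : 0 < s)
    (hcube : rescale ν s b (unitCube d)ᶜ = 0) {r : ℝ} (hr : 0 < r) {F : ℝ} (hF1 : F < 1)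
    (hF0 : 0 ≤ F) (hF : lowerCoarseDim (rescale ν s b) r = F) :
    ratio r F ≤ lowerQuantDim N ν r := by
  rcases hF0.eq_or_lt with rfl | hF0
  · rw [ratio_coe, mul_zero, zero_div]
    exact lowerQuantDim_nonneg hd hN hs hcube r
  refine ratio_le_of_eventually (l := 𝓝[<] F) nhdsWithin_le_nhds hF1.ne ?_
  filter_upwards [Ioo_mem_nhdsLT hF0] with f hf
  have hf1 : f < 1 := hf.2.trans hF1
  obtain ⟨α, hα, hm⟩ := eventually_of_lt_lowerCoarseDim (μ := rescale ν s b) (r := r) hf.1.le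
    (by rw [hF]; exact_mod_cast hf.2)
  obtain ⟨k, hk, hn⟩ := le_quantError_of_coarseCount (N := N) (ν := ν) (b := b) (α := α)
    (B := 2 * 3 ^ d * 2 ^ (f * α)) hd hN hs hr hf.1 (by positivity)
  rw [← one_div_exponent hr.ne' hf.1.ne' hf1.ne]
  refine le_lowerQuantDim (exponent_pos_of_lt_one hr hf.1 hf1) hk
    (eventually_quantError_lt_one hd hN hs hcube r)
    (eventually_of_scale (mul_pos hf.1 hα) (D := 2 * 3 ^ d) (by positivity) hm ?_)
  exact fun m n h0 h1 h2 h3 => hn m n h0 h1 h2 h3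

/-! ### Quantization dimensions of negative order -/

theorem lowerQuantDim_le_ratio_of_neg (hd : 0 < d) (hN : ∀ x, N x = 0 → x = 0) (hs : 0 < s)
    {r : ℝ} (hr : r < 0) {F : ℝ} (hF1 : 1 < F)
    (hF : upperCoarseDim (rescale ν s b) r = F) :
    lowerQuantDim N ν r ≤ ratio r F := by
  refine le_ratio_of_eventually (l := 𝓝[<] F) nhdsWithin_le_nhds hF1.ne' ?_
  filter_upwards [Ioo_mem_nhdsLT hF1] with f hf
  have hf0 : 0 < f := one_pos.trans hf.1
  obtain ⟨α, hα, hm⟩ := frequently_of_lt_upperCoarseDim (μ := rescale ν s b) (r := r) hf0.le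
    (by rw [hF]; exact_mod_cast hf.2)
  obtain ⟨K, hK, hn⟩ := quantError_le_of_coarseCount (N := N) (ν := ν) (b := b) (α := α)
    (B := 1 * 2) hd hN hs hr hf0 (by positivity)
  rw [← one_div_exponent hr.ne hf0.ne' hf.1.ne']
  refine lowerQuantDim_le (exponent_pos_of_one_lt hr hf.1) hK
    (frequently_of_scale (mul_pos hf0 hα) one_pos hm ?_)
  exact fun m n h0 h1 h2 h3 => hn m n h0 h1 (by simpa using h2) h3

theorem upperQuantDim_le_ratio_of_neg (hd : 0 < d) (hN : ∀ x, N x = 0 → x = 0) (hs : 0 < s)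
    {r : ℝ} (hr : r < 0) {F : ℝ} (hF1 : 1 < F)
    (hF : lowerCoarseDim (rescale ν s b) r = F) :
    upperQuantDim N ν r ≤ ratio r F := by
  refine le_ratio_of_eventually (l := 𝓝[<] F) nhdsWithin_le_nhds hF1.ne' ?_
  filter_upwards [Ioo_mem_nhdsLT hF1] with f hf
  have hf0 : 0 < f := one_pos.trans hf.1
  obtain ⟨α, hα, hm⟩ := eventually_of_lt_lowerCoarseDim (μ := rescale ν s b) (r := r) hf0.le
    (by rw [hF]; exact_mod_cast hf.2)
  obtain ⟨K, hK, hn⟩ := quantError_le_of_coarseCount (N := N) (ν := ν) (b := b) (α := α)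
    (B := 1 * 2 ^ (f * α)) hd hN hs hr hf0 (by positivity)
  rw [← one_div_exponent hr.ne hf0.ne' hf.1.ne']
  refine upperQuantDim_le (exponent_pos_of_one_lt hr hf.1) hK
    (eventually_of_scale (mul_pos hf0 hα) one_pos hm ?_)
  exact fun m n h0 h1 h2 h3 => hn m n h0 h1 (by simpa using h2) h3

/-- The lower bound for the error of order `r` uses `J` of order `r - ε`; the loss disappears in
the limit because the critical value is continuous from the left. -/
theorem ratio_le_lowerQuantDim_of_neg [IsProbabilityMeasure ν] (hd : 0 < d)
    (hN : ∀ x, N x = 0 → x = 0) (hs : 0 < s)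
    (hcube : rescale ν s b (unitCube d)ᶜ = 0) {r : ℝ} (hr : r < 0) {F : ℝ} (hF1 : 1 < F)
    (hF : qCrit (rescale ν s b) r = F) :
    ratio r F ≤ lowerQuantDim N ν r := by
  refine ratio_le_of_eventually (l := 𝓝[>] F) nhdsWithin_le_nhds hF1.ne' ?_
  filter_upwards [self_mem_nhdsWithin] with h hh
  have hh1 : 1 < h := hF1.trans hh
  have hh0 : 0 < h := one_pos.trans hh1
  obtain ⟨p, hp0, hph, hp⟩ := exists_of_qCrit_lt hd (hF.trans_lt (EReal.coe_lt_coe_iff.2 hh))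
  obtain ⟨v, hv1, hv2⟩ := EReal.lt_iff_exists_real_btwn.1 hp
  have hv2' : v < r * p := by exact_mod_cast hv2
  -- `beta < (r - ε) * p` still holds for this `ε`
  have hε : 0 < r - v / p := sub_pos.2 (by rwa [div_lt_iff₀ hp0])
  have hent : upperEntropy (rescale ν s b) (r - (r - v / p)) < h := by
    refine ((upperEntropy_le_qCrit hd _ _).trans (qCrit_le hd hp0 (hv1.trans_le ?_))).trans_lt hph
    rw [sub_sub_cancel, div_mul_cancel₀ _ hp0.ne']
  obtain ⟨k, hk, hx⟩ := le_quantError_of_entropy hd hN hs hcube hr hε hh0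
  rw [← one_div_exponent hr.ne hh0.ne' hh1.ne']
  exact le_lowerQuantDim (exponent_pos_of_one_lt hr hh1) hk
    (eventually_quantError_lt_one hd hN hs hcube r)
    (eventually_of_floor_rpow hh0 ((hx.and (eventually_of_upperEntropy_lt hent)).mono
      fun x hx => hx.1 hx.2))

theorem ratio_le_upperQuantDim_of_neg [IsProbabilityMeasure ν] (hd : 0 < d)
    (hN : ∀ x, N x = 0 → x = 0) (hs : 0 < s)
    (hcube : rescale ν s b (unitCube d)ᶜ = 0) {r : ℝ} (hr : r < 0) {F : ℝ} (hF1 : 1 < F)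
    (hF : lowerEntropyLim (rescale ν s b) r = F) :
    ratio r F ≤ upperQuantDim N ν r := by
  refine ratio_le_of_eventually (l := 𝓝[>] F) nhdsWithin_le_nhds hF1.ne' ?_
  filter_upwards [self_mem_nhdsWithin] with h hh
  have hh1 : 1 < h := hF1.trans hh
  have hh0 : 0 < h := one_pos.trans hh1
  obtain ⟨ε, hent, hε⟩ := (((tendsto_lowerEntropyLim hd (rescale ν s b) r).eventually
    (gt_mem_nhds (hF.trans_lt (EReal.coe_lt_coe_iff.2 hh)))).and self_mem_nhdsWithin).exists
  obtain ⟨k, hk, hx⟩ := le_quantError_of_entropy hd hN hs hcube hr hε hh0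
  rw [← one_div_exponent hr.ne hh0.ne' hh1.ne']
  exact le_upperQuantDim (exponent_pos_of_one_lt hr hh1) hk
    (eventually_quantError_lt_one hd hN hs hcube r)
    ((tendsto_floor_rpow hh0).frequently
      (((frequently_of_lowerEntropy_lt hent).and_eventually hx).mono fun x hx => hx.2 hx.1))

end Main

end PowerBounds

section Dimensions

variable {d : ℕ}

theorem exists_coe_of_mem_Ico {x : EReal} (h : x ∈ Set.Ico (0 : EReal) 1) :
    ∃ y : ℝ, x = y ∧ 0 ≤ y ∧ y < 1 := by
  lift x to ℝ using ⟨(h.2.trans_le le_top).ne, (EReal.bot_lt_zero.trans_le h.1).ne'⟩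
  exact ⟨x, rfl, by exact_mod_cast h.1, by exact_mod_cast h.2⟩

theorem exists_coe_of_mem_Ioo {x : EReal} (h : x ∈ Set.Ioo (1 : EReal) ⊤) :
    ∃ y : ℝ, x = y ∧ 1 < y := by
  lift x to ℝ using ⟨h.2.ne, (lt_of_le_of_lt bot_le h.1).ne'⟩
  exact ⟨x, rfl, by exact_mod_cast h.1⟩

variable {N : Seminorm ℝ (Fin d → ℝ)} {ν : Measure (Fin d → ℝ)} {s : ℝ} {b : Fin d → ℝ}

/-- The quantization dimensions of positive order. -/
theorem quantDim_of_pos [IsProbabilityMeasure ν] (hd : 0 < d) (hN : ∀ x, N x = 0 → x = 0)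
    (hs : 0 < s) {μ : Measure (Fin d → ℝ)} (hμ : μ = rescale ν s b)
    (hcube : μ (unitCube d)ᶜ = 0) {r : ℝ} (hr : 0 < r) :
    Tendsto (fun ε => lowerEntropy μ (r - ε)) (𝓝[>] (0 : ℝ)) (𝓝 (lowerEntropyLim μ r)) ∧
      (∀ x ∈ ({lowerCoarseDim μ r, lowerEntropyLim μ r, upperEntropy μ r, qCrit μ r,
          upperCoarseDim μ r} : Set EReal), x ∈ Set.Ico (0 : EReal) 1) ∧
      ratio r (lowerCoarseDim μ r) ≤ lowerQuantDim N ν r ∧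
      lowerQuantDim N ν r ≤ ratio r (lowerEntropyLim μ r) ∧
      ratio r (lowerEntropyLim μ r) ≤ ratio r (upperEntropy μ r) ∧
      ratio r (upperEntropy μ r) = upperQuantDim N ν r ∧
      upperQuantDim N ν r = ratio r (qCrit μ r) ∧
      ratio r (qCrit μ r) = ratio r (upperCoarseDim μ r) := by
  subst hμ
  set μ := rescale ν s b
  have hr' := neg_dimInfty_lt μ hr
  have hU := upperEntropy_eq_qCrit hd hr'
  have hC := upperCoarseDim_eq_qCrit hd hr'
  have hq : qCrit μ r ∈ Set.Ico (0 : EReal) 1 := ⟨qCrit_nonneg μ r, qCrit_lt_one hd hcube hr⟩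
  have hLlim : lowerEntropyLim μ r ∈ Set.Ico (0 : EReal) 1 :=
    ⟨(lowerEntropy_nonneg μ r).trans (lowerEntropy_le_lowerEntropyLim hd μ r),
      (lowerEntropyLim_le_qCrit hd μ r).trans_lt hq.2⟩
  have hLC : lowerCoarseDim μ r ∈ Set.Ico (0 : EReal) 1 :=
    ⟨lowerCoarseDim_nonneg μ r,
      ((lowerCoarseDim_le_upperCoarseDim μ r).trans_eq hC).trans_lt hq.2⟩
  obtain ⟨q, hqe, hq0, hq1⟩ := exists_coe_of_mem_Ico hq
  obtain ⟨l, hle, hl0, hl1⟩ := exists_coe_of_mem_Ico hLlim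
  obtain ⟨f, hfe, hf0, hf1⟩ := exists_coe_of_mem_Ico hLC
  have hlq : l ≤ q := by
    have := lowerEntropyLim_le_qCrit hd μ r
    rw [hle, hqe] at this
    exact_mod_cast this
  have hD : upperQuantDim N ν r = ratio r q :=
    (upperQuantDim_le_ratio_of_pos hd hN hs hcube hr (hU.trans hqe)).antisymm
      (ratio_le_upperQuantDim_of_pos hd hN hs hcube hr hq1 hq0 (hC.trans hqe))
  refine ⟨tendsto_lowerEntropyLim hd μ r, ?_, ?_, ?_, ?_, ?_, ?_, ?_⟩
  · rintro x (rfl | rfl | rfl | rfl | rfl)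
    exacts [hLC, hLlim, hU ▸ hq, hq, hC ▸ hq]
  · rw [hfe]
    exact ratio_le_lowerQuantDim_of_pos hd hN hs hcube hr hf1 hf0 hfe
  · rw [hle]
    exact lowerQuantDim_le_ratio_of_pos hd hN hs hcube hr hl1
      ((lowerEntropy_le_lowerEntropyLim hd μ r).trans_eq hle)
  · rw [hU, hle, hqe]
    exact ratio_mono hr hlq hq1
  · rw [hU, hqe, hD]
  · rw [hqe, hD]
  · rw [hC]

/-- The quantization dimensions of negative order. -/
theorem quantDim_of_neg [IsProbabilityMeasure ν] (hd : 0 < d) (hN : ∀ x, N x = 0 → x = 0)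
    (hs : 0 < s) {μ : Measure (Fin d → ℝ)} (hμ : μ = rescale ν s b)
    (hcube : μ (unitCube d)ᶜ = 0) {r : ℝ} (hr' : -(dimInfty μ) < (r : EReal)) (hr : r < 0) :
    ((∀ x ∈ ({upperCoarseDim μ r, qCrit μ r, upperEntropy μ r} : Set EReal),
        x ∈ Set.Ioo (1 : EReal) ⊤) ∧
      ratio r (upperCoarseDim μ r) = ratio r (qCrit μ r) ∧
      ratio r (qCrit μ r) = lowerQuantDim N ν r ∧
      lowerQuantDim N ν r = ratio r (upperEntropy μ r)) ∧
    (1 < lowerCoarseDim μ r →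
      Tendsto (fun ε => lowerEntropy μ (r - ε)) (𝓝[>] (0 : ℝ)) (𝓝 (lowerEntropyLim μ r)) ∧
      (∀ x ∈ ({lowerEntropyLim μ r, lowerCoarseDim μ r} : Set EReal), x ∈ Set.Ioo (1 : EReal) ⊤) ∧
      ratio r (upperEntropy μ r) ≤ ratio r (lowerEntropyLim μ r) ∧
      ratio r (lowerEntropyLim μ r) ≤ upperQuantDim N ν r ∧
      upperQuantDim N ν r ≤ ratio r (lowerCoarseDim μ r)) := by
  subst hμ
  set μ := rescale ν s b
  have hU := upperEntropy_eq_qCrit hd hr'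
  have hC := upperCoarseDim_eq_qCrit hd hr'
  have hq : qCrit μ r ∈ Set.Ioo (1 : EReal) ⊤ :=
    ⟨one_lt_qCrit hd hcube hr, qCrit_lt_top hd hcube hr'⟩
  obtain ⟨q, hqe, hq1⟩ := exists_coe_of_mem_Ioo hq
  have hD : lowerQuantDim N ν r = ratio r q :=
    (lowerQuantDim_le_ratio_of_neg hd hN hs hr hq1 (hC.trans hqe)).antisymm
      (ratio_le_lowerQuantDim_of_neg hd hN hs hcube hr hq1 hqe)
  refine ⟨⟨?_, by rw [hC], by rw [hD, hqe], by rw [hD, hU, hqe]⟩, fun hF => ?_⟩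
  · rintro x (rfl | rfl | rfl)
    exacts [hC ▸ hq, hq, hU ▸ hq]
  have hLC : lowerCoarseDim μ r ∈ Set.Ioo (1 : EReal) ⊤ :=
    ⟨hF, ((lowerCoarseDim_le_upperCoarseDim μ r).trans_eq hC).trans_lt hq.2⟩
  have hLlim : lowerEntropyLim μ r ∈ Set.Ioo (1 : EReal) ⊤ :=
    ⟨hF.trans_le ((lowerCoarseDim_le_lowerEntropy μ r).trans
      (lowerEntropy_le_lowerEntropyLim hd μ r)), (lowerEntropyLim_le_qCrit hd μ r).trans_lt hq.2⟩
  obtain ⟨l, hle, hl1⟩ := exists_coe_of_mem_Ioo hLlim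
  obtain ⟨f, hfe, hf1⟩ := exists_coe_of_mem_Ioo hLC
  have hlq : l ≤ q := by
    have := lowerEntropyLim_le_qCrit hd μ r
    rw [hle, hqe] at this
    exact_mod_cast this
  refine ⟨tendsto_lowerEntropyLim hd μ r, ?_, ?_, ?_, ?_⟩
  · rintro x (rfl | rfl)
    exacts [hLlim, hLC]
  · rw [hU, hqe, hle]
    exact ratio_anti hr hlq hl1
  · rw [hle]
    exact ratio_le_upperQuantDim_of_neg hd hN hs hcube hr hl1 hle
  · rw [hfe]
    exact upperQuantDim_le_ratio_of_neg hd hN hs hr hf1 hfe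

end Dimensions

section Hausdorff

open scoped NNReal

variable {d : ℕ}

/-! ### The Hausdorff dimension of the measure -/

/-- The union of the cubes of level `n` that satisfy `p`. -/
def cubeUnion (n : ℕ) (p : Set (Fin d → ℝ) → Prop) : Set (Fin d → ℝ) :=
  {x | ∃ Q ∈ dyadicCubes d n, p Q ∧ x ∈ Q}

theorem cubeUnion_eq (n : ℕ) (p : Set (Fin d → ℝ) → Prop) [DecidablePred p] :
    cubeUnion n p = ⋃ Q ∈ (dyadicCubes d n).filter p, Q := by
  ext x
  simp [cubeUnion, and_assoc]

theorem measurableSet_cubeUnion (n : ℕ) (p : Set (Fin d → ℝ) → Prop) :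
    MeasurableSet (cubeUnion n p) := by
  classical
  rw [cubeUnion_eq]
  exact Finset.measurableSet_biUnion _ fun Q hQ =>
    measurableSet_of_mem_dyadicCubes (Finset.mem_filter.1 hQ).1

theorem measure_cubeUnion_le (μ : Measure (Fin d → ℝ)) (n : ℕ) (p : Set (Fin d → ℝ) → Prop)
    [DecidablePred p] :
    μ (cubeUnion n p) ≤ ∑ Q ∈ (dyadicCubes d n).filter p, μ Q := by
  rw [cubeUnion_eq]
  exact measure_biUnion_finset_le _ _

/-- By the Borel–Cantelli lemma, a measurable set of positive measure contains one on which the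
exceptional sets are avoided from some level on. -/
theorem exists_measure_pos_of_summable {μ : Measure (Fin d → ℝ)} (hμ : μ (unitCube d)ᶜ = 0)
    (p : ℕ → Set (Fin d → ℝ) → Prop) (hp : ∑' n, μ (cubeUnion n (p n)) ≠ ⊤)
    {A : Set (Fin d → ℝ)} (hA : MeasurableSet A) (hA0 : 0 < μ A) :
    ∃ k : ℕ, ∃ B ⊆ A, MeasurableSet B ∧ 0 < μ B ∧
      ∀ n ≥ k, ∀ x ∈ B, ∃ Q ∈ dyadicCubes d n, x ∈ Q ∧ ¬ p n Q := by
  set E : ℕ → Set (Fin d → ℝ) := fun k => unitCube d ∩ ⋂ n ≥ k, (cubeUnion n (p n))ᶜ with hE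
  have hEm : ∀ k, MeasurableSet (E k) := fun k =>
    measurableSet_unitCube.inter (MeasurableSet.iInter fun n => MeasurableSet.iInter fun _ =>
      (measurableSet_cubeUnion n (p n)).compl)
  have hfull : ∀ᵐ x ∂μ, x ∈ ⋃ k, E k := by
    have h1 : ∀ᵐ x ∂μ, x ∈ unitCube d := hμ
    filter_upwards [h1, ae_eventually_notMem hp] with x hx hx'
    obtain ⟨k, hk⟩ := eventually_atTop.1 hx'
    exact Set.mem_iUnion.2 ⟨k, hx, Set.mem_iInter₂.2 hk⟩
  have hex : ∃ k, 0 < μ (A ∩ E k) := by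
    by_contra! hcon
    have h0 : μ (A ∩ ⋃ k, E k) = 0 := by
      rw [Set.inter_iUnion]
      exact measure_iUnion_null fun k => le_antisymm (hcon k) zero_le
    have : μ A ≤ μ (A ∩ ⋃ k, E k) := by
      refine measure_mono_ae (hfull.mono fun x hx hxA => ⟨hxA, hx⟩)
    exact absurd (this.trans h0.le) (not_le.2 hA0)
  obtain ⟨k, hk⟩ := hex
  refine ⟨k, A ∩ E k, Set.inter_subset_left, hA.inter (hEm k), hk, fun n hn x hx => ?_⟩
  obtain ⟨Q, hQ, hxQ⟩ := exists_mem_dyadicCubes n hx.2.1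
  refine ⟨Q, hQ, hxQ, fun hpQ => ?_⟩
  exact Set.mem_iInter₂.1 hx.2.2 n hn ⟨Q, hQ, hpQ, hxQ⟩

/-- The mass distribution principle for dyadic cubes. -/
theorem le_dimH_of_measure_le {μ : Measure (Fin d → ℝ)} {t : ℝ≥0} (ht : 0 < t) {k : ℕ}
    {B : Set (Fin d → ℝ)} (hB : MeasurableSet B) (hB0 : 0 < μ B)
    (h : ∀ n ≥ k, ∀ x ∈ B, ∃ Q ∈ dyadicCubes d n, x ∈ Q ∧ μ Q ≤ 2 ^ (-(t : ℝ) * n)) :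
    (t : ℝ≥0∞) ≤ dimH B := by
  classical
  have ht' : (0 : ℝ) < t := by exact_mod_cast ht
  -- a set of diameter below `2 ^ (-n)` meets `B` in at most `3 ^ d` cubes of level `n`
  have key : ∀ (S : Set (Fin d → ℝ)) (n : ℕ), k ≤ n → Metric.ediam S < 2 ^ (-(n : ℝ)) →
      μ (S ∩ B) ≤ 3 ^ d * 2 ^ (-(t : ℝ) * n) := by
    intro S n hn hS
    rcases (S ∩ B).eq_empty_or_nonempty with he | ⟨a, haS, haB⟩
    · simp [he]
    have hsub : S ∩ B ⊆ ⋃ Q ∈ (nearCubes n a).filter fun Q => μ Q ≤ 2 ^ (-(t : ℝ) * n), Q := by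
      rintro x ⟨hxS, hxB⟩
      obtain ⟨Q, hQ, hxQ, hμQ⟩ := h n hn x hxB
      refine Set.mem_biUnion (Finset.mem_coe.2 (Finset.mem_filter.2 ⟨?_, hμQ⟩)) hxQ
      exact mem_nearCubes.2 ⟨hQ, x, hxQ, (Metric.edist_le_ediam_of_mem hxS haS).trans_lt hS⟩
    calc μ (S ∩ B) ≤ ∑ Q ∈ (nearCubes n a).filter fun Q => μ Q ≤ 2 ^ (-(t : ℝ) * n), μ Q :=
          (measure_mono hsub).trans (measure_biUnion_finset_le _ _)
      _ ≤ ∑ Q ∈ (nearCubes n a).filter fun Q => μ Q ≤ 2 ^ (-(t : ℝ) * n),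
          (2 : ℝ≥0∞) ^ (-(t : ℝ) * n) :=
          Finset.sum_le_sum fun Q hQ => (Finset.mem_filter.1 hQ).2
      _ ≤ _ := by
          rw [Finset.sum_const, nsmul_eq_mul]
          gcongr
          exact_mod_cast (Finset.card_filter_le _ _).trans (card_nearCubes_le n a)
  set C : ℝ≥0∞ := 3 ^ d * 2 ^ (t : ℝ) with hC
  have hC0 : C ≠ 0 := mul_ne_zero (by simp) (two_rpow_ne_zero _)
  have hCt : C ≠ ⊤ := ENNReal.mul_ne_top (by simp) (two_rpow_ne_top _)
  have hle : C⁻¹ • μ.restrict B ≤ Measure.hausdorffMeasure (t : ℝ) := by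
    refine Measure.le_hausdorffMeasure _ _ (2 ^ (-(k + 1 : ℝ)))
      (pos_iff_ne_zero.2 (two_rpow_ne_zero _)) fun S hS => ?_
    have hSk : Metric.ediam S < 2 ^ (-(k : ℝ)) :=
      hS.trans_lt (ENNReal.rpow_lt_rpow_of_exponent_lt (by norm_num) (by norm_num) (by linarith))
    rw [Measure.smul_apply, Measure.restrict_apply' hB, smul_eq_mul, ENNReal.inv_mul_le_iff hC0 hCt]
    rcases eq_or_ne (Metric.ediam S) 0 with h0 | h0
    · rw [h0, ENNReal.zero_rpow_of_pos ht', mul_zero]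
      have hlim : Tendsto (fun n : ℕ => (3 : ℝ≥0∞) ^ d * 2 ^ (-(t : ℝ) * n)) atTop (𝓝 0) := by
        have h1 : Tendsto (fun n : ℕ => (2 : ℝ≥0∞) ^ (-(t : ℝ) * n)) atTop (𝓝 0) :=
          (ENNReal.tendsto_rpow_atBot_of_one_lt_base (by norm_num)).comp
            (tendsto_natCast_atTop_atTop.const_mul_atTop_of_neg (by linarith))
        simpa using ENNReal.Tendsto.const_mul h1 (Or.inr (by simp : (3 : ℝ≥0∞) ^ d ≠ ⊤))
      refine ge_of_tendsto hlim ?_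
      filter_upwards [eventually_ge_atTop k] with n hn
      exact key S n hn (by rw [h0]; exact pos_iff_ne_zero.2 (two_rpow_ne_zero _))
    · obtain ⟨j, hkj, hj1, hj2⟩ := exists_scale h0 hSk
      refine (key S j hkj hj2).trans ?_
      calc (3 : ℝ≥0∞) ^ d * 2 ^ (-(t : ℝ) * j) = C * (2 ^ (-(j + 1 : ℝ))) ^ (t : ℝ) := by
            rw [hC, ← ENNReal.rpow_mul, mul_assoc, ← two_rpow_add]
            ring_nf
        _ ≤ _ := by gcongr
  refine le_dimH_of_hausdorffMeasure_ne_zero fun h0 => ?_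
  have h1 := hle B
  rw [Measure.smul_apply, Measure.restrict_apply_self, h0, smul_eq_mul] at h1
  exact absurd (le_antisymm h1 zero_le) (mul_ne_zero (ENNReal.inv_ne_zero.2 hCt) hB0.ne')

/-- Below the slope of the spectrum to the right of `1`: the cubes of large measure form a
negligible set, so that the mass distribution principle applies. -/
theorem le_dimH_of_beta_lt {μ : Measure (Fin d → ℝ)} (hμ : μ (unitCube d)ᶜ = 0) {t : ℝ≥0}
    (ht : 0 < t) {q : ℝ} (hq : 1 < q) (hb : beta μ q < (-(t * (q - 1)) : ℝ))
    {A : Set (Fin d → ℝ)} (hA : MeasurableSet A) (hA0 : 0 < μ A) : (t : ℝ≥0∞) ≤ dimH A := by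
  classical
  obtain ⟨v, hv, hev⟩ := exists_eventually_of_partitionFunction_lt (by linarith : 0 < q) hb
  obtain ⟨n₀, hn₀⟩ := eventually_atTop.1 hev
  -- the exceptional sets start at level `n₀`
  set p : ℕ → Set (Fin d → ℝ) → Prop := fun n Q => n₀ ≤ n ∧ 2 ^ (-(t : ℝ) * n) < μ Q with hp
  have hsum : ∑' n, μ (cubeUnion n (p n)) ≠ ⊤ := by
    refine ne_top_of_le_ne_top (tsum_two_rpow_ne_top (by linarith : v + t * (q - 1) < 0))
      (ENNReal.tsum_le_tsum fun n => ?_)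
    rcases lt_or_ge n n₀ with hn | hn
    · have : cubeUnion n (p n) = ∅ := by
        ext x
        simp [cubeUnion, hp, not_le.2 hn]
      simp [this]
    calc μ (cubeUnion n (p n)) ≤ ∑ Q ∈ (dyadicCubes d n).filter (p n), μ Q :=
          measure_cubeUnion_le _ _ _
      _ ≤ ∑ Q ∈ (dyadicCubes d n).filter (p n), μ Q ^ q * 2 ^ (t * (q - 1) * n) := by
          refine Finset.sum_le_sum fun Q hQ => ?_
          have h1 := (Finset.mem_filter.1 hQ).2.2
          have h2 : (1 : ℝ≥0∞) ≤ μ Q ^ (q - 1) * 2 ^ (t * (q - 1) * n) := by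
            calc (1 : ℝ≥0∞) = (2 ^ (-(t : ℝ) * n)) ^ (q - 1) * 2 ^ (t * (q - 1) * n) := by
                  rw [← ENNReal.rpow_mul, ← two_rpow_add]
                  ring_nf
                  simp
              _ ≤ _ := by gcongr
          calc μ Q ≤ μ Q * (μ Q ^ (q - 1) * 2 ^ (t * (q - 1) * n)) := le_mul_of_one_le_right' h2
            _ = μ Q ^ (1 : ℝ) * μ Q ^ (q - 1) * 2 ^ (t * (q - 1) * n) := by
                rw [ENNReal.rpow_one]; exact (mul_assoc _ _ _).symm
            _ = _ := by
                rw [← ENNReal.rpow_add_of_nonneg _ _ zero_le_one (by linarith)]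
                ring_nf
      _ ≤ (∑ Q ∈ dyadicCubes d n, μ Q ^ q) * 2 ^ (t * (q - 1) * n) := by
          rw [← Finset.sum_mul]
          gcongr
          exact Finset.filter_subset _ _
      _ ≤ 2 ^ (v * n) * 2 ^ (t * (q - 1) * n) := by
          gcongr
          exact hn₀ n hn
      _ = _ := by rw [← two_rpow_add]; ring_nf
  obtain ⟨k, B, hBA, hBm, hB0, hBp⟩ := exists_measure_pos_of_summable hμ p hsum hA hA0
  refine le_trans (le_dimH_of_measure_le ht (k := max k n₀) hBm hB0 fun n hn x hx => ?_)
    (dimH_mono hBA)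
  obtain ⟨Q, hQ, hxQ, hpQ⟩ := hBp n ((le_max_left _ _).trans hn) x hx
  refine ⟨Q, hQ, hxQ, ?_⟩
  by_contra! hlt
  exact hpQ ⟨(le_max_right _ _).trans hn, hlt⟩

/-- Above the slope of the spectrum to the left of `1`: almost every point lies in cubes of large
measure, of which there are few. -/
theorem exists_dimH_le_of_beta_lt {μ : Measure (Fin d → ℝ)} [IsProbabilityMeasure μ]
    (hμ : μ (unitCube d)ᶜ = 0) {t : ℝ≥0} {q : ℝ} (hq0 : 0 < q) (hq : q < 1)
    (hb : beta μ q < (t * (1 - q) : ℝ)) :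
    ∃ A, MeasurableSet A ∧ 0 < μ A ∧ dimH A ≤ t := by
  classical
  obtain ⟨v, hv, hev⟩ := exists_eventually_of_partitionFunction_lt hq0 hb
  obtain ⟨n₀, hn₀⟩ := eventually_atTop.1 hev
  set p : ℕ → Set (Fin d → ℝ) → Prop := fun n Q => n₀ ≤ n ∧ μ Q < 2 ^ (-(t : ℝ) * n) with hp
  have hsum : ∑' n, μ (cubeUnion n (p n)) ≠ ⊤ := by
    refine ne_top_of_le_ne_top (tsum_two_rpow_ne_top (by linarith : v - t * (1 - q) < 0))
      (ENNReal.tsum_le_tsum fun n => ?_)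
    rcases lt_or_ge n n₀ with hn | hn
    · have : cubeUnion n (p n) = ∅ := by
        ext x
        simp [cubeUnion, hp, not_le.2 hn]
      simp [this]
    calc μ (cubeUnion n (p n)) ≤ ∑ Q ∈ (dyadicCubes d n).filter (p n), μ Q :=
          measure_cubeUnion_le _ _ _
      _ ≤ ∑ Q ∈ (dyadicCubes d n).filter (p n), μ Q ^ q * 2 ^ (-(t * (1 - q)) * n) := by
          refine Finset.sum_le_sum fun Q hQ => ?_
          have h1 := (Finset.mem_filter.1 hQ).2.2
          calc μ Q = μ Q ^ (q + (1 - q)) := by rw [add_sub_cancel, ENNReal.rpow_one]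
            _ = μ Q ^ q * μ Q ^ (1 - q) :=
                ENNReal.rpow_add_of_nonneg _ _ hq0.le (by linarith)
            _ ≤ μ Q ^ q * (2 ^ (-(t : ℝ) * n)) ^ (1 - q) := by gcongr
            _ = _ := by
                rw [← ENNReal.rpow_mul]
                ring_nf
      _ ≤ (∑ Q ∈ dyadicCubes d n, μ Q ^ q) * 2 ^ (-(t * (1 - q)) * n) := by
          rw [← Finset.sum_mul]
          gcongr
          exact Finset.filter_subset _ _
      _ ≤ 2 ^ (v * n) * 2 ^ (-(t * (1 - q)) * n) := by
          gcongr
          exact hn₀ n hn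
      _ = _ := by rw [← two_rpow_add]; ring_nf
  obtain ⟨k, B, -, hBm, hB0, hBp⟩ := exists_measure_pos_of_summable hμ p hsum MeasurableSet.univ
    (by simp)
  refine ⟨B, hBm, hB0,
    dimH_le_of_hausdorffMeasure_ne_top (ne_top_of_le_ne_top ENNReal.one_ne_top ?_)⟩
  set G : ℕ → Finset (Set (Fin d → ℝ)) := fun n =>
    (dyadicCubes d n).filter fun Q => 2 ^ (-(t : ℝ) * n) ≤ μ Q with hG
  have hGd : ∀ n, ∀ Q ∈ G n, Q ∈ dyadicCubes d n := fun n Q hQ => (Finset.mem_filter.1 hQ).1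
  have hcard : ∀ n, ((G n).card : ℝ≥0∞) * 2 ^ (-(t : ℝ) * n) ≤ 1 := fun n => by
    rw [← nsmul_eq_mul, ← Finset.sum_const]
    calc _ ≤ ∑ Q ∈ G n, μ Q := Finset.sum_le_sum fun Q hQ => (Finset.mem_filter.1 hQ).2
      _ ≤ ∑ Q ∈ dyadicCubes d n, μ Q := Finset.sum_le_sum_of_subset (Finset.filter_subset _ _)
      _ = 1 := sum_measure_eq_one hμ (isDyadicPartition_dyadicCubes n)
  have hr : Tendsto (fun n : ℕ => (2 : ℝ≥0∞) ^ (-(n : ℝ))) atTop (𝓝 0) :=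
    (ENNReal.tendsto_rpow_atBot_of_one_lt_base (by norm_num)).comp
      (tendsto_neg_atTop_atBot.comp tendsto_natCast_atTop_atTop)
  have hdiam : ∀ n, ∀ i : G n, Metric.ediam (i : Set (Fin d → ℝ)) ≤ (2 : ℝ≥0∞) ^ (-(n : ℝ)) :=
    fun n i => Metric.ediam_le fun x hx y hy =>
      edist_le_of_mem_dyadicCubes (hGd n i i.2) hx hy
  refine (Measure.hausdorffMeasure_le_liminf_sum (ι := fun n => G n) (t : ℝ) B _ hr
    (fun n i => (i : Set (Fin d → ℝ))) (Eventually.of_forall hdiam) ?_).trans ?_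
  · filter_upwards [eventually_ge_atTop (max k n₀)] with n hn x hx
    obtain ⟨Q, hQ, hxQ, hpQ⟩ := hBp n ((le_max_left _ _).trans hn) x hx
    refine Set.mem_iUnion.2 ⟨⟨Q, Finset.mem_filter.2 ⟨hQ, ?_⟩⟩, hxQ⟩
    by_contra! hlt
    exact hpQ ⟨(le_max_right _ _).trans hn, hlt⟩
  · refine liminf_le_of_frequently_le' (Frequently.of_forall fun n => ?_)
    refine le_trans ?_ (hcard n)
    calc ∑ i : G n, Metric.ediam (i : Set (Fin d → ℝ)) ^ (t : ℝ)
        ≤ ∑ _i : G n, (2 : ℝ≥0∞) ^ (-(t : ℝ) * n) := by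
          refine Finset.sum_le_sum fun i _ => ?_
          refine (ENNReal.rpow_le_rpow (hdiam n i) (NNReal.coe_nonneg t)).trans (le_of_eq ?_)
          rw [← ENNReal.rpow_mul]
          congr 1
          ring
      _ = _ := by simp

theorem lipschitzWith_smul_add (s : ℝ) (b : Fin d → ℝ) :
    LipschitzWith ‖s‖₊ fun x : Fin d → ℝ => s • x + b :=
  LipschitzWith.of_dist_le_mul fun x y => by
    rw [dist_add_right, dist_smul₀, coe_nnnorm]

theorem le_dimHMeasure_of_beta_lt {ν : Measure (Fin d → ℝ)} {s : ℝ} {b : Fin d → ℝ} (hs : 0 < s)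
    (hcube : rescale ν s b (unitCube d)ᶜ = 0) {t : ℝ≥0} (ht : 0 < t) {q : ℝ} (hq : 1 < q)
    (hb : beta (rescale ν s b) q < (-(t * (q - 1)) : ℝ)) : (t : ℝ≥0∞) ≤ dimHMeasure ν := by
  refine le_iInf₂ fun A hA => ?_
  -- the image of `A` under the similarity is its preimage under the inverse
  set T' : (Fin d → ℝ) → (Fin d → ℝ) := fun y => s⁻¹ • (y - b) with hT'
  have hT'm : Measurable T' := by fun_prop
  have himage : (fun x => s • x + b) '' A = T' ⁻¹' A := by
    refine congrFun (Set.image_eq_preimage_of_inverse (fun x => ?_) (fun y => ?_)) A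
    · simp [hT', smul_smul, inv_mul_cancel₀ hs.ne']
    · simp [hT', smul_smul, mul_inv_cancel₀ hs.ne']
  refine le_trans ?_ ((lipschitzWith_smul_add s b).dimH_image_le A)
  rw [himage]
  refine le_dimH_of_beta_lt hcube ht hq hb (hT'm hA.1) ?_
  rw [rescale, Measure.map_apply (by fun_prop) (hT'm hA.1), ← Set.preimage_comp]
  have : (T' ∘ fun x : Fin d → ℝ => s • x + b) = id := funext fun x => by
    simp [hT', smul_smul, inv_mul_cancel₀ hs.ne']
  rw [this, Set.preimage_id]
  exact hA.2

theorem dimHMeasure_le_of_beta_lt {ν : Measure (Fin d → ℝ)} [IsProbabilityMeasure ν] {s : ℝ}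
    {b : Fin d → ℝ} (hs : 0 < s) (hcube : rescale ν s b (unitCube d)ᶜ = 0) {t : ℝ≥0} {q : ℝ}
    (hq0 : 0 < q) (hq : q < 1) (hb : beta (rescale ν s b) q < (t * (1 - q) : ℝ)) :
    dimHMeasure ν ≤ t := by
  obtain ⟨A, hA, hA0, hAt⟩ := exists_dimH_le_of_beta_lt hcube hq0 hq hb
  have hTm : Measurable fun x : Fin d → ℝ => s • x + b := by fun_prop
  rw [rescale, Measure.map_apply hTm hA] at hA0
  refine (iInf₂_le_of_le (f := fun (A : Set (Fin d → ℝ)) (_ : MeasurableSet A ∧ 0 < ν A) => dimH A)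
    _ ⟨hTm hA, hA0⟩ ?_).trans hAt
  have himage : (fun x => s • x + b) ⁻¹' A = (fun y => s⁻¹ • y + -(s⁻¹ • b)) '' A := by
    refine (congrFun (Set.image_eq_preimage_of_inverse (fun x => ?_) (fun y => ?_)) A).symm
    · simp [smul_smul, mul_inv_cancel₀ hs.ne']
    · simp [smul_smul, inv_mul_cancel₀ hs.ne']
  rw [himage]
  exact (lipschitzWith_smul_add _ _).dimH_image_le A

end Hausdorff

section OrderZero

open scoped NNReal

variable {d : ℕ}

/-! ### Order zero -/

/-- If `φ r` is the point where `B` crosses the line of slope `r` through the origin, then the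
derivative of `B` at `1` is the reciprocal of the derivative of `φ` at `0`. -/
theorem hasDerivAt_of_crossing {B φ : ℝ → ℝ} {c a : ℝ} (hc : 0 < c) (ha : 0 < a)
    (h1 : ∀ r, -c < r → ∀ q, 0 < q → q < φ r → r * q ≤ B q)
    (h2 : ∀ r, -c < r → ∀ q, 0 < q → φ r < q → B q ≤ r * q)
    (hφ0 : φ 0 = 1) (hB1 : B 1 = 0) (hφ : HasDerivAt φ (-a) 0) : HasDerivAt B (-(1 / a)) 1 := by
  -- compare with the lines through `(1, 0)` of slope `-1 / k`
  have hslope : ∀ k : ℝ, 0 < k →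
      Tendsto (fun q => (φ (-(q - 1) / k) - q) / (q - 1)) (𝓝[≠] 1) (𝓝 (a / k - 1)) := by
    intro k hk
    have hin : HasDerivAt (fun q : ℝ => -(q - 1) / k) (-1 / k) 1 :=
      (((hasDerivAt_id 1).sub_const 1).neg).div_const k
    have hφ' : HasDerivAt φ (-a) (-((1 : ℝ) - 1) / k) := by simpa using hφ
    have h := (hφ'.comp 1 hin).sub (hasDerivAt_id 1)
    rw [hasDerivAt_iff_tendsto_slope] at h
    have he : -a * (-1 / k) - 1 = a / k - 1 := by ring
    rw [he] at h
    refine h.congr fun q => ?_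
    simp [slope_def_field, hφ0]
  have hev : ∀ k : ℝ, 0 < k → ∀ᶠ q in 𝓝[≠] (1 : ℝ), q ≠ 1 ∧ 0 < q ∧ -c < -(q - 1) / k := by
    intro k hk
    refine (eventually_mem_nhdsWithin (a := (1 : ℝ)) (s := {1}ᶜ)).and
      (Eventually.filter_mono nhdsWithin_le_nhds ?_)
    have hcont : ContinuousAt (fun q : ℝ => -(q - 1) / k) 1 := by fun_prop
    exact (lt_mem_nhds one_pos).and (hcont.eventually_const_lt (by simpa using hc))
  have hup : ∀ k : ℝ, a < k → ∀ᶠ q in 𝓝[≠] (1 : ℝ), slope B 1 q ≤ -q / k := by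
    intro k hk
    have hk0 : 0 < k := ha.trans hk
    have hneg : a / k - 1 < 0 := sub_neg.2 ((div_lt_one hk0).2 hk)
    filter_upwards [hev k hk0, (hslope k hk0).eventually_lt_const hneg] with q ⟨hq1, hq0, hqc⟩ hs
    rw [slope_def_field, hB1, sub_zero]
    rcases lt_or_gt_of_ne hq1 with hlt | hgt
    · rw [div_le_iff_of_neg (by linarith)]
      have h3 : q < φ (-(q - 1) / k) := by
        by_contra! hcon
        exact absurd hs (not_lt.2 (div_nonneg_of_nonpos (by linarith) (by linarith)))
      exact (le_of_eq (by ring)).trans (h1 _ hqc q hq0 h3)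
    · rw [div_le_iff₀ (by linarith)]
      have h3 : φ (-(q - 1) / k) < q := by
        by_contra! hcon
        exact absurd hs (not_lt.2 (div_nonneg (by linarith) (by linarith)))
      exact (h2 _ hqc q hq0 h3).trans (le_of_eq (by ring))
  have hlow : ∀ k : ℝ, 0 < k → k < a → ∀ᶠ q in 𝓝[≠] (1 : ℝ), -q / k ≤ slope B 1 q := by
    intro k hk0 hk
    have hpos : 0 < a / k - 1 := sub_pos.2 ((one_lt_div hk0).2 hk)
    filter_upwards [hev k hk0, (hslope k hk0).eventually_const_lt hpos] with q ⟨hq1, hq0, hqc⟩ hs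
    rw [slope_def_field, hB1, sub_zero]
    rcases lt_or_gt_of_ne hq1 with hlt | hgt
    · rw [le_div_iff_of_neg (by linarith)]
      have h3 : φ (-(q - 1) / k) < q := by
        by_contra! hcon
        exact absurd hs (not_lt.2 (div_nonpos_of_nonneg_of_nonpos (by linarith) (by linarith)))
      exact (h2 _ hqc q hq0 h3).trans (le_of_eq (by ring))
    · rw [le_div_iff₀ (by linarith)]
      have h3 : q < φ (-(q - 1) / k) := by
        by_contra! hcon
        exact absurd hs (not_lt.2 (div_nonpos_of_nonpos_of_nonneg (by linarith) (by linarith)))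
      exact (le_of_eq (by ring)).trans (h1 _ hqc q hq0 h3)
  have hk : ContinuousAt (fun k : ℝ => -1 / k) a := by
    have := ha.ne'
    fun_prop (disch := assumption)
  have hline : ∀ k : ℝ, Tendsto (fun q : ℝ => -q / k) (𝓝[≠] 1) (𝓝 (-1 / k)) := fun k =>
    ((by fun_prop : Continuous fun q : ℝ => -q / k).tendsto 1).mono_left nhdsWithin_le_nhds
  rw [hasDerivAt_iff_tendsto_slope, ← neg_div]
  refine tendsto_order.2 ⟨fun y hy => ?_, fun y hy => ?_⟩
  · obtain ⟨k, hky, hk0, hka⟩ := (((hk.eventually_const_lt hy).filter_mono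
      nhdsWithin_le_nhds).and (Ioo_mem_nhdsLT ha)).exists
    filter_upwards [hlow k hk0 hka, (hline k).eventually_const_lt hky] with q hq1 hq2
    exact hq2.trans_le hq1
  · obtain ⟨k, hky, hka⟩ := (((hk.eventually_lt_const hy).filter_mono
      nhdsWithin_le_nhds).and (self_mem_nhdsWithin (s := Set.Ioi a))).exists
    filter_upwards [hup k hka, (hline k).eventually_lt_const hky] with q hq1 hq2
    exact hq1.trans_lt hq2

/-- The quotient `r φ r / (1 - φ r)` is `φ r` divided by the negative of the difference quotient
of `φ` at `0`. -/
theorem tendsto_ratio_zero {φ : ℝ → ℝ} {a : ℝ} (ha : 0 < a) (hφ0 : φ 0 = 1)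
    (hφ : HasDerivAt φ (-a) 0) :
    Tendsto (fun r => ratio r (φ r)) (𝓝[≠] 0) (𝓝 ((1 / a : ℝ) : EReal)) := by
  have h1 : Tendsto φ (𝓝[≠] 0) (𝓝 1) := hφ0 ▸ hφ.continuousAt.tendsto.mono_left nhdsWithin_le_nhds
  have h2 := (hasDerivAt_iff_tendsto_slope.1 hφ).neg
  rw [neg_neg] at h2
  refine ((continuous_coe_real_ereal.tendsto _).comp (h1.div h2 ha.ne')).congr fun r => ?_
  rw [ratio_coe, Function.comp_apply, Pi.div_apply, slope_def_field, hφ0, sub_zero, ← neg_div,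
    neg_sub, div_div_eq_mul_div, mul_comm]

/-- Once the spectrum has crossed the line of slope `r` it stays below it, because its slopes are
less than `r`. -/
theorem beta_lt_of_qCrit_lt (hd : 0 < d) {μ : Measure (Fin d → ℝ)} {r q : ℝ}
    (hr : -(dimInfty μ) < (r : EReal)) (h : qCrit μ r < q) : beta μ q < (r * q : ℝ) := by
  obtain ⟨p, hp0, hpq, hb⟩ := exists_of_qCrit_lt hd h
  have hpq' : p < q := by exact_mod_cast hpq
  obtain ⟨c, hc1, hc2⟩ := EReal.lt_iff_exists_real_btwn.1 (EReal.neg_lt_comm.1 hr)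
  have hcr : -r < c := by exact_mod_cast hc1
  refine (beta_le_sub hc2 hp0 hpq'.le hb).trans_le (EReal.coe_le_coe_iff.2 ?_)
  nlinarith [mul_nonneg (by linarith : 0 ≤ c + r) (by linarith : 0 ≤ q - p)]

section CriticalValue

variable {μ : Measure (Fin d → ℝ)} [IsProbabilityMeasure μ]

theorem beta_ne_top (hμ : μ (unitCube d)ᶜ = 0) {q : ℝ} (hq : 0 < q) : beta μ q ≠ ⊤ := by
  rcases le_total q 1 with h | h
  · exact ne_top_of_le_ne_top (EReal.coe_ne_top _) (beta_le_of_le_one hμ hq h)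
  · refine ne_top_of_lt (beta_le_sub (c := -1) (b := 1) ?_ one_pos h ?_)
    · exact lt_of_lt_of_le (by exact_mod_cast neg_one_lt_zero) (dimInfty_nonneg μ)
    · rw [beta_one hμ]
      exact_mod_cast one_pos

theorem beta_ne_bot (hμ : μ (unitCube d)ᶜ = 0) {q : ℝ} (hq : 0 < q) : beta μ q ≠ ⊥ := by
  rcases le_total q 1 with h | h
  · exact ne_bot_of_le_ne_bot EReal.zero_ne_bot (beta_nonneg_of_le_one hμ hq h)
  · exact ne_bot_of_le_ne_bot (EReal.coe_ne_bot _) (le_beta_of_one_le hμ h)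

theorem coe_toReal_qCrit (hd : 0 < d) (hμ : μ (unitCube d)ᶜ = 0) {r : ℝ}
    (hr : -(dimInfty μ) < (r : EReal)) : ((qCrit μ r).toReal : EReal) = qCrit μ r :=
  EReal.coe_toReal (qCrit_lt_top hd hμ hr).ne
    (ne_bot_of_le_ne_bot EReal.zero_ne_bot (qCrit_nonneg μ r))

theorem qCrit_zero (hd : 0 < d) (hμ : μ (unitCube d)ᶜ = 0) (h0 : 0 < dimInfty μ) :
    qCrit μ 0 = 1 := by
  refine le_antisymm ?_ (le_qCrit hd fun q hq hb => ?_)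
  · obtain ⟨c, hc1, hc2⟩ := EReal.lt_iff_exists_real_btwn.1 h0
    have hc : 0 < c := by exact_mod_cast hc1
    refine EReal.le_of_forall_lt_iff_le.1 fun q hq => ?_
    have hq1 : 1 < q := by exact_mod_cast hq
    refine qCrit_le hd (by linarith) ?_
    have := beta_le_sub (b := c * (q - 1)) hc2 one_pos hq1.le (by
      rw [beta_one hμ]
      exact_mod_cast mul_pos hc (by linarith : 0 < q - 1))
    simpa using this
  · by_contra! hlt
    have hlt' : q < 1 := by exact_mod_cast hlt
    have := (beta_nonneg_of_le_one hμ hq hlt'.le).trans_lt hb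
    simp at this

end CriticalValue

variable {N : Seminorm ℝ (Fin d → ℝ)} {ν : Measure (Fin d → ℝ)} {s : ℝ} {b : Fin d → ℝ}

/-- The quantization dimension of order zero and the Hausdorff dimension. -/
theorem quantDim_zero [IsProbabilityMeasure ν] (hd : 0 < d) (hN : ∀ x, N x = 0 → x = 0)
    (hs : 0 < s) {μ : Measure (Fin d → ℝ)} (hμ : μ = rescale ν s b)
    (hcube : μ (unitCube d)ᶜ = 0) (h0 : 0 < dimInfty μ)
    (hdiff : DifferentiableAt ℝ (fun r : ℝ => (qCrit μ r).toReal) 0) :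
    ∃ β' : ℝ, (∀ᶠ q in 𝓝 (1 : ℝ), beta μ q ≠ ⊤ ∧ beta μ q ≠ ⊥) ∧
      HasDerivAt (fun q : ℝ => (beta μ q).toReal) β' 1 ∧
      lowerQuantDim N ν 0 = ((-β' : ℝ) : EReal) ∧ upperQuantDim N ν 0 = ((-β' : ℝ) : EReal) ∧
      ((dimHMeasure ν : ENNReal) : EReal) = ((-β' : ℝ) : EReal) := by
  have : IsProbabilityMeasure μ := hμ ▸ inferInstance
  have hcont := (exists_norm_bounds N hN).1
  obtain ⟨c, hc1, hc2⟩ := EReal.lt_iff_exists_real_btwn.1 h0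
  have hc : 0 < c := by exact_mod_cast hc1
  have hrc : ∀ r : ℝ, -c < r → -(dimInfty μ) < (r : EReal) := fun r hr =>
    EReal.neg_lt_comm.1 (lt_of_le_of_lt (by exact_mod_cast (neg_lt.1 hr).le) hc2)
  set φ : ℝ → ℝ := fun r => (qCrit μ r).toReal with hφdef
  have hφ : ∀ r, -c < r → (φ r : EReal) = qCrit μ r := fun r hr =>
    coe_toReal_qCrit hd hcube (hrc r hr)
  have hφ0 : φ 0 = 1 := by simp [hφdef, qCrit_zero hd hcube h0]
  obtain ⟨a, ha⟩ : ∃ a, deriv φ 0 = -a := ⟨-deriv φ 0, (neg_neg _).symm⟩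
  have hder : HasDerivAt φ (-a) 0 := ha ▸ hdiff.hasDerivAt
  -- the critical value grows at least at rate `1 / d` to the left of `0`
  have ha0 : 0 < a := by
    have hd' : (0 : ℝ) < d := by exact_mod_cast hd
    have hle : -a ≤ -(1 / d) := by
      refine le_of_tendsto ((hasDerivAt_iff_tendsto_slope.1 hder).mono_left
        (nhdsLT_le_nhdsNE 0)) ?_
      filter_upwards [Ioo_mem_nhdsLT (neg_lt_zero.2 hc)] with r hr
      have h := one_add_le_qCrit hd hcube hr.2
      rw [← hφ r hr.1, EReal.coe_le_coe_iff] at h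
      rw [slope_def_field, hφ0, sub_zero, div_le_iff_of_neg hr.2]
      calc -(1 / (d : ℝ)) * r = -r / d := by ring
        _ ≤ _ := by linarith
    have : (0 : ℝ) < 1 / d := by positivity
    linarith
  have hfin : ∀ q : ℝ, 0 < q → ((beta μ q).toReal : EReal) = beta μ q := fun q hq =>
    EReal.coe_toReal (beta_ne_top hcube hq) (beta_ne_bot hcube hq)
  have hβ : HasDerivAt (fun q : ℝ => (beta μ q).toReal) (-(1 / a)) 1 := by
    refine hasDerivAt_of_crossing hc ha0 (fun r hr q hq h => ?_) (fun r hr q hq h => ?_) hφ0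
      (by simp [beta_one hcube]) hder
    · rw [← EReal.coe_le_coe_iff, hfin q hq]
      exact le_beta_of_lt_qCrit hd hq (by rw [← hφ r hr]; exact_mod_cast h)
    · rw [← EReal.coe_le_coe_iff, hfin q hq]
      exact (beta_lt_of_qCrit_lt hd (hrc r hr) (by rw [← hφ r hr]; exact_mod_cast h)).le
  have hratio := tendsto_ratio_zero ha0 hφ0 hder
  have hU : upperQuantDim N ν 0 ≤ ((1 / a : ℝ) : EReal) := by
    refine ge_of_tendsto (hratio.mono_left (nhdsGT_le_nhdsNE 0)) ?_
    filter_upwards [self_mem_nhdsWithin] with r (hr : 0 < r)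
    rw [hφ r (by linarith), ← (quantDim_of_pos hd hN hs hμ hcube hr).2.2.2.2.2.2.1]
    refine limsup_le_limsup ?_ (by isBoundedDefault) (by isBoundedDefault)
    filter_upwards [eventually_quantError_lt_one hd hN hs (hμ ▸ hcube) r] with n hn
    exact EReal.coe_le_coe_iff.2 (quantRatio_mono (quantError_zero_le hcont hr n) hn)
  have hL : ((1 / a : ℝ) : EReal) ≤ lowerQuantDim N ν 0 := by
    refine le_of_tendsto (hratio.mono_left (nhdsLT_le_nhdsNE 0)) ?_
    filter_upwards [Ioo_mem_nhdsLT (neg_lt_zero.2 hc)] with r hr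
    rw [hφ r hr.1, (quantDim_of_neg hd hN hs hμ hcube (hrc r hr.1) hr.2).1.2.2.1]
    refine liminf_le_liminf ?_ (by isBoundedDefault) (by isBoundedDefault)
    filter_upwards [eventually_quantError_lt_one hd hN hs (hμ ▸ hcube) 0] with n hn
    exact EReal.coe_le_coe_iff.2 (quantRatio_mono (quantError_le_zero hcont hr.2 n) hn)
  have hLU : lowerQuantDim N ν 0 ≤ upperQuantDim N ν 0 :=
    liminf_le_limsup (by isBoundedDefault) (by isBoundedDefault)
  have hone : (beta μ 1).toReal = 0 := by simp [beta_one hcube]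
  have hslope : Tendsto (fun q => (beta μ q).toReal / (q - 1)) (𝓝[≠] 1) (𝓝 (-(1 / a))) :=
    (hasDerivAt_iff_tendsto_slope.1 hβ).congr fun q => by rw [slope_def_field, hone, sub_zero]
  have hH : dimHMeasure ν = ((1 / a).toNNReal : ℝ≥0∞) := by
    have ha1 : ((1 / a).toNNReal : ℝ) = 1 / a := Real.coe_toNNReal _ (by positivity)
    refine le_antisymm (le_of_forall_gt_imp_ge_of_dense fun u hu => ?_)
      (ENNReal.le_of_forall_nnreal_lt fun t ht => ?_)
    · obtain ⟨t, ht, htu⟩ := ENNReal.lt_iff_exists_nnreal_btwn.1 hu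
      have ht' : -(t : ℝ) < -(1 / a) := by
        rw [neg_lt_neg_iff, ← ha1]
        exact_mod_cast ht
      obtain ⟨q, hq, hq0, hq1⟩ := (((hslope.eventually_const_lt ht').filter_mono
        (nhdsLT_le_nhdsNE 1)).and (Ioo_mem_nhdsLT one_pos)).exists
      rw [lt_div_iff_of_neg (by linarith)] at hq
      refine (dimHMeasure_le_of_beta_lt hs (hμ ▸ hcube) hq0 hq1 ?_).trans htu.le
      rw [← hμ, ← hfin q hq0, EReal.coe_lt_coe_iff]
      linarith
    · rcases eq_or_ne t 0 with rfl | ht0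
      · simp
      have ht' : -(1 / a) < -(t : ℝ) := by
        rw [neg_lt_neg_iff, ← ha1]
        exact_mod_cast ht
      obtain ⟨q, hq, hq1⟩ := (((hslope.eventually_lt_const ht').filter_mono
        (nhdsGT_le_nhdsNE 1)).and (self_mem_nhdsWithin (s := Set.Ioi (1 : ℝ)))).exists
      have hq1' : 1 < q := hq1
      rw [div_lt_iff₀ (by linarith)] at hq
      refine le_dimHMeasure_of_beta_lt hs (hμ ▸ hcube) (pos_iff_ne_zero.2 ht0) hq1' ?_
      rw [← hμ, ← hfin q (by linarith), EReal.coe_lt_coe_iff]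
      linarith
  refine ⟨-(1 / a), ?_, hβ, ?_, ?_, ?_⟩
  · filter_upwards [lt_mem_nhds one_pos] with q hq
    exact ⟨beta_ne_top hcube hq, beta_ne_bot hcube hq⟩
  · rw [neg_neg]
    exact le_antisymm (hLU.trans hU) hL
  · rw [neg_neg]
    exact le_antisymm hU (hL.trans hLU)
  · rw [neg_neg, hH]
    change ((ENNReal.ofReal (1 / a) : ℝ≥0∞) : EReal) = _
    rw [EReal.coe_ennreal_ofReal, max_eq_left (by positivity)]

end OrderZero

end Quantization

theorem theorem1p6 {d : ℕ} (hd : 0 < d)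
    (N : Seminorm ℝ (Fin d → ℝ)) (hN : ∀ x, N x = 0 → x = 0)
    (ν : MeasureTheory.Measure (Fin d → ℝ)) [MeasureTheory.IsProbabilityMeasure ν]
    (hcompact : ∃ K : Set (Fin d → ℝ), IsCompact K ∧ ν Kᶜ = 0)
    -- normalization: `μ` is the image of `ν` under `x ↦ s x + b` and lives on the unit cube
    (s : ℝ) (hs : 0 < s) (b : Fin d → ℝ)
    (μ : MeasureTheory.Measure (Fin d → ℝ)) (hμ : μ = Quantization.rescale ν s b)
    (hcube : μ (Quantization.unitCube d)ᶜ = 0) :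
    -- positive order
    (∀ r : ℝ, 0 < r →
      Tendsto (fun ε => Quantization.lowerEntropy μ (r - ε)) (𝓝[>] (0 : ℝ))
        (𝓝 (Quantization.lowerEntropyLim μ r)) ∧
      (∀ x ∈ ({Quantization.lowerCoarseDim μ r, Quantization.lowerEntropyLim μ r,
          Quantization.upperEntropy μ r, Quantization.qCrit μ r,
          Quantization.upperCoarseDim μ r} : Set EReal), x ∈ Set.Ico (0 : EReal) 1) ∧
      Quantization.ratio r (Quantization.lowerCoarseDim μ r)
        ≤ Quantization.lowerQuantDim N ν r ∧
      Quantization.lowerQuantDim N ν r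
        ≤ Quantization.ratio r (Quantization.lowerEntropyLim μ r) ∧
      Quantization.ratio r (Quantization.lowerEntropyLim μ r)
        ≤ Quantization.ratio r (Quantization.upperEntropy μ r) ∧
      Quantization.ratio r (Quantization.upperEntropy μ r)
        = Quantization.upperQuantDim N ν r ∧
      Quantization.upperQuantDim N ν r = Quantization.ratio r (Quantization.qCrit μ r) ∧
      Quantization.ratio r (Quantization.qCrit μ r)
        = Quantization.ratio r (Quantization.upperCoarseDim μ r)) ∧
    -- negative order
    (∀ r : ℝ, -(Quantization.dimInfty μ) < (r : EReal) → r < 0 →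
      ((∀ x ∈ ({Quantization.upperCoarseDim μ r, Quantization.qCrit μ r,
          Quantization.upperEntropy μ r} : Set EReal), x ∈ Set.Ioo (1 : EReal) ⊤) ∧
        Quantization.ratio r (Quantization.upperCoarseDim μ r)
          = Quantization.ratio r (Quantization.qCrit μ r) ∧
        Quantization.ratio r (Quantization.qCrit μ r) = Quantization.lowerQuantDim N ν r ∧
        Quantization.lowerQuantDim N ν r
          = Quantization.ratio r (Quantization.upperEntropy μ r)) ∧
      (1 < Quantization.lowerCoarseDim μ r →
        Tendsto (fun ε => Quantization.lowerEntropy μ (r - ε)) (𝓝[>] (0 : ℝ))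
          (𝓝 (Quantization.lowerEntropyLim μ r)) ∧
        (∀ x ∈ ({Quantization.lowerEntropyLim μ r, Quantization.lowerCoarseDim μ r} : Set EReal),
          x ∈ Set.Ioo (1 : EReal) ⊤) ∧
        Quantization.ratio r (Quantization.upperEntropy μ r)
          ≤ Quantization.ratio r (Quantization.lowerEntropyLim μ r) ∧
        Quantization.ratio r (Quantization.lowerEntropyLim μ r)
          ≤ Quantization.upperQuantDim N ν r ∧
        Quantization.upperQuantDim N ν r
          ≤ Quantization.ratio r (Quantization.lowerCoarseDim μ r))) ∧
    -- order zero
    (0 < Quantization.dimInfty μ →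
      DifferentiableAt ℝ (fun r : ℝ => (Quantization.qCrit μ r).toReal) 0 →
      ∃ β' : ℝ,
        (∀ᶠ q in 𝓝 (1 : ℝ), Quantization.beta μ q ≠ ⊤ ∧ Quantization.beta μ q ≠ ⊥) ∧
        HasDerivAt (fun q : ℝ => (Quantization.beta μ q).toReal) β' 1 ∧
        Quantization.lowerQuantDim N ν 0 = ((-β' : ℝ) : EReal) ∧
        Quantization.upperQuantDim N ν 0 = ((-β' : ℝ) : EReal) ∧
        ((Quantization.dimHMeasure ν : ENNReal) : EReal) = ((-β' : ℝ) : EReal)) := by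
  exact ⟨fun r hr => Quantization.quantDim_of_pos hd hN hs hμ hcube hr,
    fun r hr' hr => Quantization.quantDim_of_neg hd hN hs hμ hcube hr' hr,
    fun h0 hdiff => Quantization.quantDim_zero hd hN hs hμ hcube h0 hdiff⟩
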